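/- Let $\mathbb T$ be the unit circle, $1<p<\infty$, $1/p+1/q=1$, and let $H^r=\{f\in L^r(\mathbb T):\hat f_n=0 \text{ for all } n<0\}$ for $r\in\{p,q\}$. Let $P:\sum_{n\in\mathbb Z}\hat f_nt^n\mapsto\sum_{n\ge 0}\hat f_nt^n$ be the projection of $L^r$ onto $H^r$ and $Q=I-P$. Fix $\beta\in\mathbb C$ with $|\beta|>1$ and put $$\alpha(t)=\frac{t-\beta}{\overline\beta t-1},\quad \lambda=i\sqrt{|\beta|^2-1},\quad \alpha_-(t)=\frac{\lambda t}{\overline\beta t-1},\quad (J_\alpha f)(t)=t^{-1}\alpha_-(t)f(\alpha(t)),\quad g_\alpha=g\circ\alpha .$$ For $g\in L^\infty$ define on $H^r$ the operators $T(g)f=P(gf)$ and $H_\alpha(g)f=P(g\,QJ_\alpha f)$. The cokernel of a bounded operator $A$ on $H^p$ is the kernel of its adjoint, which acts on $H^q$ through the pairing $\langle f,g\rangle=\int f\overline g$, that is, $\operatorname{coker}A=\{g\in H^q:\langle Af,g\rangle=0\ \text{for all } f\in H^p\}$. Let $a,b\in L^\infty$ with $a$ invertible in $L^\infty$ and $a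 a_\alpha=b b_\alpha$ (an $\alpha$-matching pair), let $c=ab^{-1}$, $d=ba_\alpha^{-1}$ be the subordinated pair, and assume that the pair is Fredholm, i.e. that $T(c)$ and $T(d)$ are Fredholm on $H^p$; put $\kappa_1=\operatorname{ind}T(c)$, $\kappa_2=\operatorname{ind}T(d)$. Note that $(\overline a,\overline b_\alpha)$ is a matching pair with subordinated pair $(\overline d,\overline c)$. For a function $g\in L^\infty$ with $gg_\alpha=1$ let $\mathbf P_\alpha^{\pm}(g)=\tfrac12(I\pm J_\alpha QgP)$ on $\ker T(g)$. If $T(g)$ is Fredholm of index $\kappa\ge 0$, put $T_r^{-1}(g)=T(gt^{\kappa})^{-1}T(t^{\kappa})$. Whenever $\operatorname{ind}T(c)\ge0$, define the maps $\varphi_\alpha^\pm$ of the pair $(a,b)$ by $$2\varphi_\alpha^{\pm}(s)=T_r^{-1}(c)T(a_\alpha^{-1})s\mp J_\alpha QcP\,T_r^{-1}(c)T(a_\alpha^{-1})s\pm J_\alpha Qa_\alpha^{-1}s ,$$ and similarly for any other matching pair in place of $(a,b)$. Write $\dotplus$ for a direct sum of subspaces. Then: (i) If $\kappa_1\ge 0$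 and $\kappa_2\ge 1$, then $T_r^{-1}(c)$ is a right inverse of $T(c)$, the operators $T(a)\pm H_\alpha(b)$ on $H^p$ are right-invertible, and $$\ker(T(a)\pm H_\alpha(b))=\operatorname{im}\mathbf P_\alpha^{\mp}(c)\dotplus\varphi_\alpha^{\pm}(\operatorname{im}\mathbf P_\alpha^{\pm}(d)).$$ (ii) If $\kappa_1\le -1$ and $\kappa_2\le 0$, then $T_r^{-1}(\overline d)$ is a right inverse of $T(\overline d)$ on $H^q$, the operators $T(a)\pm H_\alpha(b)$ on $H^p$ are left-invertible, and $$\operatorname{coker}(T(a)\pm H_\alpha(b))=\operatorname{im}\mathbf P_\alpha^{\mp}(\overline d)\dotplus\varphi_\alpha^{\pm}(\operatorname{im}\mathbf P_\alpha^{\pm}(\overline c)),$$ where all spaces on the right are formed on $H^q$ and $\varphi_\alpha^\pm$ is taken for the pair $(\overline a,\overline b_\alpha)$; moreover $\operatorname{im}\mathbf P_\alpha^{\pm}(\overline d)=\{0\}$ if $\kappa_2=0$. (iii) If $\kappa_1\ge 0$ and $\kappa_2\le 0$, then $$\ker(T(a)\pm H_\alpha(b))=\operatorname{im}\mathbf P_\alpha^{\mp}(c),\qquad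 \operatorname{coker}(T(a)\pm H_\alpha(b))=\operatorname{im}\mathbf P_\alpha^{\mp}(\overline d),$$ with the last space formed on $H^q$. -/

import Mathlib

open MeasureTheory Complex
open scoped ENNReal ComplexConjugate

noncomputable section

namespace AlphaTH

/-! ### The unit circle and its Lebesgue spaces -/

instance instMeasurableSpaceCircle : MeasurableSpace Circle := borel Circle

instance instBorelSpaceCircle : BorelSpace Circle := ⟨rfl⟩

/-- Normalised arc length measure `|dt| / (2π)` on the unit circle. -/
def arc : Measure Circle :=
  (ENNReal.ofReal (2 * Real.pi))⁻¹ •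
    Measure.map Circle.exp (volume.restrict (Set.Ioc 0 (2 * Real.pi)))

instance instIsFiniteMeasureArc : IsFiniteMeasure arc := by
  unfold arc
  have : IsFiniteMeasure (volume.restrict (Set.Ioc 0 (2 * Real.pi))) :=
    ⟨by rw [Measure.restrict_apply_univ]; exact measure_Ioc_lt_top⟩
  refine ⟨?_⟩
  rw [Measure.smul_apply, smul_eq_mul]
  refine ENNReal.mul_lt_top ?_ (measure_lt_top _ _)
  exact ENNReal.inv_lt_top.2 (ENNReal.ofReal_pos.2 Real.two_pi_pos)

/-- The `n`-th Fourier coefficient `(1/2π) ∫₀^{2π} f(e^{iθ}) e^{-inθ} dθ`. -/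
def fcoef (f : Circle → ℂ) (n : ℤ) : ℂ := ∫ t, f t * (t : ℂ) ^ (-n) ∂arc

lemma integrable_mul_zpow {p : ℝ≥0∞} [hp : Fact (1 ≤ p)] (f : Lp ℂ p arc) (n : ℤ) :
    Integrable (fun t : Circle => f t * (t : ℂ) ^ (-n)) arc := by
  have h1 : Integrable (f : Circle → ℂ) arc := (Lp.memLp f).integrable hp.out
  have hc : Continuous (fun t : Circle => (t : ℂ) ^ (-n)) :=
    Continuous.zpow₀ (by fun_prop) _ (fun t => Or.inl (Circle.coe_ne_zero t))
  exact h1.mul_bdd (c := 1) hc.aestronglyMeasurable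
    (Filter.Eventually.of_forall fun t => by rw [norm_zpow, Circle.norm_coe, one_zpow])

/-- The Hardy space `H^p`: the functions in `L^p` whose Fourier coefficients of negative index
vanish. -/
def Hardy (p : ℝ≥0∞) [Fact (1 ≤ p)] : Submodule ℂ (Lp ℂ p arc) where
  carrier := {f | ∀ n : ℤ, n < 0 → fcoef f n = 0}
  zero_mem' := by
    intro n _
    unfold fcoef
    rw [integral_eq_zero_of_ae]
    filter_upwards [Lp.coeFn_zero ℂ p arc] with t ht
    simp only [ht, Pi.zero_apply, zero_mul]
  add_mem' := by
    intro f g hf hg n hn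
    have h : fcoef (f + g : Lp ℂ p arc) n = fcoef f n + fcoef g n := by
      unfold fcoef
      rw [← integral_add (integrable_mul_zpow f n) (integrable_mul_zpow g n)]
      refine integral_congr_ae ?_
      filter_upwards [Lp.coeFn_add f g] with t ht
      simp only [ht, Pi.add_apply, add_mul]
    rw [h, hf n hn, hg n hn, add_zero]
  smul_mem' := by
    intro c f hf n hn
    have h : fcoef (c • f : Lp ℂ p arc) n = c * fcoef f n := by
      unfold fcoef
      rw [← integral_const_mul]
      refine integral_congr_ae ?_
      filter_upwards [Lp.coeFn_smul c f] with t ht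
      simp [ht, mul_assoc]
    rw [h, hf n hn, mul_zero]

/-! ### The shift `α` -/

section Shift

lemma denom_ge (β : ℂ) (t : Circle) : ‖β‖ - 1 ≤ ‖conj β * (t : ℂ) - 1‖ := by
  have := norm_sub_norm_le (conj β * (t : ℂ)) 1
  rwa [norm_mul, RCLike.norm_conj, Circle.norm_coe, mul_one, norm_one] at this

lemma denom_ne_zero (β : ℂ) [hβ : Fact (1 < ‖β‖)] (t : Circle) : conj β * (t : ℂ) - 1 ≠ 0 := by
  have h := denom_ge β t
  have h1 := hβ.out
  intro h0
  rw [h0, norm_zero] at h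
  linarith

lemma norm_num_eq (β : ℂ) (t : Circle) : ‖(t : ℂ) - β‖ = ‖conj β * (t : ℂ) - 1‖ := by
  have h : conj β * (t : ℂ) - 1 = (t : ℂ) * conj (β - t) := by
    have h2 : (t : ℂ) * conj (t : ℂ) = 1 := by
      rw [Complex.mul_conj, Circle.normSq_coe]; simp
    rw [map_sub, mul_sub, h2]; ring
  rw [h, norm_mul, Circle.norm_coe, one_mul, RCLike.norm_conj, norm_sub_rev]

variable (β : ℂ) [hβ : Fact (1 < ‖β‖)]

/-- The shift `α(t) = (t - β) / (conj β * t - 1)` of the unit circle. -/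
def alpha (t : Circle) : Circle :=
  ⟨((t : ℂ) - β) / (conj β * (t : ℂ) - 1), mem_sphere_zero_iff_norm.2 <| by
    rw [norm_div, norm_num_eq,
      div_self (norm_ne_zero_iff.2 (denom_ne_zero β t))]⟩

/-- `λ = i √(|β|² - 1)`. -/
def lam : ℂ := I * (Real.sqrt (‖β‖ ^ 2 - 1) : ℂ)

/-- `α₋(t) = λ t / (conj β * t - 1)`. -/
def alphaMinus (t : Circle) : ℂ := lam β * (t : ℂ) / (conj β * (t : ℂ) - 1)

lemma coe_alpha (t : Circle) :
    (alpha β t : ℂ) = ((t : ℂ) - β) / (conj β * (t : ℂ) - 1) := rfl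

lemma alpha_alpha (t : Circle) : alpha β (alpha β t) = t := by
  have h1 := denom_ne_zero β t
  have h2 := denom_ne_zero β (alpha β t)
  ext
  rw [coe_alpha, div_eq_iff h2, coe_alpha, sub_eq_iff_eq_add, div_eq_iff h1]
  have h3 : conj β * (((t : ℂ) - β) / (conj β * (t : ℂ) - 1)) * (conj β * (t : ℂ) - 1) =
      conj β * ((t : ℂ) - β) := by
    rw [mul_assoc, div_mul_cancel₀ _ h1]
  linear_combination -(t : ℂ) * h3

lemma alpha_lipschitz :
    LipschitzWith (Real.toNNReal ((‖β‖ + 1) / (‖β‖ - 1))) (alpha β) := by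
  have hb := hβ.out
  refine LipschitzWith.of_dist_le_mul fun s t => ?_
  rw [Real.coe_toNNReal _ (div_nonneg (by linarith) (by linarith))]
  have h1 := denom_ne_zero β s
  have h2 := denom_ne_zero β t
  have e : (alpha β s : ℂ) - (alpha β t : ℂ) =
      (β * conj β - 1) * ((s : ℂ) - t) /
        ((conj β * (s : ℂ) - 1) * (conj β * (t : ℂ) - 1)) := by
    rw [coe_alpha, coe_alpha, div_sub_div _ _ h1 h2]
    congr 1
    ring
  have e2 : ‖β * conj β - 1‖ = (‖β‖ + 1) * (‖β‖ - 1) := by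
    rw [Complex.mul_conj, Complex.normSq_eq_norm_sq]
    rw [← Complex.ofReal_one, ← Complex.ofReal_sub, Complex.norm_real, Real.norm_eq_abs,
      abs_of_nonneg (by nlinarith)]
    ring
  change dist (alpha β s : ℂ) (alpha β t : ℂ) ≤ _ * dist (s : ℂ) t
  rw [dist_eq_norm, dist_eq_norm]
  rw [e, norm_div, norm_mul, norm_mul, e2]
  have g1 := denom_ge β s
  have g2 := denom_ge β t
  have hpos : 0 < ‖β‖ - 1 := by linarith
  calc (‖β‖ + 1) * (‖β‖ - 1) * ‖(s : ℂ) - t‖ /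
        (‖conj β * (s : ℂ) - 1‖ * ‖conj β * (t : ℂ) - 1‖)
      ≤ (‖β‖ + 1) * (‖β‖ - 1) * ‖(s : ℂ) - t‖ / ((‖β‖ - 1) * (‖β‖ - 1)) := by
        gcongr
    _ = (‖β‖ + 1) / (‖β‖ - 1) * ‖(s : ℂ) - t‖ := by
        field_simp

lemma exp_dist_ge {x y : ℝ} (h : |x - y| ≤ Real.pi) :
    |x - y| ≤ Real.pi / 2 * dist (Circle.exp x) (Circle.exp y) := by
  have e : dist (Circle.exp x) (Circle.exp y) = 2 * Real.sin (|x - y| / 2) := by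
    change dist ((Circle.exp x : Circle) : ℂ) (Circle.exp y : Circle) = _
    rw [dist_eq_norm]
    change ‖((Circle.exp x : Circle) : ℂ) - (Circle.exp y : Circle)‖ = _
    have : ((Circle.exp x : Circle) : ℂ) - (Circle.exp y : Circle)
        = Complex.exp (y * I) * (Complex.exp (I * ((x - y : ℝ) : ℂ)) - 1) := by
      rw [mul_sub, ← Complex.exp_add, Circle.coe_exp, Circle.coe_exp]
      push_cast
      ring_nf
    rw [this, norm_mul, Complex.norm_exp_ofReal_mul_I, one_mul,
      Complex.norm_exp_I_mul_ofReal_sub_one, Real.norm_eq_abs, abs_mul, abs_two]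
    congr 1
    rcases le_total 0 (x - y) with h0 | h0
    · rw [abs_of_nonneg h0] at h ⊢
      exact abs_of_nonneg (Real.sin_nonneg_of_nonneg_of_le_pi (by linarith) (by linarith))
    · rw [abs_of_nonpos h0] at h ⊢
      rw [neg_div, Real.sin_neg]
      refine abs_of_nonpos ?_
      have := Real.sin_nonneg_of_nonneg_of_le_pi (x := -((x - y) / 2)) (by linarith) (by linarith)
      rw [Real.sin_neg] at this
      linarith
  have := Real.mul_le_sin (x := |x - y| / 2) (by positivity) (by linarith)
  rw [e]
  have hp := Real.pi_pos
  calc |x - y| = Real.pi * (2 / Real.pi * (|x - y| / 2)) := by field_simp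
    _ ≤ Real.pi * Real.sin (|x - y| / 2) := by gcongr
    _ = _ := by ring

lemma volume_le_of_diam {S : Set ℝ} (h : ∀ x ∈ S, ∀ y ∈ S, |x - y| ≤ Real.pi) :
    volume S ≤ ENNReal.ofReal (Real.pi / 2) * μH[1] (Circle.exp '' S) := by
  have hinj : Set.InjOn Circle.exp S := by
    intro x hx y hy hxy
    have := exp_dist_ge (h x hx y hy)
    rw [hxy, dist_self, mul_zero] at this
    have := abs_nonpos_iff.1 this
    linarith
  have hL : LipschitzOnWith (Real.toNNReal (Real.pi / 2)) (Function.invFunOn Circle.exp S)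
      (Circle.exp '' S) := by
    refine LipschitzOnWith.of_dist_le_mul ?_
    rintro _ ⟨x, hx, rfl⟩ _ ⟨y, hy, rfl⟩
    rw [hinj.leftInvOn_invFunOn hx, hinj.leftInvOn_invFunOn hy,
      Real.coe_toNNReal _ (by positivity), Real.dist_eq]
    exact exp_dist_ge (h x hx y hy)
  have := hL.hausdorffMeasure_image_le (d := 1) zero_le_one
  rw [hinj.leftInvOn_invFunOn.image_image] at this
  rw [← hausdorffMeasure_real]
  simpa [ENNReal.ofReal] using this

lemma volume_le {S : Set ℝ} (h : S ⊆ Set.Ioc 0 (2 * Real.pi)) :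
    volume S ≤ ENNReal.ofReal Real.pi * μH[1] (Circle.exp '' S) := by
  have h1 : volume (S ∩ Set.Iic Real.pi)
      ≤ ENNReal.ofReal (Real.pi / 2) * μH[1] (Circle.exp '' S) := by
    refine (volume_le_of_diam ?_).trans (by gcongr; exact Set.inter_subset_left)
    rintro x ⟨hx, hx'⟩ y ⟨hy, hy'⟩
    have := h hx; have := h hy
    simp only [Set.mem_Ioc, Set.mem_Iic] at *
    rw [abs_le]; constructor <;> linarith
  have h2 : volume (S ∩ Set.Ioi Real.pi)
      ≤ ENNReal.ofReal (Real.pi / 2) * μH[1] (Circle.exp '' S) := by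
    refine (volume_le_of_diam ?_).trans (by gcongr; exact Set.inter_subset_left)
    rintro x ⟨hx, hx'⟩ y ⟨hy, hy'⟩
    have := h hx; have := h hy
    simp only [Set.mem_Ioc, Set.mem_Ioi] at *
    rw [abs_le]; constructor <;> linarith
  calc volume S ≤ volume (S ∩ Set.Iic Real.pi) + volume (S ∩ Set.Ioi Real.pi) := by
        have h3 : S = (S ∩ Set.Iic Real.pi) ∪ (S ∩ Set.Ioi Real.pi) := by
          rw [← Set.inter_union_distrib_left, Set.Iic_union_Ioi, Set.inter_univ]
        conv_lhs => rw [h3]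
        exact measure_union_le (μ := volume) _ _
    _ ≤ _ := add_le_add h1 h2
    _ = _ := by
        rw [← add_mul, ← ENNReal.ofReal_add (by positivity) (by positivity), add_halves]

lemma exp_lipschitz : LipschitzWith 1 Circle.exp := by
  refine LipschitzWith.of_dist_le_mul fun x y => ?_
  change dist ((Circle.exp x : Circle) : ℂ) (Circle.exp y : Circle) ≤ _
  rw [dist_eq_norm]
  change ‖((Circle.exp x : Circle) : ℂ) - (Circle.exp y : Circle)‖ ≤ _
  have : ((Circle.exp x : Circle) : ℂ) - (Circle.exp y : Circle)
      = Complex.exp (y * I) * (Complex.exp (I * ((x - y : ℝ) : ℂ)) - 1) := by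
    rw [mul_sub, ← Complex.exp_add, Circle.coe_exp, Circle.coe_exp]
    push_cast
    ring_nf
  rw [this, norm_mul, Complex.norm_exp_ofReal_mul_I, one_mul,
    Complex.norm_exp_I_mul_ofReal_sub_one, Real.norm_eq_abs, abs_mul, abs_two, Real.dist_eq]
  have := Real.abs_sin_le_abs (x := (x - y) / 2)
  rw [abs_div, abs_two] at this
  simp only [NNReal.coe_one, one_mul]
  linarith

lemma exp_surjOn : Set.SurjOn Circle.exp (Set.Ioc 0 (2 * Real.pi)) Set.univ := by
  intro z _
  obtain ⟨x, rfl⟩ := Circle.exp_surjective z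
  refine ⟨toIocMod Real.two_pi_pos 0 x, ?_, ?_⟩
  · simpa using toIocMod_mem_Ioc Real.two_pi_pos 0 x
  · rw [toIocMod]
    exact Circle.periodic_exp.sub_zsmul_eq _

/-- A constant in the comparison of arc length with its image under `α`. -/
def arcConst : ℝ≥0∞ :=
  ENNReal.ofReal Real.pi * (Real.toNNReal ((‖β‖ + 1) / (‖β‖ - 1)) : ℝ≥0∞)

lemma measurable_alpha : Measurable (alpha β) := (alpha_lipschitz β).continuous.measurable

/-- The shift `α` distorts arc length by at most a constant factor. -/
lemma map_alpha_le : Measure.map (alpha β) arc ≤ arcConst β • arc := by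
  refine Measure.le_iff.2 fun E hE => ?_
  have hα := measurable_alpha β
  have hexp : Measurable Circle.exp := Circle.exp.continuous.measurable
  rw [Measure.map_apply hα hE]
  unfold arc
  simp only [Measure.smul_apply, smul_eq_mul]
  rw [Measure.map_apply hexp (hα hE), Measure.map_apply hexp hE,
    Measure.restrict_apply (hexp (hα hE)), Measure.restrict_apply (hexp hE), mul_left_comm]
  refine mul_le_mul_right ?_ _
  set U := Set.Ioc 0 (2 * Real.pi) with hU
  calc volume (Circle.exp ⁻¹' (alpha β ⁻¹' E) ∩ U)
      ≤ ENNReal.ofReal Real.pi * μH[1] (Circle.exp '' (Circle.exp ⁻¹' (alpha β ⁻¹' E) ∩ U)) :=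
        volume_le Set.inter_subset_right
    _ ≤ ENNReal.ofReal Real.pi *
        μH[1] (alpha β '' (Circle.exp '' (Circle.exp ⁻¹' E ∩ U))) := by
        gcongr
        rintro _ ⟨x, ⟨hx, -⟩, rfl⟩
        obtain ⟨y, hy, hy'⟩ := exp_surjOn (Set.mem_univ (alpha β (Circle.exp x)))
        refine ⟨alpha β (Circle.exp x), ⟨y, ⟨?_, hy⟩, hy'⟩, alpha_alpha β _⟩
        rw [Set.mem_preimage, hy']
        exact hx
    _ ≤ ENNReal.ofReal Real.pi * ((Real.toNNReal ((‖β‖ + 1) / (‖β‖ - 1)) : ℝ≥0∞) *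
        volume (Circle.exp ⁻¹' E ∩ U)) := by
        gcongr
        refine ((alpha_lipschitz β).hausdorffMeasure_image_le (d := 1) zero_le_one _).trans ?_
        rw [ENNReal.rpow_one]
        gcongr
        have := exp_lipschitz.hausdorffMeasure_image_le (d := 1) zero_le_one
          (Circle.exp ⁻¹' E ∩ U)
        rw [hausdorffMeasure_real] at this
        simpa using this
    _ = _ := by rw [arcConst, mul_assoc]

lemma arcConst_ne_top (β : ℂ) : arcConst β ≠ ∞ := by
  unfold arcConst
  finiteness

lemma quasiMeasurePreserving_alpha : Measure.QuasiMeasurePreserving (alpha β) arc arc :=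
  ⟨measurable_alpha β, Measure.absolutelyContinuous_of_le_smul (map_alpha_le β)⟩

lemma memLp_comp_alpha {p : ℝ≥0∞} {f : Circle → ℂ} (hf : MemLp f p arc) :
    MemLp (f ∘ alpha β) p arc :=
  (hf.of_measure_le_smul (arcConst_ne_top β) (map_alpha_le β)).comp_of_map
    (measurable_alpha β).aemeasurable

lemma eLpNorm_comp_alpha_le {p : ℝ≥0∞} [hp : Fact (1 ≤ p)] {f : Circle → ℂ}
    (hf : MemLp f p arc) :
    eLpNorm (f ∘ alpha β) p arc ≤ max 1 (arcConst β) * eLpNorm f p arc := by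
  have hm : AEStronglyMeasurable f (Measure.map (alpha β) arc) :=
    hf.1.mono_ac (quasiMeasurePreserving_alpha β).absolutelyContinuous
  rw [← eLpNorm_map_measure hm (measurable_alpha β).aemeasurable]
  have h1 : Measure.map (alpha β) arc ≤ max 1 (arcConst β) • arc :=
    (map_alpha_le β).trans (by
      refine Measure.le_iff.2 fun E _ => ?_
      simp only [Measure.smul_apply, smul_eq_mul]
      gcongr
      exact le_max_right _ _)
  refine (eLpNorm_mono_measure f h1).trans ?_
  rcases eq_or_ne p ∞ with rfl | hp'
  · rw [eLpNorm_smul_measure_of_ne_zero (by simp)]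
    simp only [ENNReal.toReal_div, ENNReal.toReal_one, ENNReal.toReal_top, div_zero,
      ENNReal.rpow_zero, one_smul]
    exact le_mul_of_one_le_left zero_le (le_max_left _ _)
  · rw [eLpNorm_smul_measure_of_ne_top hp', smul_eq_mul]
    gcongr
    nth_rewrite 2 [← ENNReal.rpow_one (max 1 (arcConst β))]
    refine ENNReal.rpow_le_rpow_of_exponent_le (le_max_left _ _) ?_
    rw [ENNReal.toReal_div, ENNReal.toReal_one]
    have : 1 ≤ p.toReal := by
      rw [← ENNReal.toReal_one]
      exact (ENNReal.toReal_le_toReal (by simp) hp').2 hp.out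
    rw [div_le_one (by linarith)]
    exact this

/-- The composition operator `f ↦ f ∘ α` on `L^p`. -/
def compAlpha (p : ℝ≥0∞) [Fact (1 ≤ p)] : Lp ℂ p arc →L[ℂ] Lp ℂ p arc :=
  LinearMap.mkContinuous
    { toFun := fun f => (memLp_comp_alpha β (Lp.memLp f)).toLp (f ∘ alpha β)
      map_add' := by
        intro f g
        rw [← MemLp.toLp_add]
        refine MemLp.toLp_congr _ _ ?_
        exact (quasiMeasurePreserving_alpha β).ae_eq_comp (Lp.coeFn_add f g)
      map_smul' := by
        intro c f
        rw [RingHom.id_apply, ← MemLp.toLp_const_smul]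
        refine MemLp.toLp_congr _ _ ?_
        exact (quasiMeasurePreserving_alpha β).ae_eq_comp (Lp.coeFn_smul c f) }
    (max 1 (arcConst β)).toReal
    (by
      intro f
      have hC : max 1 (arcConst β) ≠ ∞ := by
        rw [Ne, max_eq_top, not_or]
        exact ⟨by simp, arcConst_ne_top β⟩
      change ‖(memLp_comp_alpha β (Lp.memLp f)).toLp (f ∘ alpha β)‖ ≤ _
      rw [Lp.norm_toLp, Lp.norm_def, ← ENNReal.toReal_mul]
      exact ENNReal.toReal_mono (ENNReal.mul_ne_top hC (Lp.eLpNorm_ne_top f))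
        (eLpNorm_comp_alpha_le β (Lp.memLp f)))

end Shift

/-! ### Operators on `L^p` and `H^p` -/

section Operators

variable (p : ℝ≥0∞) [Fact (1 ≤ p)]

open Classical in
/-- The operator `f ↦ g f` of multiplication by `g ∈ L^∞` on `L^p`
(only used for `g ∈ L^∞`). -/
def mulOp (g : Circle → ℂ) : Lp ℂ p arc →L[ℂ] Lp ℂ p arc :=
  if hg : MemLp g ∞ arc then
    ((ContinuousLinearMap.mul ℂ ℂ).holderL arc ∞ p p) (hg.toLp g)
  else 0

/-- The weighted shift operator `(J_α f)(t) = t⁻¹ α₋(t) f(α(t))` on `L^p`. -/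
def shiftOp (β : ℂ) [Fact (1 < ‖β‖)] : Lp ℂ p arc →L[ℂ] Lp ℂ p arc :=
  mulOp p (fun t => (t : ℂ)⁻¹ * alphaMinus β t) ∘L compAlpha β p

open Classical in
/-- The projection `P : ∑ f̂ₙ tⁿ ↦ ∑_{n ≥ 0} f̂ₙ tⁿ` of `L^p` onto `H^p`. For `1 < p < ∞` a bounded
operator with this action on Fourier coefficients exists (M. Riesz), and it is unique because a
function is determined by its Fourier coefficients. -/
def projP : Lp ℂ p arc →L[ℂ] Hardy p :=
  if h : ∃ R : Lp ℂ p arc →L[ℂ] Hardy p,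
      ∀ (f : Lp ℂ p arc) (n : ℤ), 0 ≤ n → fcoef (R f : Lp ℂ p arc) n = fcoef f n
  then h.choose else 0

/-- The complementary projection `Q = I - P` on `L^p`. -/
def projQ : Lp ℂ p arc →L[ℂ] Lp ℂ p arc :=
  ContinuousLinearMap.id ℂ _ - (Hardy p).subtypeL ∘L projP p

/-- The Toeplitz operator `T(a) f = P a f` on `H^p`. -/
def toeplitz (a : Circle → ℂ) : Hardy p →L[ℂ] Hardy p :=
  projP p ∘L mulOp p a ∘L (Hardy p).subtypeL

/-- The generalized Hankel operator `H_α(b) f = P b Q J_α f` on `H^p`. -/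
def hankel (β : ℂ) [Fact (1 < ‖β‖)] (b : Circle → ℂ) : Hardy p →L[ℂ] Hardy p :=
  projP p ∘L mulOp p b ∘L projQ p ∘L shiftOp p β ∘L (Hardy p).subtypeL

/-- The index `dim ker A - dim coker A` of a Fredholm operator. -/
def index {E : Type*} [NormedAddCommGroup E] [NormedSpace ℂ E] (A : E →L[ℂ] E) : ℤ :=
  (Module.finrank ℂ (LinearMap.ker (A : E →ₗ[ℂ] E)) : ℤ) -
    (Module.finrank ℂ (E ⧸ LinearMap.range (A : E →ₗ[ℂ] E)) : ℤ)

variable {p} in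
/-- The cokernel of an operator `A` on `H^p`, that is, the kernel of its adjoint `A*`, which acts on
`H^q`, `1/p + 1/q = 1`, through the pairing `⟨f, g⟩ = ∫ f conj(g)`: the set of all `g ∈ H^q` with
`⟨A f, g⟩ = 0` for every `f ∈ H^p`. -/
def coker (q : ℝ≥0∞) [Fact (1 ≤ q)] [p.HolderConjugate q] (A : Hardy p →L[ℂ] Hardy p) :
    Submodule ℂ (Hardy q) where
  carrier := {g | ∀ f : Hardy p,
    ∫ t, (A f : Lp ℂ p arc) t * conj ((g : Lp ℂ q arc) t) ∂arc = 0}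
  zero_mem' := by
    intro f
    rw [integral_eq_zero_of_ae]
    filter_upwards [Lp.coeFn_zero ℂ q arc] with t ht
    change _ * conj ((0 : Lp ℂ q arc) t) = 0
    rw [ht, Pi.zero_apply, map_zero, mul_zero]
  add_mem' := by
    intro g h hg hh f
    have hi : ∀ k : Hardy q,
        Integrable (fun t => (A f : Lp ℂ p arc) t * conj ((k : Lp ℂ q arc) t)) arc :=
      fun k => (Lp.memLp (A f : Lp ℂ p arc)).integrable_mul (Lp.memLp (k : Lp ℂ q arc)).star
    have e : ∫ t, (A f : Lp ℂ p arc) t * conj (((g + h : Hardy q) : Lp ℂ q arc) t) ∂arc =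
        (∫ t, (A f : Lp ℂ p arc) t * conj ((g : Lp ℂ q arc) t) ∂arc) +
          ∫ t, (A f : Lp ℂ p arc) t * conj ((h : Lp ℂ q arc) t) ∂arc := by
      rw [← integral_add (hi g) (hi h)]
      refine integral_congr_ae ?_
      filter_upwards [Lp.coeFn_add (g : Lp ℂ q arc) (h : Lp ℂ q arc)] with t ht
      simp only [Submodule.coe_add, ht, Pi.add_apply, map_add, mul_add]
    rw [e, hg f, hh f, add_zero]
  smul_mem' := by
    intro c g hg f
    have e : ∫ t, (A f : Lp ℂ p arc) t * conj (((c • g : Hardy q) : Lp ℂ q arc) t) ∂arc =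
        conj c * ∫ t, (A f : Lp ℂ p arc) t * conj ((g : Lp ℂ q arc) t) ∂arc := by
      rw [← integral_const_mul]
      refine integral_congr_ae ?_
      filter_upwards [Lp.coeFn_smul c (g : Lp ℂ q arc)] with t ht
      simp only [Submodule.coe_smul, ht, Pi.smul_apply, smul_eq_mul, map_mul]
      ring
    rw [e, hg f, mul_zero]

/-- The operator `J_α Q g` from `H^p` to `H^p`. Since `J_α Q = P J_α` maps into `H^p`, the outer `P`
only fixes the codomain. -/
def shiftQ (β : ℂ) [Fact (1 < ‖β‖)] (g : Circle → ℂ) : Hardy p →L[ℂ] Hardy p :=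
  projP p ∘L shiftOp p β ∘L projQ p ∘L mulOp p g ∘L (Hardy p).subtypeL

/-- The space `im P_α^±(g)`, where `P_α^±(g) = (1/2)(I ± J_α Q g P)` on `ker T(g)`; the sign is
`ε = ±1`. -/
def imP (β : ℂ) [Fact (1 < ‖β‖)] (ε : ℂ) (g : Circle → ℂ) : Submodule ℂ (Hardy p) :=
  (LinearMap.ker (toeplitz p g : Hardy p →ₗ[ℂ] Hardy p)).map
    (((1 / 2 : ℂ) • (ContinuousLinearMap.id ℂ (Hardy p) + ε • shiftQ p β g) :
      Hardy p →L[ℂ] Hardy p) : Hardy p →ₗ[ℂ] Hardy p)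

/-- For a Fredholm operator `T(g)` of index `κ ≥ 0`, the right inverse
`T_r⁻¹(g) = T(g t^κ)⁻¹ T(t^κ)` of `T(g)`. -/
def rightInv (g : Circle → ℂ) : Hardy p →L[ℂ] Hardy p :=
  (toeplitz p (fun t => g t * (t : ℂ) ^ index (toeplitz p g))).inverse ∘L
    toeplitz p (fun t => (t : ℂ) ^ index (toeplitz p g))

end Operators

/-! ### Matching pairs -/

section Matching

variable (β : ℂ) [Fact (1 < ‖β‖)]

/-- `(a, b)` is an `α`-matching pair: `a` is invertible in `L^∞`, `b ∈ L^∞`, and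
`a a_α = b b_α` almost everywhere. -/
structure IsMatchingPair (a b : Circle → ℂ) : Prop where
  memLp_left : MemLp a ∞ arc
  memLp_right : MemLp b ∞ arc
  ne_zero : ∀ᵐ t ∂arc, a t ≠ 0
  memLp_inv : MemLp (fun t => (a t)⁻¹) ∞ arc
  matching : ∀ᵐ t ∂arc, a t * a (alpha β t) = b t * b (alpha β t)

/-- The first function `c = a b⁻¹` of the subordinated pair. -/
def subC (a b : Circle → ℂ) (t : Circle) : ℂ := a t * (b t)⁻¹

/-- The second function `d = b a_α⁻¹` of the subordinated pair. -/
def subD (a b : Circle → ℂ) (t : Circle) : ℂ := b t * (a (alpha β t))⁻¹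

/-- The matching pair `(a, b)` is Fredholm on `H^p`: `T(c)` and `T(d)` are Fredholm. -/
def IsFredholmPair (p : ℝ≥0∞) [Fact (1 ≤ p)] (a b : Circle → ℂ) : Prop :=
  IsMatchingPair β a b ∧ (toeplitz p (subC a b)).IsFredholm ∧ (toeplitz p (subD β a b)).IsFredholm

/-- The maps `φ_α^±` of the pair `(a, b)`, with `ε = ±1` for the sign:
`2 φ_α^±(s) = T_r⁻¹(c) T(a_α⁻¹) s ∓ J_α Q c P T_r⁻¹(c) T(a_α⁻¹) s ± J_α Q a_α⁻¹ s`. -/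
def phi (p : ℝ≥0∞) [Fact (1 ≤ p)] (ε : ℂ) (a b : Circle → ℂ) : Hardy p →L[ℂ] Hardy p :=
  let ainv : Circle → ℂ := fun t => (a (alpha β t))⁻¹
  let u : Hardy p →L[ℂ] Hardy p := rightInv p (subC a b) ∘L toeplitz p ainv
  (1 / 2 : ℂ) • (u - ε • (shiftQ p β (subC a b) ∘L u) + ε • shiftQ p β ainv)

/-- `X = Y ∔ Z` is the direct sum of its subspaces `Y` and `Z`. -/
def IsDirectSum {E : Type*} [AddCommGroup E] [Module ℂ E] (X Y Z : Submodule ℂ E) : Prop :=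
  X = Y ⊔ Z ∧ Disjoint Y Z

end Matching

/-- `A` is invertible from the right. -/
def RightInvertible {E : Type*} [NormedAddCommGroup E] [NormedSpace ℂ E] (A : E →L[ℂ] E) : Prop :=
  ∃ B : E →L[ℂ] E, A ∘L B = ContinuousLinearMap.id ℂ E

/-- `A` is invertible from the left. -/
def LeftInvertible {E : Type*} [NormedAddCommGroup E] [NormedSpace ℂ E] (A : E →L[ℂ] E) : Prop :=
  ∃ B : E →L[ℂ] E, B ∘L A = ContinuousLinearMap.id ℂ E

end AlphaTH

end

set_option linter.unusedSectionVars false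

noncomputable section

namespace AlphaTH

/-! ### Integration on the circle -/

/-! Everything rests on four properties of `J = J_α`: `J² = I`, `J g = g_α J`, `J` is self-adjoint
for the pairing, and `P J P = 0 = Q J Q`, so that `J` interchanges `H^p` with `ker P`. Hence `T(a) +
ε H_α(b)` is the compression of the symbol map `f ↦ h = a f + ε b J f`. The matching condition gives
`d J h = ε h` (`subD_shiftOp_symbol`), and `h = b (c f + ε J f)`.

The equation `(T(a) + ε H_α(b)) f = y` therefore splits into two scalar ones. Writing `h = y + J s`
with `s ∈ H^p` gives `d s - ε J s = ε y - d J y`, and then `c f + ε J f = b⁻¹ h`. Both have the form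
`g f + ε J f = w` with `g g_α = 1` and `g J w = ε w`. Given a right inverse `R` of `T(g)`, such an
equation is solved by averaging `R P w` with `ε J (w - g R P w)` (`solveOp_spec`). The solutions of
`g s = ε J s` in `H^p` are exactly `im P_α^ε(g)` (`mem_imP`). For `y = 0` this yields the kernel
formula: `s` ranges over `im P_α^ε(d)`, the map `φ_α^ε` lifts `s` to the kernel, and the homogeneous
solutions form `im P_α^{-ε}(c)`. One-sided inverses of `T(c)` and `T(d)` give one-sided inverses of
`T(a) + ε H_α(b)` by the same substitution.

The adjoint on `H^q` is the operator of the same type for `(conj a, conj b_α)`, with subordinated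
pair `(conj d, conj c)`, so cokernel formulas are kernel formulas for that pair.

The one-sided inverses come from Coburn's alternative: a Toeplitz operator with closed range and an
a.e. nonzero symbol is injective or surjective, because a nontrivial kernel puts the constants, and
then all polynomials, into the range. Multiplying the symbol by `t^κ` then makes it bijective
(`toeplitz_of_isFredholm`). Two classical facts are proved on the way: M. Riesz's theorem that `P`
is bounded, and enough of the duality of `L^p` and `L^q` to transfer bijectivity from `T(g)` to
`T(conj g)`. -/

instance instIsProbabilityMeasureArc : IsProbabilityMeasure arc := by
  refine ⟨?_⟩
  unfold arc
  rw [Measure.smul_apply, Measure.map_apply Circle.exp.continuous.measurable MeasurableSet.univ,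
    Set.preimage_univ, Measure.restrict_apply_univ, Real.volume_Ioc, sub_zero, smul_eq_mul]
  exact ENNReal.inv_mul_cancel (ENNReal.ofReal_pos.2 Real.two_pi_pos).ne' ENNReal.ofReal_ne_top

lemma integral_arc {E : Type*} [NormedAddCommGroup E] [NormedSpace ℝ E] {f : ℂ → E}
    (hf : Continuous fun t : Circle => f t) :
    ∫ t : Circle, f t ∂arc = Real.circleAverage f 0 1 := by
  unfold arc
  rw [integral_smul_measure, integral_map Circle.exp.continuous.measurable.aemeasurable
    hf.aestronglyMeasurable, Real.circleAverage_def,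
    intervalIntegral.integral_of_le Real.two_pi_pos.le, ENNReal.toReal_inv,
    ENNReal.toReal_ofReal Real.two_pi_pos.le]
  simp [circleMap, Circle.coe_exp]

/-- Cauchy's theorem: a function holomorphic near the closed disc averages to its value at `0`. -/
lemma integral_arc_of_diffContOnCl {f : ℂ → ℂ} (hf : DiffContOnCl ℂ f (Metric.ball 0 1)) :
    ∫ t : Circle, f t ∂arc = f 0 := by
  rw [integral_arc]
  · have := DiffContOnCl.circleAverage (f := f) (c := 0) (R := 1) (by simpa using hf)
    simpa using this
  · have := hf.continuousOn
    rw [closure_ball _ one_ne_zero] at this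
    exact this.comp_continuous continuous_subtype_val fun t => by simp [Circle.norm_coe]

lemma integral_conj_arc {f : Circle → ℂ} : ∫ t, conj (f t) ∂arc = conj (∫ t, f t ∂arc) :=
  integral_conj

/-! ### Trigonometric polynomials -/

/-- The monomial `t ^ n` on the circle. -/
def zpowC (n : ℤ) : C(Circle, ℂ) :=
  ⟨fun t => (t : ℂ) ^ n, Continuous.zpow₀ (by fun_prop) _ fun t => Or.inl (Circle.coe_ne_zero t)⟩

@[simp] lemma zpowC_apply (n : ℤ) (t : Circle) : zpowC n t = (t : ℂ) ^ n := rfl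

lemma conj_coe (t : Circle) : conj (t : ℂ) = (t : ℂ)⁻¹ := by
  rw [← Circle.coe_inv_eq_conj, Circle.coe_inv]

lemma conj_zpow (t : Circle) (n : ℤ) : conj ((t : ℂ) ^ n) = (t : ℂ) ^ (-n) := by
  rw [map_zpow₀, conj_coe, inv_zpow, zpow_neg]

lemma integral_zpow (n : ℤ) : ∫ t : Circle, (t : ℂ) ^ n ∂arc = if n = 0 then 1 else 0 := by
  have key : ∀ m : ℕ, m ≠ 0 → ∫ t : Circle, (t : ℂ) ^ m ∂arc = 0 := fun m hm => by
    have := integral_arc_of_diffContOnCl (f := fun z => z ^ m)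
      (Differentiable.diffContOnCl (by fun_prop))
    rw [this, zero_pow hm]
  obtain ⟨m, rfl | rfl⟩ := n.eq_nat_or_neg
  · rcases eq_or_ne m 0 with rfl | hm
    · simp
    · simp [hm, key m hm]
  · rcases eq_or_ne m 0 with rfl | hm
    · simp
    · have h1 : ∀ t : Circle, (t : ℂ) ^ (-(m : ℤ)) = conj ((t : ℂ) ^ m) := fun t => by
        rw [← zpow_natCast, conj_zpow]
      simp only [h1]
      rw [integral_conj_arc, key m hm]
      simp [hm]

/-- The trigonometric polynomial with the given coefficients. -/
def trig : (ℤ →₀ ℂ) →ₗ[ℂ] C(Circle, ℂ) := Finsupp.linearCombination ℂ zpowC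

lemma trig_single (n : ℤ) (c : ℂ) : trig (Finsupp.single n c) = c • zpowC n := by
  simp [trig]

lemma trig_apply (a : ℤ →₀ ℂ) (t : Circle) : trig a t = a.sum fun n c => c * (t : ℂ) ^ n := by
  simp [trig, Finsupp.linearCombination_apply, Finsupp.sum]

lemma range_trig : LinearMap.range trig = Submodule.span ℂ (Set.range zpowC) := by
  rw [trig, Finsupp.range_linearCombination]

/-- The star algebra of trigonometric polynomials. -/
def trigAlgebra : StarSubalgebra ℂ C(Circle, ℂ) where
  toSubalgebra := Algebra.adjoin ℂ (Set.range zpowC)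
  star_mem' := by
    change Algebra.adjoin ℂ (Set.range zpowC) ≤ star (Algebra.adjoin ℂ (Set.range zpowC))
    refine Algebra.adjoin_le ?_
    rintro - ⟨n, rfl⟩
    exact Algebra.subset_adjoin ⟨-n, ContinuousMap.ext fun t => (conj_zpow t n).symm⟩

lemma trigAlgebra_coe :
    Subalgebra.toSubmodule trigAlgebra.toSubalgebra = LinearMap.range trig := by
  rw [range_trig]
  apply Algebra.adjoin_eq_span_of_subset
  refine Set.Subset.trans ?_ Submodule.subset_span
  intro x hx
  refine Submonoid.closure_induction (fun _ => id) ⟨0, ?_⟩ ?_ hx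
  · ext1 z; simp
  · rintro - - - - ⟨m, rfl⟩ ⟨n, rfl⟩
    refine ⟨m + n, ?_⟩
    ext1 z
    simp [zpow_add₀ (Circle.coe_ne_zero z)]

/-- Stone–Weierstrass: the monomial `t` already separates points. -/
lemma denseRange_trig : DenseRange trig := by
  have h1 : trigAlgebra.topologicalClosure = ⊤ := by
    refine ContinuousMap.starSubalgebra_topologicalClosure_eq_top_of_separatesPoints _ ?_
    intro x y hxy
    refine ⟨_, ⟨zpowC 1, Algebra.subset_adjoin ⟨1, rfl⟩, rfl⟩, ?_⟩
    simpa [Circle.coe_inj] using hxy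
  have h2 : (LinearMap.range trig).topologicalClosure = ⊤ := by
    rw [← trigAlgebra_coe]
    exact congr_arg (Subalgebra.toSubmodule <| StarSubalgebra.toSubalgebra ·) h1
  have := (Submodule.dense_iff_topologicalClosure_eq_top).2 h2
  rwa [LinearMap.coe_range] at this

/-! ### Trigonometric polynomials in `L^p`. -/

section Lp

variable (p : ℝ≥0∞) [Fact (1 ≤ p)]

/-- The monomial `t ^ n` as an element of `L^p`. -/
def mono (n : ℤ) : Lp ℂ p arc := ContinuousMap.toLp p arc ℂ (zpowC n)

/-- A trigonometric polynomial as an element of `L^p`. -/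
def trigLp : (ℤ →₀ ℂ) →ₗ[ℂ] Lp ℂ p arc :=
  (ContinuousMap.toLp p arc ℂ : C(Circle, ℂ) →L[ℂ] Lp ℂ p arc).toLinearMap ∘ₗ trig

lemma coeFn_mono (n : ℤ) : mono p n =ᵐ[arc] fun t => (t : ℂ) ^ n :=
  ContinuousMap.coeFn_toLp arc (zpowC n)

lemma coeFn_trigLp (a : ℤ →₀ ℂ) : trigLp p a =ᵐ[arc] trig a := ContinuousMap.coeFn_toLp arc _

lemma trigLp_single (n : ℤ) (c : ℂ) : trigLp p (Finsupp.single n c) = c • mono p n := by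
  simp [trigLp, trig_single, mono]

lemma trigLp_eq_sum (a : ℤ →₀ ℂ) : trigLp p a = a.sum fun n c => c • mono p n := by
  conv_lhs => rw [← Finsupp.sum_single a]
  rw [Finsupp.sum, map_sum]
  simp only [trigLp_single, Finsupp.sum]

variable {p}

lemma denseRange_trigLp (hp : p ≠ ∞) : DenseRange (trigLp p) :=
  (ContinuousMap.toLp_denseRange ℂ arc ℂ hp).comp denseRange_trig (ContinuousLinearMap.continuous _)

/-- Density of trigonometric polynomials. The operator identities for `P` and `J_α` are reduced by
this to integrals of monomials. -/
lemma clm_ext_mono (hp : p ≠ ∞) {F : Type*} [NormedAddCommGroup F] [NormedSpace ℂ F]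
    {A B : Lp ℂ p arc →L[ℂ] F} (h : ∀ n, A (mono p n) = B (mono p n)) : A = B := by
  ext1 f
  have := (denseRange_trigLp hp).equalizer A.continuous B.continuous (by
    ext a
    simp only [Function.comp, trigLp_eq_sum, Finsupp.sum, map_sum, map_smul, h])
  exact congrFun this f

lemma norm_toLp_le (f : C(Circle, ℂ)) :
    ‖(ContinuousMap.toLp p arc ℂ f : Lp ℂ p arc)‖ ≤ ‖f‖ := by
  refine (ContinuousLinearMap.le_opNorm _ _).trans ?_
  refine mul_le_of_le_one_left (norm_nonneg _) ?_
  have := ContinuousMap.toLp_norm_le (p := p) (μ := arc) (E := ℂ) (𝕜 := ℂ)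
  simpa [measureUnivNNReal] using this

end Lp

/-! ### The pairing -/

section Pairing

variable {p q : ℝ≥0∞} [hp1 : Fact (1 ≤ p)] [hq1 : Fact (1 ≤ q)] [hpq : p.HolderConjugate q]

/-- The sesquilinear pairing `∫ f conj(g)` of `L^p` and `L^q`. -/
def pair (f : Lp ℂ p arc) (g : Lp ℂ q arc) : ℂ := ∫ t, f t * conj (g t) ∂arc

lemma pair_symm (f : Lp ℂ p arc) (g : Lp ℂ q arc) : conj (pair f g) = pair g f := by
  unfold pair
  rw [← integral_conj_arc]
  simp [mul_comm]

/-- The functional `f ↦ ∫ f conj(g)` on `L^p`. -/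
def pairL (g : Lp ℂ q arc) : Lp ℂ p arc →L[ℂ] ℂ :=
  ((ContinuousLinearMap.mul ℂ ℂ).lpPairing arc p q).flip ((Lp.memLp g).star.toLp _)

lemma pairL_apply (g : Lp ℂ q arc) (f : Lp ℂ p arc) : pairL g f = pair f g := by
  rw [pairL, ContinuousLinearMap.flip_apply, ContinuousLinearMap.lpPairing_eq_integral]
  refine integral_congr_ae ?_
  filter_upwards [(Lp.memLp g).star.coeFn_toLp] with t ht
  simp [ht]

lemma norm_pair_le (f : Lp ℂ p arc) (g : Lp ℂ q arc) : ‖pair f g‖ ≤ ‖f‖ * ‖g‖ := by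
  have h1 : pair f g =
      (ContinuousLinearMap.mul ℂ ℂ).lpPairing arc p q f ((Lp.memLp g).star.toLp _) :=
    (pairL_apply g f).symm
  have h2 : ‖((Lp.memLp g).star.toLp _ : Lp ℂ q arc)‖ = ‖g‖ := by
    rw [Lp.norm_toLp, Lp.norm_def]
    congr 1
    exact eLpNorm_congr_norm_ae (Filter.Eventually.of_forall fun t => by simp)
  rw [h1, ContinuousLinearMap.lpPairing_eq_integral]
  refine (norm_integral_le_lintegral_norm _).trans ?_
  rw [← h2, Lp.norm_def, Lp.norm_def, ← ENNReal.toReal_mul]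
  refine ENNReal.toReal_mono (ENNReal.mul_ne_top (Lp.eLpNorm_ne_top _) (Lp.eLpNorm_ne_top _)) ?_
  have := eLpNorm_smul_le_mul_eLpNorm (r := 1) (p := p) (q := q)
    (Lp.aestronglyMeasurable ((Lp.memLp g).star.toLp _ : Lp ℂ q arc)) (Lp.aestronglyMeasurable f)
  rw [eLpNorm_one_eq_lintegral_enorm] at this
  simpa [ofReal_norm] using this

lemma pair_add_left (f f' : Lp ℂ p arc) (g : Lp ℂ q arc) :
    pair (f + f') g = pair f g + pair f' g := by
  simp only [← pairL_apply, map_add]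

lemma pair_sub_left (f f' : Lp ℂ p arc) (g : Lp ℂ q arc) :
    pair (f - f') g = pair f g - pair f' g := by
  simp only [← pairL_apply, map_sub]

lemma pair_smul_left (c : ℂ) (f : Lp ℂ p arc) (g : Lp ℂ q arc) :
    pair (c • f) g = c * pair f g := by
  simp only [← pairL_apply, map_smul, smul_eq_mul]

lemma pair_zero_left (g : Lp ℂ q arc) : pair (0 : Lp ℂ p arc) g = 0 := by
  simp only [← pairL_apply, map_zero]

lemma pair_add_right (f : Lp ℂ p arc) (g g' : Lp ℂ q arc) :
    pair f (g + g') = pair f g + pair f g' := by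
  have := hpq.symm
  rw [← pair_symm, pair_add_left, map_add, pair_symm, pair_symm]

lemma pair_smul_right (c : ℂ) (f : Lp ℂ p arc) (g : Lp ℂ q arc) :
    pair f (c • g) = conj c * pair f g := by
  have := hpq.symm
  rw [← pair_symm, pair_smul_left, map_mul, pair_symm]

lemma pair_zero_right (f : Lp ℂ p arc) : pair f (0 : Lp ℂ q arc) = 0 := by
  have := hpq.symm
  rw [← pair_symm, pair_zero_left, map_zero]

lemma pair_mono (f : Lp ℂ p arc) (n : ℤ) : pair f (mono q n) = fcoef f n := by
  refine integral_congr_ae ?_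
  filter_upwards [coeFn_mono q n] with t ht
  rw [ht, conj_zpow]

lemma pair_mono_mono (m n : ℤ) :
    pair (mono p m) (mono q n) = if m = n then 1 else 0 := by
  have : pair (mono p m) (mono q n) = ∫ t : Circle, (t : ℂ) ^ (m - n) ∂arc := by
    refine integral_congr_ae ?_
    filter_upwards [coeFn_mono q n, coeFn_mono p m] with t ht ht'
    rw [ht, ht', conj_zpow, ← zpow_add₀ (Circle.coe_ne_zero t), sub_eq_add_neg]
  rw [this, integral_zpow]
  simp [sub_eq_zero]

lemma fcoef_mono (m n : ℤ) : fcoef (mono p m) n = if m = n then 1 else 0 := by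
  have : Fact (1 ≤ ENNReal.conjExponent p) := ⟨le_self_add⟩
  have : p.HolderConjugate (ENNReal.conjExponent p) := ENNReal.HolderConjugate.conjExponent hp1.out
  rw [← pair_mono (q := ENNReal.conjExponent p), pair_mono_mono]

end Pairing

/-! ### Norms and extremal functions -/

section Extremal

variable {p q : ℝ≥0∞} [hp1 : Fact (1 ≤ p)] [hq1 : Fact (1 ≤ q)] [hpq : p.HolderConjugate q]

lemma toReal_pos_of_lt_top (hp' : p < ∞) : 0 < p.toReal :=
  ENNReal.toReal_pos (zero_lt_one.trans_le hp1.out).ne' hp'.ne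

lemma one_lt_toReal (hp : 1 < p) (hp' : p < ∞) : 1 < p.toReal := by
  have := (ENNReal.toReal_lt_toReal ENNReal.one_ne_top hp'.ne).2 hp
  simpa using this

lemma one_lt_conj (hp' : p < ∞) : 1 < q :=
  (ENNReal.HolderConjugate.lt_top_iff_one_lt p q).1 hp'

lemma conj_lt_top (hp : 1 < p) : q < ∞ :=
  (ENNReal.HolderConjugate.lt_top_iff_one_lt q p).2 hp

lemma holder_toReal (hp : 1 < p) (hp' : p < ∞) : p.toReal.HolderConjugate q.toReal :=
  ENNReal.HolderConjugate.toReal_of_ne_top hp'.ne (conj_lt_top (q := q) hp).ne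

lemma conj_le_two (hp2 : 2 ≤ p) : q ≤ 2 := by
  have h1 := ENNReal.HolderConjugate.inv_add_inv_eq_one p q
  have h2 : (2 : ℝ≥0∞)⁻¹ + 2⁻¹ = 1 := ENNReal.inv_two_add_inv_two
  by_contra hcon
  rw [not_le] at hcon
  have h3 := ENNReal.add_lt_add_of_le_of_lt
    (by simp [(zero_lt_one.trans_le hp1.out).ne']) (ENNReal.inv_le_inv.2 hp2)
    (ENNReal.inv_lt_inv.2 hcon)
  rw [h1, h2] at h3
  exact lt_irrefl _ h3

lemma two_le_conj (hp2 : p ≤ 2) : 2 ≤ q := by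
  have h1 := ENNReal.HolderConjugate.inv_add_inv_eq_one p q
  have h2 : (2 : ℝ≥0∞)⁻¹ + 2⁻¹ = 1 := ENNReal.inv_two_add_inv_two
  by_contra hcon
  rw [not_le] at hcon
  have h3 := ENNReal.add_lt_add_of_le_of_lt (by simp) (ENNReal.inv_le_inv.2 hp2)
    (ENNReal.inv_lt_inv.2 hcon)
  rw [h1, h2] at h3
  exact lt_irrefl _ h3

lemma norm_rpow_eq_integral (hp' : p < ∞) (f : Lp ℂ p arc) :
    ‖f‖ ^ p.toReal = ∫ t, ‖f t‖ ^ p.toReal ∂arc := by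
  have h0 := toReal_pos_of_lt_top hp'
  have hn : 0 ≤ ∫ t, ‖f t‖ ^ p.toReal ∂arc := integral_nonneg fun t => by positivity
  rw [Lp.norm_def, (Lp.memLp f).eLpNorm_eq_integral_rpow_norm
    (zero_lt_one.trans_le hp1.out).ne' hp'.ne, ENNReal.toReal_ofReal (by positivity),
    ← Real.rpow_mul hn, inv_mul_cancel₀ h0.ne', Real.rpow_one]

/-- Every `f ∈ L^p` is normed by some `k` in the unit ball of `L^q`, a multiple of
`f |f|^{p-2}`. -/
lemma exists_extremal (hp : 1 < p) (hp' : p < ∞) (f : Lp ℂ p arc) :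
    ∃ k : Lp ℂ q arc, ‖k‖ ≤ 1 ∧ pair f k = ‖f‖ ∧
      ∃ c : ℝ, k =ᵐ[arc] fun t => (c : ℂ) * (f t * ((‖f t‖ ^ (p.toReal - 2) : ℝ) : ℂ)) := by
  rcases eq_or_ne f 0 with rfl | hf
  · refine ⟨0, by simp, by simp [pair_zero_left], 0, ?_⟩
    filter_upwards [Lp.coeFn_zero ℂ q arc] with t ht
    simp
  have hq' : q < ∞ := conj_lt_top (p := p) hp
  have hP := one_lt_toReal hp hp'
  have hpq' := holder_toReal (q := q) hp hp'
  set P := p.toReal with hPdef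
  set Q := q.toReal with hQdef
  have hQ : (P - 1) * Q = P := hpq'.sub_one_mul_conj
  have hQ0 : 0 < Q := hpq'.symm.pos
  have hN : 0 < ‖f‖ := norm_pos_iff.2 hf
  let k₀ : Circle → ℂ := fun t => f t * ((‖f t‖ ^ (P - 2) : ℝ) : ℂ)
  have hk₀ : ∀ t, ‖k₀ t‖ = ‖f t‖ ^ (P - 1) := fun t => by
    rw [norm_mul, Complex.norm_real, Real.norm_eq_abs, abs_of_nonneg (by positivity)]
    -- The exponent `P - 2` may be negative, so zeros of `f` are treated apart; both sides vanish
    -- there since `P > 1`.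
    rcases eq_or_ne ‖f t‖ 0 with h | h
    · rw [h, zero_mul, Real.zero_rpow (by linarith)]
    · rw [show P - 1 = 1 + (P - 2) by ring, Real.rpow_add (lt_of_le_of_ne (norm_nonneg _) h.symm),
        Real.rpow_one]
  have hk₀Q : ∀ t, ‖k₀ t‖ ^ Q = ‖f t‖ ^ P := fun t => by
    rw [hk₀, ← Real.rpow_mul (norm_nonneg _), hQ]
  have hm : AEStronglyMeasurable k₀ arc := by
    refine (Lp.aestronglyMeasurable f).mul ?_
    refine (Complex.measurable_ofReal.comp_aemeasurable ?_).aestronglyMeasurable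
    exact (Lp.aestronglyMeasurable f).norm.aemeasurable.pow_const _
  have hk₀L : MemLp k₀ q arc := by
    rw [← integrable_norm_rpow_iff hm (zero_lt_one.trans_le hq1.out).ne' hq'.ne]
    simp only [← hQdef, hk₀Q]
    exact (Lp.memLp f).integrable_norm_rpow (zero_lt_one.trans_le hp1.out).ne' hp'.ne
  have hnorm : ‖hk₀L.toLp k₀‖ = ‖f‖ ^ (P - 1) := by
    have h1 : ‖hk₀L.toLp k₀‖ ^ Q = (‖f‖ ^ (P - 1)) ^ Q := by
      rw [norm_rpow_eq_integral hq', ← Real.rpow_mul (norm_nonneg _), hQ,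
        norm_rpow_eq_integral hp']
      refine integral_congr_ae ?_
      filter_upwards [hk₀L.coeFn_toLp] with t ht
      rw [ht, hk₀Q]
    exact (Real.rpow_left_inj (norm_nonneg _) (by positivity) hQ0.ne').1 h1
  have hpair : pair f (hk₀L.toLp k₀) = ((‖f‖ ^ P : ℝ) : ℂ) := by
    rw [norm_rpow_eq_integral hp', ← integral_complex_ofReal]
    refine integral_congr_ae ?_
    filter_upwards [hk₀L.coeFn_toLp] with t ht
    rw [ht]
    have : f t * conj (k₀ t) = ((‖f t‖ ^ 2 * ‖f t‖ ^ (P - 2) : ℝ) : ℂ) := by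
      simp only [k₀, map_mul, Complex.conj_ofReal, ← mul_assoc, Complex.mul_conj,
        Complex.normSq_eq_norm_sq, Complex.ofReal_mul]
    rw [this]
    congr 1
    rcases eq_or_ne ‖f t‖ 0 with h | h
    · rw [h, ← hPdef, Real.zero_rpow (x := P) (by linarith)]; simp
    · rw [← Real.rpow_natCast, ← Real.rpow_add (lt_of_le_of_ne (norm_nonneg _) h.symm)]
      congr 1
      push_cast
      ring
  -- Since `k₀` has norm `‖f‖ ^ (P - 1)` and pairs with `f` to `‖f‖ ^ P`, the factor `‖f‖ ^ (1 - P)`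
  -- normalises it.
  refine ⟨((‖f‖ ^ (1 - P) : ℝ) : ℂ) • hk₀L.toLp k₀, ?_, ?_, ‖f‖ ^ (1 - P), ?_⟩
  · rw [norm_smul, Complex.norm_real, Real.norm_eq_abs, abs_of_nonneg (by positivity), hnorm,
      ← Real.rpow_add hN]
    simp
  · rw [pair_smul_right, hpair, Complex.conj_ofReal, ← Complex.ofReal_mul, ← Real.rpow_add hN]
    simp
  · filter_upwards [Lp.coeFn_smul ((‖f‖ ^ (1 - P) : ℝ) : ℂ) (hk₀L.toLp k₀), hk₀L.coeFn_toLp]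
      with t ht ht'
    rw [ht, Pi.smul_apply, ht', smul_eq_mul]

lemma norm_le_of_pair (hp : 1 < p) (hp' : p < ∞) (f : Lp ℂ p arc) {C : ℝ}
    (h : ∀ k : Lp ℂ q arc, ‖k‖ ≤ 1 → ‖pair f k‖ ≤ C) : ‖f‖ ≤ C := by
  obtain ⟨k, hk, hk', -⟩ := exists_extremal (q := q) hp hp' f
  have := h k hk
  rwa [hk', Complex.norm_real, norm_norm] at this

lemma eq_zero_of_pair (hp : 1 < p) (hp' : p < ∞) {f : Lp ℂ p arc}
    (h : ∀ k : Lp ℂ q arc, pair f k = 0) : f = 0 :=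
  norm_le_zero_iff.1 (norm_le_of_pair (q := q) hp hp' f fun k _ => by simp [h k])

lemma eq_of_pair (hp : 1 < p) (hp' : p < ∞) {f g : Lp ℂ p arc}
    (h : ∀ k : Lp ℂ q arc, pair f k = pair g k) : f = g :=
  sub_eq_zero.1 (eq_zero_of_pair (q := q) hp hp' fun k => by rw [pair_sub_left, h, sub_self])

end Extremal

/-! ### Fourier coefficients determine a function. -/

section FourierUniqueness

variable {p : ℝ≥0∞} [hp1 : Fact (1 ≤ p)]

instance instFactConjExponent : Fact (1 ≤ ENNReal.conjExponent p) := ⟨le_self_add⟩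

/-- The functionals on `L^q` given by `f` and `g` agree on monomials, hence everywhere because `q <
∞`; pairing with `L^q` separates points of `L^p`. -/
lemma eq_of_fcoef (hp : 1 < p) (hp' : p < ∞) {f g : Lp ℂ p arc}
    (h : ∀ n, fcoef f n = fcoef g n) : f = g := by
  have : (ENNReal.conjExponent p).HolderConjugate p := ENNReal.HolderConjugate.symm
  refine eq_of_pair (q := ENNReal.conjExponent p) hp hp' fun k => ?_
  rw [← pair_symm k f, ← pair_symm k g, ← pairL_apply, ← pairL_apply]
  congr 2
  refine clm_ext_mono (conj_lt_top (p := p) hp).ne fun n => ?_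
  rw [pairL_apply, pairL_apply, ← pair_symm f, ← pair_symm g, pair_mono, pair_mono, h]

lemma fcoef_add (f g : Lp ℂ p arc) (n : ℤ) : fcoef (f + g : Lp ℂ p arc) n = fcoef f n + fcoef g n := by
  simp only [← pair_mono (q := ENNReal.conjExponent p), pair_add_left]

lemma fcoef_sub (f g : Lp ℂ p arc) (n : ℤ) : fcoef (f - g : Lp ℂ p arc) n = fcoef f n - fcoef g n := by
  simp only [← pair_mono (q := ENNReal.conjExponent p), pair_sub_left]

lemma fcoef_smul (c : ℂ) (f : Lp ℂ p arc) (n : ℤ) : fcoef (c • f : Lp ℂ p arc) n = c * fcoef f n := by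
  simp only [← pair_mono (q := ENNReal.conjExponent p), pair_smul_left]

/-- The `n`-th Fourier coefficient as a functional on `L^p`. -/
def fcoefL (n : ℤ) : Lp ℂ p arc →L[ℂ] ℂ := pairL (mono (ENNReal.conjExponent p) n)

lemma fcoefL_apply (n : ℤ) (f : Lp ℂ p arc) : fcoefL n f = fcoef f n := by
  rw [fcoefL, pairL_apply, pair_mono]

lemma fcoef_trigLp (a : ℤ →₀ ℂ) (n : ℤ) : fcoef (trigLp p a) n = a n := by
  rw [← fcoefL_apply, trigLp_eq_sum, Finsupp.sum, map_sum]
  simp [fcoefL_apply, fcoef_mono, eq_comm]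

end FourierUniqueness

/-! ### The theorem of M. Riesz -/

/-- With `θ = |arg w| < π/2` and `|w| ^ r` divided out, the claim is `1 ≤ A cos^r θ - B cos (r θ)`.
Away from `π/2` the first term suffices; near `π/2` the cosine of `r θ` is negative, as `π/2 < r π/2
≤ π`. -/
lemma exists_rpow_le {r : ℝ} (h1 : 1 < r) (h2 : r ≤ 2) :
    ∃ A B : ℝ, 0 ≤ A ∧ 0 ≤ B ∧
      ∀ w : ℂ, 0 < w.re → ‖w‖ ^ r ≤ A * w.re ^ r - B * (w ^ (r : ℂ)).re := by
  have hpi := Real.pi_pos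
  -- The midpoint of `π/(2r)` and `π/2`: both `cos θ₀ > 0` and `cos (r θ₀) < 0` hold there.
  obtain ⟨θ₀, hθ₀⟩ : ∃ θ : ℝ, θ = Real.pi / 4 * (1 + 1 / r) := ⟨_, rfl⟩
  have hr : 1 / r < 1 := by rw [div_lt_one (by linarith)]; exact h1
  have hr' : 0 < 1 / r := by positivity
  have hθpos : 0 < θ₀ := by rw [hθ₀]; positivity
  have hθlt : θ₀ < Real.pi / 2 := by rw [hθ₀]; nlinarith
  have hrθ : r * θ₀ = Real.pi / 4 * (r + 1) := by rw [hθ₀]; field_simp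
  have hm : 0 < Real.cos θ₀ := Real.cos_pos_of_mem_Ioo ⟨by linarith, hθlt⟩
  have hc : Real.cos (r * θ₀) < 0 :=
    Real.cos_neg_of_pi_div_two_lt_of_lt (by rw [hrθ]; nlinarith) (by rw [hrθ]; nlinarith)
  set c := -Real.cos (r * θ₀) with hcdef
  have hc0 : 0 < c := by rw [hcdef]; linarith
  set m := Real.cos θ₀ ^ r with hmdef
  have hm0 : 0 < m := Real.rpow_pos_of_pos hm r
  refine ⟨(1 + 1 / c) / m, 1 / c, by positivity, by positivity, fun w hw => ?_⟩
  set θ := |w.arg| with hθdef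
  have hθ0 : 0 ≤ θ := abs_nonneg _
  have hθ : θ < Real.pi / 2 := Complex.abs_arg_lt_pi_div_two_iff.2 (Or.inl hw)
  have hre : w.re = ‖w‖ * Real.cos θ := by
    rw [hθdef, Real.cos_abs, Complex.norm_mul_cos_arg]
  have hpow : (w ^ (r : ℂ)).re = ‖w‖ ^ r * Real.cos (r * θ) := by
    rw [Complex.cpow_ofReal_re]
    congr 1
    rw [← Real.cos_abs (w.arg * r), abs_mul, abs_of_pos (by linarith : (0 : ℝ) < r), mul_comm]
  have hcos : 0 < Real.cos θ := Real.cos_pos_of_mem_Ioo ⟨by linarith, hθ⟩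
  rw [hpow, hre, Real.mul_rpow (norm_nonneg _) hcos.le]
  have key : 1 ≤ (1 + 1 / c) / m * Real.cos θ ^ r - 1 / c * Real.cos (r * θ) := by
    rcases le_total θ θ₀ with h | h
    · have h3 : m ≤ Real.cos θ ^ r := by
        refine Real.rpow_le_rpow hm.le ?_ (by linarith)
        exact Real.cos_le_cos_of_nonneg_of_le_pi hθ0 (by linarith) h
      have h4 : 1 + 1 / c ≤ (1 + 1 / c) / m * Real.cos θ ^ r := by
        rw [div_mul_eq_mul_div, le_div_iff₀ hm0]
        gcongr
      have h5 : 1 / c * Real.cos (r * θ) ≤ 1 / c * 1 := by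
        gcongr
        exact Real.cos_le_one _
      linarith
    · have h3 : Real.cos (r * θ) ≤ -c := by
        rw [hcdef, neg_neg]
        refine Real.cos_le_cos_of_nonneg_of_le_pi (by positivity) ?_ (by gcongr)
        nlinarith
      have h4 : 0 ≤ (1 + 1 / c) / m * Real.cos θ ^ r := by positivity
      have h5 : 1 / c * Real.cos (r * θ) ≤ 1 / c * (-c) := by gcongr
      have h6 : 1 / c * (-c) = -1 := by field_simp
      linarith
  have hw0 : 0 ≤ ‖w‖ ^ r := by positivity
  calc ‖w‖ ^ r = ‖w‖ ^ r * 1 := (mul_one _).symm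
    _ ≤ ‖w‖ ^ r * ((1 + 1 / c) / m * Real.cos θ ^ r - 1 / c * Real.cos (r * θ)) := by gcongr
    _ = _ := by ring

/-- If `Re F ≥ δ` on the unit circle, then also on the closed unit disc. -/
lemma le_re_of_le_re_sphere {F : ℂ → ℂ} (hF : Differentiable ℂ F) {δ : ℝ}
    (h : ∀ t : Circle, δ ≤ (F t).re) {z : ℂ} (hz : z ∈ Metric.closedBall (0 : ℂ) 1) :
    δ ≤ (F z).re := by
  -- Maximum modulus for `exp (-F)`, whose modulus is `exp (-Re F)`.
  have h1 : ‖Complex.exp (-F z)‖ ≤ Real.exp (-δ) := by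
    refine Complex.norm_le_of_forall_mem_frontier_norm_le (U := Metric.ball 0 1)
      (f := fun z => Complex.exp (-F z)) Metric.isBounded_ball
      (Differentiable.diffContOnCl (by fun_prop)) (fun w hw => ?_) ?_
    · rw [frontier_ball _ one_ne_zero] at hw
      have := h ⟨w, hw⟩
      rw [Complex.norm_exp, Complex.neg_re]
      exact Real.exp_le_exp.2 (neg_le_neg this)
    · rwa [closure_ball _ one_ne_zero]
  rw [Complex.norm_exp, Complex.neg_re] at h1
  have := Real.exp_le_exp.1 h1
  linarith

lemma integrable_arc_of_continuous {E : Type*} [NormedAddCommGroup E] {f : Circle → E}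
    (hf : Continuous f) : Integrable f arc :=
  integrableOn_univ.1 (hf.continuousOn.integrableOn_compact isCompact_univ)

/-- The values of `F` on the closed disc stay off the branch cut, so `F ^ r` is holomorphic and its
mean is `F(0) ^ r`. This is nonnegative because `F(0)` is a positive real, so on integrating the
pointwise inequality the `B` term can be dropped. -/
lemma integral_norm_rpow_le {r : ℝ} (h1 : 1 < r) (h2 : r ≤ 2) :
    ∃ A : ℝ, 0 ≤ A ∧ ∀ F : ℂ → ℂ, Differentiable ℂ F → ∀ δ : ℝ, 0 < δ →
      (∀ t : Circle, δ ≤ (F t).re) → (F 0).im = 0 →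
      ∫ t : Circle, ‖F t‖ ^ r ∂arc ≤ A * ∫ t : Circle, (F t).re ^ r ∂arc := by
  obtain ⟨A, B, hA, hB, hAB⟩ := exists_rpow_le h1 h2
  refine ⟨A, hA, fun F hF δ hδ hre him => ?_⟩
  have hpos : ∀ z ∈ Metric.closedBall (0 : ℂ) 1, 0 < (F z).re := fun z hz =>
    hδ.trans_le (le_re_of_le_re_sphere hF hre hz)
  have hr0 : (0 : ℝ) ≤ r := by linarith
  have hc : ContinuousOn (fun z => F z ^ (r : ℂ)) (Metric.closedBall 0 1) :=
    hF.continuous.continuousOn.cpow_const fun z hz => Or.inl (hpos z hz)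
  have hmean : ∫ t : Circle, F t ^ (r : ℂ) ∂arc = F 0 ^ (r : ℂ) := by
    refine integral_arc_of_diffContOnCl (f := fun z => F z ^ (r : ℂ)) ⟨?_, ?_⟩
    · intro z hz
      exact (hF z).differentiableWithinAt.cpow_const
        (Or.inl (hpos z (Metric.ball_subset_closedBall hz)))
    · rwa [closure_ball _ one_ne_zero]
  have hF' : Continuous fun t : Circle => F t := hF.continuous.comp continuous_subtype_val
  have hint : Integrable (fun t : Circle => F t ^ (r : ℂ)) arc := by
    refine integrable_arc_of_continuous (hc.comp_continuous continuous_subtype_val fun t => ?_)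
    simp [Circle.norm_coe]
  have i1 : Integrable (fun t : Circle => ‖F t‖ ^ r) arc :=
    integrable_arc_of_continuous (hF'.norm.rpow_const fun _ => Or.inr hr0)
  have i2 : Integrable (fun t : Circle => (F t).re ^ r) arc :=
    integrable_arc_of_continuous
      ((Complex.continuous_re.comp hF').rpow_const fun _ => Or.inr hr0)
  have i3 : Integrable (fun t : Circle => (F t ^ (r : ℂ)).re) arc := hint.re
  have hF0 : 0 ≤ (F 0 ^ (r : ℂ)).re := by
    have : F 0 = (((F 0).re : ℝ) : ℂ) := Complex.ext rfl (by simp [him])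
    rw [this, ← Complex.ofReal_cpow (hpos 0 (by simp)).le, Complex.ofReal_re]
    have := (hpos 0 (by simp)).le
    positivity
  calc ∫ t : Circle, ‖F t‖ ^ r ∂arc
      ≤ ∫ t : Circle, (A * (F t).re ^ r - B * (F t ^ (r : ℂ)).re) ∂arc :=
        integral_mono i1 ((i2.const_mul A).sub (i3.const_mul B)) fun t =>
          hAB _ (hδ.trans_le (hre t))
    _ = A * ∫ t : Circle, (F t).re ^ r ∂arc - B * ∫ t : Circle, (F t ^ (r : ℂ)).re ∂arc := by
        rw [integral_sub (i2.const_mul A) (i3.const_mul B), integral_const_mul,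
          integral_const_mul]
    _ = A * ∫ t : Circle, (F t).re ^ r ∂arc - B * (F 0 ^ (r : ℂ)).re := by
        rw [← hmean]
        congr 2
        exact integral_re hint
    _ ≤ _ := by
        have := mul_nonneg hB hF0
        linarith

/-- The part of a coefficient sequence with nonnegative indices. -/
def nonnegPart : (ℤ →₀ ℂ) →ₗ[ℂ] (ℤ →₀ ℂ) where
  toFun := Finsupp.filter fun n => 0 ≤ n
  map_add' _ _ := Finsupp.filter_add
  map_smul' _ _ := Finsupp.filter_smul

lemma nonnegPart_apply (a : ℤ →₀ ℂ) (n : ℤ) : nonnegPart a n = if 0 ≤ n then a n else 0 :=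
  Finsupp.filter_apply _ _ _

/-- The coefficients of the complex conjugate of a trigonometric polynomial. -/
def conjCoef (a : ℤ →₀ ℂ) : ℤ →₀ ℂ :=
  (a.mapRange (starRingEnd ℂ) (map_zero _)).equivMapDomain (Equiv.neg ℤ)

lemma conjCoef_apply (a : ℤ →₀ ℂ) (n : ℤ) : conjCoef a n = conj (a (-n)) := rfl

lemma conjCoef_add (a b : ℤ →₀ ℂ) : conjCoef (a + b) = conjCoef a + conjCoef b := by
  ext n; simp [conjCoef_apply]

lemma trig_conjCoef (a : ℤ →₀ ℂ) (t : Circle) : trig (conjCoef a) t = conj (trig a t) := by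
  induction a using Finsupp.induction_linear with
  | zero =>
    have : conjCoef 0 = 0 := by ext n; simp [conjCoef_apply]
    simp [this]
  | add a b ha hb => simp [conjCoef_add, ha, hb]
  | single n c =>
    have : conjCoef (Finsupp.single n c) = Finsupp.single (-n) (conj c) := by
      ext m
      rw [conjCoef_apply, Finsupp.single_apply, Finsupp.single_apply]
      have : n = -m ↔ -n = m := by constructor <;> intro h <;> omega
      simp only [this]
      split_ifs <;> simp
    simp [this, trig_single, conj_coe]

/-- Real trigonometric polynomials. -/
def IsHerm (a : ℤ →₀ ℂ) : Prop := conjCoef a = a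

lemma isHerm_half_add (a : ℤ →₀ ℂ) : IsHerm ((1 / 2 : ℂ) • (a + conjCoef a)) := by
  ext n
  have h2 : conj (2 : ℂ) = 2 := Complex.conj_ofNat 2
  simp [conjCoef_apply, add_comm, h2]

lemma IsHerm.sub {a b : ℤ →₀ ℂ} (ha : IsHerm a) (hb : IsHerm b) : IsHerm (a - b) := by
  ext n
  have h1 := DFunLike.congr_fun ha n
  have h2 := DFunLike.congr_fun hb n
  rw [conjCoef_apply] at h1 h2 ⊢
  simp [h1, h2]

lemma trig_half_add (a : ℤ →₀ ℂ) (t : Circle) :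
    trig ((1 / 2 : ℂ) • (a + conjCoef a)) t = (((trig a t).re : ℝ) : ℂ) := by
  rw [map_smul, map_add, ContinuousMap.smul_apply, ContinuousMap.add_apply, trig_conjCoef,
    Complex.re_eq_add_conj]
  simp [div_eq_inv_mul]

lemma IsHerm.zero_im {a : ℤ →₀ ℂ} (ha : IsHerm a) : (a 0).im = 0 := by
  have h1 := DFunLike.congr_fun ha 0
  rw [conjCoef_apply, neg_zero] at h1
  exact Complex.conj_eq_iff_im.1 h1

/-- For Hermitian coefficients, the part with nonpositive indices is the conjugate of the part with
nonnegative ones, and adding the two counts the constant term twice. Thus `2 P a - a 0` is the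
analytic completion of the real polynomial `a`. -/
lemma IsHerm.trig_eq {a : ℤ →₀ ℂ} (ha : IsHerm a) (t : Circle) :
    trig a t = (((2 * trig (nonnegPart a) t - a 0).re : ℝ) : ℂ) := by
  have h1 : a + Finsupp.single 0 (a 0) = nonnegPart a + conjCoef (nonnegPart a) := by
    ext n
    have h1 := DFunLike.congr_fun ha n
    rw [conjCoef_apply] at h1
    rw [Finsupp.add_apply, Finsupp.add_apply, conjCoef_apply, nonnegPart_apply, nonnegPart_apply,
      Finsupp.single_apply]
    rcases lt_trichotomy n 0 with h | rfl | h
    · rw [if_neg h.ne', if_neg (not_le.2 h), if_pos (by omega), h1]; ring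
    · simp at h1
      simp [h1]
    · rw [if_neg h.ne, if_pos h.le, if_neg (by omega)]; simp
  have h2 := congrArg (fun b => trig b t) h1
  simp only [map_add, ContinuousMap.add_apply, trig_conjCoef, trig_single] at h2
  have h3 : conj (a 0) = a 0 := Complex.conj_eq_iff_im.2 ha.zero_im
  rw [Complex.re_eq_add_conj]
  simp only [map_sub, map_mul, h3]
  have h4 : conj (2 : ℂ) = 2 := Complex.conj_ofNat 2
  rw [h4]
  simp at h2
  linear_combination h2

/-- The polynomial with the nonnegative coefficients of `a`. -/
def holPart (a : ℤ →₀ ℂ) (z : ℂ) : ℂ := (nonnegPart a).sum fun n c => c * z ^ n.toNat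

lemma holPart_coe (a : ℤ →₀ ℂ) (t : Circle) : holPart a t = trig (nonnegPart a) t := by
  rw [trig_apply, holPart]
  refine Finset.sum_congr rfl fun n hn => ?_
  have h0 : 0 ≤ n := by
    by_contra h
    rw [Finsupp.mem_support_iff, nonnegPart_apply, if_neg h] at hn
    exact hn rfl
  dsimp only
  rw [← zpow_natCast, Int.toNat_of_nonneg h0]

lemma holPart_zero (a : ℤ →₀ ℂ) : holPart a 0 = a 0 := by
  rw [holPart, Finsupp.sum, Finset.sum_eq_single 0]
  · simp [nonnegPart_apply]
  · intro n hn hn0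
    have h0 : 0 ≤ n := by
      by_contra h
      rw [Finsupp.mem_support_iff, nonnegPart_apply, if_neg h] at hn
      exact hn rfl
    rw [zero_pow (by omega), mul_zero]
  · intro h
    rw [Finsupp.notMem_support_iff] at h
    simp [h]

lemma differentiable_holPart (a : ℤ →₀ ℂ) : Differentiable ℂ (holPart a) := by
  unfold holPart Finsupp.sum
  fun_prop

/-! ### Boundedness of the projection on trigonometric polynomials and its extension to `L^p`. -/

section Riesz

variable {p q : ℝ≥0∞} [hp1 : Fact (1 ≤ p)] [hq1 : Fact (1 ≤ q)] [hpq : p.HolderConjugate q]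

lemma trigLp_add_toLp_le {f g h : C(Circle, ℂ)} {ε : ℝ} (hε : 0 ≤ ε)
    (H : ∀ t, ‖f t‖ ≤ ‖g t‖) (H' : ∀ t, ‖h t - f t‖ ≤ ε) :
    ‖(ContinuousMap.toLp p arc ℂ h : Lp ℂ p arc)‖ ≤
      ‖(ContinuousMap.toLp p arc ℂ g : Lp ℂ p arc)‖ + ε := by
  have h1 : h = f + (h - f) := by abel
  rw [h1, map_add]
  refine (norm_add_le _ _).trans (add_le_add ?_ ?_)
  · refine Lp.norm_le_norm_of_ae_le ?_
    filter_upwards [ContinuousMap.coeFn_toLp (p := p) (𝕜 := ℂ) arc f,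
      ContinuousMap.coeFn_toLp (p := p) (𝕜 := ℂ) arc g] with t h2 h3
    rw [h2, h3]
    exact H t
  · exact (norm_toLp_le _).trans ((ContinuousMap.norm_le _ hε).2 H')

/-- `integral_norm_rpow_le` is applied to the analytic completion `F = 2 P a - a 0`, whose real part
on the circle is `a` and for which `F(0) = a 0` is real. Adding back `a 0`, bounded by `‖a‖`, and
halving gives the constant. -/
lemma norm_nonnegPart_le_of_pos (hp : 1 < p) (hp2 : p ≤ 2) :
    ∃ C : ℝ, 0 ≤ C ∧ ∀ a : ℤ →₀ ℂ, IsHerm a → ∀ δ : ℝ, 0 < δ → (∀ t, δ ≤ (trig a t).re) →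
      ‖trigLp p (nonnegPart a)‖ ≤ C * ‖trigLp p a‖ := by
  have hp' : p < ∞ := hp2.trans_lt (by simp)
  have hP := one_lt_toReal hp hp'
  have hP2 : p.toReal ≤ 2 := by
    have := (ENNReal.toReal_le_toReal hp'.ne (by simp)).2 hp2
    simpa using this
  obtain ⟨A, hA, hAF⟩ := integral_norm_rpow_le hP hP2
  refine ⟨(A ^ p.toReal⁻¹ + 1) / 2, by positivity, fun a ha δ hδ hpos => ?_⟩
  set b : ℤ →₀ ℂ := (2 : ℂ) • nonnegPart a - Finsupp.single 0 (a 0) with hb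
  have hbt : ∀ t, trig b t = 2 * holPart a t - a 0 := fun t => by
    simp [hb, trig_single, holPart_coe]
  have hare : ∀ t, trig a t = (((2 * holPart a t - a 0).re : ℝ) : ℂ) := fun t => by
    rw [holPart_coe]; exact ha.trig_eq t
  have hnn : ∀ t : Circle, 0 ≤ (2 * holPart a t - a 0).re := fun t => by
    have := hpos t
    rw [hare, Complex.ofReal_re] at this
    linarith
  have h1 : ‖trigLp p b‖ ^ p.toReal ≤ A * ‖trigLp p a‖ ^ p.toReal := by
    rw [norm_rpow_eq_integral hp', norm_rpow_eq_integral hp']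
    have := hAF (fun z => 2 * holPart a z - a 0)
      (((differentiable_holPart a).const_mul 2).sub_const _) δ hδ (fun t => by
        have := hpos t
        rwa [hare, Complex.ofReal_re] at this) (by simp [holPart_zero, ha.zero_im])
    refine le_trans (le_of_eq ?_) (this.trans (le_of_eq ?_))
    · refine integral_congr_ae ?_
      filter_upwards [coeFn_trigLp p b] with t ht
      rw [ht, hbt]
    · congr 1
      refine integral_congr_ae ?_
      filter_upwards [coeFn_trigLp p a] with t ht
      rw [ht, hare, Complex.norm_real, Real.norm_eq_abs, abs_of_nonneg (hnn t)]
  have h2 : ‖trigLp p b‖ ≤ A ^ p.toReal⁻¹ * ‖trigLp p a‖ := by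
    have := Real.rpow_le_rpow (by positivity) h1 (inv_nonneg.2 (by linarith : 0 ≤ p.toReal))
    rwa [Real.mul_rpow hA (by positivity), ← Real.rpow_mul (norm_nonneg _),
      ← Real.rpow_mul (norm_nonneg _), mul_inv_cancel₀ (by linarith), Real.rpow_one,
      Real.rpow_one] at this
  have h3 : ‖a 0 • mono p 0‖ ≤ ‖trigLp p a‖ := by
    have h4 : ∀ r : ℝ≥0∞, ∀ [Fact (1 ≤ r)], ‖mono r 0‖ ≤ 1 := fun r _ =>
      (norm_toLp_le _).trans ((ContinuousMap.norm_le _ zero_le_one).2 fun t => by simp)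
    have h5 : a 0 = pair (trigLp p a) (mono (ENNReal.conjExponent p) 0) := by
      rw [pair_mono, fcoef_trigLp]
    rw [norm_smul, h5]
    calc _ ≤ (‖trigLp p a‖ * ‖mono (ENNReal.conjExponent p) 0‖) * ‖mono p 0‖ := by
            gcongr; exact norm_pair_le _ _
      _ ≤ (‖trigLp p a‖ * 1) * 1 := by gcongr <;> exact h4 _
      _ = _ := by ring
  have h6 : trigLp p (nonnegPart a) = (1 / 2 : ℂ) • (trigLp p b + a 0 • mono p 0) := by
    rw [hb, map_sub, trigLp_single, map_smul, sub_add_cancel, smul_smul]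
    norm_num
  rw [h6, norm_smul]
  have h7 : ‖(1 / 2 : ℂ)‖ = 1 / 2 := by simp
  rw [h7]
  have := norm_add_le (trigLp p b) (a 0 • mono p 0)
  linarith

/-- A real polynomial is a difference of two strictly positive ones, `a = b' - (b' - a)`, where `b'`
approximates the positive part of `a` from above. Neither norm exceeds `‖a‖` by more than an
arbitrarily small error. -/
lemma norm_nonnegPart_le_of_isHerm (hp : 1 < p) (hp2 : p ≤ 2) :
    ∃ C : ℝ, 0 ≤ C ∧ ∀ a : ℤ →₀ ℂ, IsHerm a →
      ‖trigLp p (nonnegPart a)‖ ≤ C * ‖trigLp p a‖ := by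
  obtain ⟨C, hC, h⟩ := norm_nonnegPart_le_of_pos hp hp2
  refine ⟨2 * C, by positivity, fun a ha => ?_⟩
  have key : ∀ δ : ℝ, 0 < δ →
      ‖trigLp p (nonnegPart a)‖ ≤ 2 * C * ‖trigLp p a‖ + δ * (6 * C) := fun δ hδ => by
    have hreal : ∀ t, trig a t = (((trig a t).re : ℝ) : ℂ) := fun t => by
      conv_lhs => rw [ha.trig_eq t]
      conv_rhs => rw [ha.trig_eq t]
      simp
    let f : C(Circle, ℂ) := ⟨fun t => ((max (trig a t).re 0 : ℝ) : ℂ), by fun_prop⟩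
    let f' : C(Circle, ℂ) := ⟨fun t => ((max (trig a t).re 0 - (trig a t).re : ℝ) : ℂ), by fun_prop⟩
    -- The target is raised by `2δ`, so that after an error `δ` both `b'` and `b' - a` are still at
    -- least `δ`, while exceeding the positive and negative parts of `a` by at most `3δ`.
    obtain ⟨b, hb⟩ := Metric.denseRange_iff.1 denseRange_trig
      (f + ContinuousMap.const _ ((2 * δ : ℝ) : ℂ)) δ hδ
    set b' := (1 / 2 : ℂ) • (b + conjCoef b) with hb'
    have hb'H : IsHerm b' := isHerm_half_add b
    have hbt : ∀ t, |(trig b t).re - (max (trig a t).re 0 + 2 * δ)| ≤ δ := fun t => by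
      have h1 := (ContinuousMap.dist_apply_le_dist t).trans hb.le
      rw [dist_comm, dist_eq_norm] at h1
      refine le_trans ?_ h1
      have := Complex.abs_re_le_norm 
        (trig b t - (f + ContinuousMap.const _ ((2 * δ : ℝ) : ℂ) : C(Circle, ℂ)) t)
      refine le_trans (le_of_eq ?_) this
      simp [f]
    have hb't : ∀ t, trig b' t = (((trig b t).re : ℝ) : ℂ) := trig_half_add b
    have hp1 : ∀ t, δ ≤ (trig b' t).re := fun t => by
      have := abs_le.1 (hbt t)
      rw [hb't, Complex.ofReal_re]
      have := le_max_right (trig a t).re 0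
      linarith
    have hp2 : ∀ t, δ ≤ (trig (b' - a) t).re := fun t => by
      have := abs_le.1 (hbt t)
      rw [map_sub, ContinuousMap.sub_apply, Complex.sub_re, hb't, Complex.ofReal_re]
      have := le_max_left (trig a t).re 0
      linarith
    have n1 : ‖trigLp p b'‖ ≤ ‖trigLp p a‖ + 3 * δ := by
      refine trigLp_add_toLp_le (f := f) (by positivity) (fun t => ?_) (fun t => ?_)
      · change ‖((max (trig a t).re 0 : ℝ) : ℂ)‖ ≤ _
        rw [hreal t, Complex.norm_real, Complex.norm_real, Complex.ofReal_re, Real.norm_eq_abs,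
          Real.norm_eq_abs, abs_of_nonneg (le_max_right _ _)]
        exact max_le (le_abs_self _) (abs_nonneg _)
      · change ‖trig b' t - ((max (trig a t).re 0 : ℝ) : ℂ)‖ ≤ _
        rw [hb't, ← Complex.ofReal_sub, Complex.norm_real, Real.norm_eq_abs]
        have := abs_le.1 (hbt t)
        rw [abs_le]
        constructor <;> linarith
    have n2 : ‖trigLp p (b' - a)‖ ≤ ‖trigLp p a‖ + 3 * δ := by
      refine trigLp_add_toLp_le (f := f') (by positivity) (fun t => ?_) (fun t => ?_)
      · change ‖((max (trig a t).re 0 - (trig a t).re : ℝ) : ℂ)‖ ≤ _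
        rw [hreal t, Complex.norm_real, Complex.norm_real, Complex.ofReal_re, Real.norm_eq_abs,
          Real.norm_eq_abs, abs_of_nonneg (sub_nonneg.2 (le_max_left _ _)), sub_le_iff_le_add]
        exact max_le (by linarith [abs_nonneg (trig a t).re])
          (by linarith [neg_abs_le (trig a t).re])
      · change ‖trig (b' - a) t - ((max (trig a t).re 0 - (trig a t).re : ℝ) : ℂ)‖ ≤ _
        rw [map_sub, ContinuousMap.sub_apply, hb't, hreal t, ← Complex.ofReal_sub,
          ← Complex.ofReal_sub, Complex.norm_real, Real.norm_eq_abs, Complex.ofReal_re]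
        have := abs_le.1 (hbt t)
        rw [abs_le]
        constructor <;> linarith
    have e : trigLp p (nonnegPart a) =
        trigLp p (nonnegPart b') - trigLp p (nonnegPart (b' - a)) := by
      rw [map_sub nonnegPart, map_sub]
      abel
    rw [e]
    calc _ ≤ ‖trigLp p (nonnegPart b')‖ + ‖trigLp p (nonnegPart (b' - a))‖ := norm_sub_le _ _
      _ ≤ C * ‖trigLp p b'‖ + C * ‖trigLp p (b' - a)‖ :=
        add_le_add (h b' hb'H δ hδ hp1) (h _ (hb'H.sub ha) δ hδ hp2)
      _ ≤ C * (‖trigLp p a‖ + 3 * δ) + C * (‖trigLp p a‖ + 3 * δ) := by gcongr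
      _ = _ := by ring
  refine le_of_forall_pos_le_add fun ε hε => ?_
  -- The two errors `3δ`, each multiplied by `C`, add up to `6Cδ ≤ ε`.
  refine (key (ε / (6 * C + 1)) (by positivity)).trans ?_
  gcongr
  rw [div_mul_eq_mul_div, div_le_iff₀ (by positivity)]
  nlinarith

lemma norm_nonnegPart_le (hp : 1 < p) (hp2 : p ≤ 2) :
    ∃ C : ℝ, ∀ a : ℤ →₀ ℂ, ‖trigLp p (nonnegPart a)‖ ≤ C * ‖trigLp p a‖ := by
  obtain ⟨C, hC, h⟩ := norm_nonnegPart_le_of_isHerm hp hp2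
  refine ⟨2 * C, fun a => ?_⟩
  set re := (1 / 2 : ℂ) • (a + conjCoef a) with hre
  set im := (1 / 2 : ℂ) • ((-I) • a + conjCoef ((-I) • a)) with him
  have e : a = re + I • im := by
    ext n
    simp only [hre, him, Finsupp.add_apply, Finsupp.smul_apply, conjCoef_apply, smul_eq_mul,
      map_mul, map_neg, Complex.conj_I]
    linear_combination (1 / 2 * a n - 1 / 2 * conj (a (-n))) * Complex.I_mul_I
  have n1 : ‖trigLp p re‖ ≤ ‖trigLp p a‖ := by
    refine Lp.norm_le_norm_of_ae_le ?_
    filter_upwards [coeFn_trigLp p re, coeFn_trigLp p a] with t h1 h2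
    rw [h1, h2, hre, trig_half_add, Complex.norm_real]
    exact Complex.abs_re_le_norm _
  have n2 : ‖trigLp p im‖ ≤ ‖trigLp p a‖ := by
    refine Lp.norm_le_norm_of_ae_le ?_
    filter_upwards [coeFn_trigLp p im, coeFn_trigLp p a] with t h1 h2
    rw [h1, h2, him, trig_half_add, Complex.norm_real]
    refine (Complex.abs_re_le_norm _).trans ?_
    simp
  have e' : trigLp p (nonnegPart a) = trigLp p (nonnegPart re) + I • trigLp p (nonnegPart im) := by
    conv_lhs => rw [e]
    simp
  rw [e']
  calc _ ≤ ‖trigLp p (nonnegPart re)‖ + ‖I • trigLp p (nonnegPart im)‖ := norm_add_le _ _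
    _ ≤ C * ‖trigLp p re‖ + C * ‖trigLp p im‖ := by
      rw [norm_smul, Complex.norm_I, one_mul]
      exact add_le_add (h _ (isHerm_half_add _)) (h _ (isHerm_half_add _))
    _ ≤ C * ‖trigLp p a‖ + C * ‖trigLp p a‖ := by gcongr
    _ = _ := by ring

lemma exists_projection_of_bound (hp' : p < ∞)
    (h : ∃ C : ℝ, ∀ a : ℤ →₀ ℂ, ‖trigLp p (nonnegPart a)‖ ≤ C * ‖trigLp p a‖) :
    ∃ R : Lp ℂ p arc →L[ℂ] Lp ℂ p arc,
      ∀ f n, fcoef (R f) n = if 0 ≤ n then fcoef f n else 0 := by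
  obtain ⟨R, hRm⟩ : ∃ R : Lp ℂ p arc →L[ℂ] Lp ℂ p arc,
      ∀ a, R (trigLp p a) = trigLp p (nonnegPart a) :=
    ⟨_, LinearMap.extendOfNorm_eq (f := trigLp p ∘ₗ nonnegPart) (denseRange_trigLp hp'.ne) h⟩
  refine ⟨R, fun f n => ?_⟩
  have : fcoefL n ∘L R = if 0 ≤ n then fcoefL n else 0 := by
    refine clm_ext_mono hp'.ne fun m => ?_
    have h1 : mono p m = trigLp p (Finsupp.single m 1) := by rw [trigLp_single, one_smul]
    rw [ContinuousLinearMap.comp_apply, h1, hRm, fcoefL_apply, fcoef_trigLp, nonnegPart_apply]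
    split_ifs
    · rw [fcoefL_apply, fcoef_trigLp]
    · rfl
  have h2 := DFunLike.congr_fun this f
  rw [ContinuousLinearMap.comp_apply, fcoefL_apply] at h2
  rw [h2]
  split_ifs
  · rw [fcoefL_apply]
  · rfl

/-- For `p > 2` the bound is inherited by duality: on trigonometric polynomials the projection is
adjoint to the bounded projection on `L^q` with `q ≤ 2`. -/
lemma exists_projection (hp : 1 < p) (hp' : p < ∞) :
    ∃ R : Lp ℂ p arc →L[ℂ] Lp ℂ p arc,
      ∀ f n, fcoef (R f) n = if 0 ≤ n then fcoef f n else 0 := by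
  refine exists_projection_of_bound hp' ?_
  rcases le_total p 2 with hp2 | hp2
  · exact norm_nonnegPart_le hp hp2
  let q := ENNReal.conjExponent p
  have hpq : p.HolderConjugate q := inferInstance
  have hqp : q.HolderConjugate p := hpq.symm
  have hq : 1 < q := one_lt_conj hp'
  have hq2 : q ≤ 2 := conj_le_two hp2
  obtain ⟨R, hR⟩ := exists_projection_of_bound (conj_lt_top (p := p) hp)
    (norm_nonnegPart_le hq hq2)
  refine ⟨‖R‖, fun a => ?_⟩
  have hadj : ∀ k : Lp ℂ q arc, pair (trigLp p (nonnegPart a)) k = pair (trigLp p a) (R k) := by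
    intro k
    induction a using Finsupp.induction_linear with
    | zero => simp [pair_zero_left]
    | add a b ha hb => simp [pair_add_left, ha, hb]
    | single m c =>
      have h1 : nonnegPart (Finsupp.single m c) = if 0 ≤ m then Finsupp.single m c else 0 := by
        split_ifs with hm
        · exact Finsupp.filter_single_of_pos _ hm
        · exact Finsupp.filter_single_of_neg _ hm
      have h2 : ∀ k' : Lp ℂ q arc, pair (mono p m) k' = conj (fcoef k' m) := fun k' => by
        rw [← pair_symm, pair_mono]
      rw [h1]
      split_ifs with hm
      · rw [trigLp_single, pair_smul_left, pair_smul_left, h2, h2, hR, if_pos hm]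
      · rw [trigLp_single, pair_smul_left, h2, hR, if_neg hm, map_zero, pair_zero_left, map_zero,
          mul_zero]
  refine norm_le_of_pair (q := q) hp hp' _ fun k hk => ?_
  rw [hadj]
  calc _ ≤ ‖trigLp p a‖ * ‖R k‖ := norm_pair_le _ _
    _ ≤ ‖trigLp p a‖ * (‖R‖ * 1) := by
      gcongr
      exact R.le_opNorm_of_le hk
    _ = _ := by ring

end Riesz

/-! ### The projections -/

section Projections

variable {p q : ℝ≥0∞} [hp1 : Fact (1 ≤ p)] [hq1 : Fact (1 ≤ q)] [hpq : p.HolderConjugate q]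

lemma mem_Hardy {f : Lp ℂ p arc} : f ∈ Hardy p ↔ ∀ n : ℤ, n < 0 → fcoef f n = 0 := Iff.rfl

/-- M. Riesz's theorem rules out the default value `0` in the definition of `projP`. The negative
coefficients vanish because the values lie in `Hardy p`. -/
lemma fcoef_projP [hlt : Fact (1 < p)] [hfin : Fact (p < ∞)] (f : Lp ℂ p arc) (n : ℤ) :
    fcoef (projP p f : Lp ℂ p arc) n = if 0 ≤ n then fcoef f n else 0 := by
  have h : ∃ R : Lp ℂ p arc →L[ℂ] Hardy p,
      ∀ (f : Lp ℂ p arc) (n : ℤ), 0 ≤ n → fcoef (R f : Lp ℂ p arc) n = fcoef f n := by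
    obtain ⟨R, hR⟩ := exists_projection hlt.out hfin.out
    have hmem : ∀ f, R f ∈ Hardy p := fun f n hn => by rw [hR, if_neg (not_le.2 hn)]
    refine ⟨R.codRestrict (Hardy p) hmem, fun f n hn => ?_⟩
    change fcoef (R f) n = fcoef f n
    rw [hR, if_pos hn]
  split_ifs with hn
  · rw [projP, dif_pos h]
    exact h.choose_spec f n hn
  · exact (projP p f).2 n (not_le.1 hn)

variable [hlt : Fact (1 < p)] [hfin : Fact (p < ∞)]

lemma ext_fcoef {f g : Lp ℂ p arc} (h : ∀ n, fcoef f n = fcoef g n) : f = g :=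
  eq_of_fcoef hlt.out hfin.out h

lemma projP_coe (f : Hardy p) : projP p (f : Lp ℂ p arc) = f := by
  refine Subtype.ext (ext_fcoef fun n => ?_)
  rw [fcoef_projP]
  split_ifs with hn
  · rfl
  · exact (f.2 n (not_le.1 hn)).symm

lemma projP_of_mem {f : Lp ℂ p arc} (hf : f ∈ Hardy p) : (projP p f : Lp ℂ p arc) = f :=
  congrArg Subtype.val (projP_coe ⟨f, hf⟩)

lemma projP_eq_zero_iff {f : Lp ℂ p arc} : projP p f = 0 ↔ ∀ n : ℤ, 0 ≤ n → fcoef f n = 0 := by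
  constructor
  · intro h n hn
    have := fcoef_projP f n
    rw [if_pos hn, h] at this
    rw [← this, ← fcoefL_apply]
    exact map_zero _
  · intro h
    refine Subtype.ext (ext_fcoef fun n => ?_)
    have h0 : fcoef ((0 : Hardy p) : Lp ℂ p arc) n = 0 := by
      rw [← fcoefL_apply]; exact map_zero _
    rw [fcoef_projP, h0]
    split_ifs with hn
    · exact h n hn
    · rfl

lemma projQ_apply (f : Lp ℂ p arc) : projQ p f = f - projP p f := rfl

lemma projP_projQ (f : Lp ℂ p arc) : projP p (projQ p f) = 0 := by
  rw [projQ_apply, map_sub, projP_coe, sub_self]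

lemma projQ_eq_self {f : Lp ℂ p arc} (h : projP p f = 0) : projQ p f = f := by
  rw [projQ_apply, h]; simp

lemma fcoef_projQ (f : Lp ℂ p arc) (n : ℤ) :
    fcoef (projQ p f) n = if 0 ≤ n then 0 else fcoef f n := by
  rw [projQ_apply, fcoef_sub, fcoef_projP]
  split_ifs <;> simp

lemma mono_mem_Hardy {n : ℤ} (hn : 0 ≤ n) : mono p n ∈ Hardy p := fun m hm => by
  rw [fcoef_mono, if_neg (by omega)]

lemma projP_mono_of_neg {n : ℤ} (hn : n < 0) : projP p (mono p n) = 0 :=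
  projP_eq_zero_iff.2 fun m hm => by rw [fcoef_mono, if_neg (by omega)]

omit hlt hfin in
/-- Operators are adjoint if they are adjoint on monomials. -/
lemma pair_eq_of_mono (hp : p ≠ ∞) (hq : q ≠ ∞) {A : Lp ℂ p arc →L[ℂ] Lp ℂ p arc}
    {B : Lp ℂ q arc →L[ℂ] Lp ℂ q arc}
    (h : ∀ m n, pair (A (mono p m)) (mono q n) = pair (mono p m) (B (mono q n)))
    (f : Lp ℂ p arc) (g : Lp ℂ q arc) : pair (A f) g = pair f (B g) := by
  have hqp := hpq.symm
  have h1 : ∀ f n, pair (A f) (mono q n) = pair f (B (mono q n)) := fun f n => by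
    have : pairL (mono q n) ∘L A = pairL (B (mono q n)) := by
      refine clm_ext_mono hp fun m => ?_
      rw [ContinuousLinearMap.comp_apply, pairL_apply, pairL_apply, h]
    have := DFunLike.congr_fun this f
    rwa [ContinuousLinearMap.comp_apply, pairL_apply, pairL_apply] at this
  have h2 : pairL (A f) = pairL f ∘L B := by
    refine clm_ext_mono hq fun n => ?_
    rw [ContinuousLinearMap.comp_apply, pairL_apply, pairL_apply, ← pair_symm, h1, pair_symm]
  have := DFunLike.congr_fun h2 g
  rw [ContinuousLinearMap.comp_apply, pairL_apply, pairL_apply] at this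
  rw [← pair_symm g, this, pair_symm]

lemma pair_projP [Fact (1 < q)] [hqfin : Fact (q < ∞)] (f : Lp ℂ p arc) (g : Lp ℂ q arc) :
    pair (projP p f : Lp ℂ p arc) g = pair f (projP q g : Lp ℂ q arc) := by
  have hqp := hpq.symm
  refine pair_eq_of_mono (A := (Hardy p).subtypeL ∘L projP p) (B := (Hardy q).subtypeL ∘L projP q)
    hfin.out.ne hqfin.out.ne (fun m n => ?_) f g
  change pair (projP p (mono p m) : Lp ℂ p arc) (mono q n) =
    pair (mono p m) (projP q (mono q n) : Lp ℂ q arc)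
  rw [← pair_symm (projP q (mono q n) : Lp ℂ q arc), pair_mono, pair_mono, fcoef_projP,
    fcoef_projP, fcoef_mono, fcoef_mono]
  by_cases h : m = n
  · subst h
    split_ifs <;> simp
  · simp [h, Ne.symm h]

end Projections

/-! ### Multiplication operators -/

section Multiplication

variable {p q : ℝ≥0∞} [hp1 : Fact (1 ≤ p)] [hq1 : Fact (1 ≤ q)] [hpq : p.HolderConjugate q]

lemma memLp_top_of_continuous {g : Circle → ℂ} (hg : Continuous g) : MemLp g ∞ arc :=
  memLp_top_of_bound hg.aestronglyMeasurable ‖(⟨g, hg⟩ : C(Circle, ℂ))‖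
    (Filter.Eventually.of_forall fun t => (⟨g, hg⟩ : C(Circle, ℂ)).norm_coe_le_norm t)

lemma memLp_top_mul {g h : Circle → ℂ} (hg : MemLp g ∞ arc) (hh : MemLp h ∞ arc) :
    MemLp (fun t => g t * h t) ∞ arc := hh.mul hg

lemma memLp_top_conj {g : Circle → ℂ} (hg : MemLp g ∞ arc) :
    MemLp (fun t => conj (g t)) ∞ arc := hg.star

lemma memLp_top_zpow (n : ℤ) : MemLp (fun t : Circle => (t : ℂ) ^ n) ∞ arc :=
  memLp_top_of_continuous (zpowC n).continuous

lemma coeFn_mulOp {g : Circle → ℂ} (hg : MemLp g ∞ arc) (f : Lp ℂ p arc) :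
    mulOp p g f =ᵐ[arc] fun t => g t * f t := by
  rw [mulOp, dif_pos hg, ContinuousLinearMap.holderL_apply_apply]
  filter_upwards [ContinuousLinearMap.coeFn_holder (r := p) (ContinuousLinearMap.mul ℂ ℂ)
    (hg.toLp g) f, hg.coeFn_toLp] with t h1 h2
  rw [h1, h2]
  rfl

lemma mulOp_congr {g h : Circle → ℂ} (H : g =ᵐ[arc] h) : mulOp p g = mulOp p h := by
  by_cases hg : MemLp g ∞ arc
  · have hh : MemLp h ∞ arc := hg.ae_eq H
    rw [mulOp, mulOp, dif_pos hg, dif_pos hh]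
    congr 1
    exact MemLp.toLp_congr _ _ H
  · have hh : ¬ MemLp h ∞ arc := fun hh => hg (hh.ae_eq H.symm)
    rw [mulOp, mulOp, dif_neg hg, dif_neg hh]

lemma mulOp_mulOp {g h : Circle → ℂ} (hg : MemLp g ∞ arc) (hh : MemLp h ∞ arc) (f : Lp ℂ p arc) :
    mulOp p g (mulOp p h f) = mulOp p (fun t => g t * h t) f := by
  refine Lp.ext ?_
  filter_upwards [coeFn_mulOp hg (mulOp p h f), coeFn_mulOp hh f,
    coeFn_mulOp (memLp_top_mul hg hh) f] with t h1 h2 h3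
  rw [h1, h2, h3, mul_assoc]

lemma mulOp_eq_self {g : Circle → ℂ} (hg : ∀ᵐ t ∂arc, g t = 1) (f : Lp ℂ p arc) :
    mulOp p g f = f := by
  have : MemLp g ∞ arc := (memLp_top_of_continuous (continuous_const (y := (1 : ℂ)))).ae_eq
    (hg.mono fun t ht => ht.symm)
  refine Lp.ext ?_
  filter_upwards [coeFn_mulOp this f, hg] with t h1 h2
  rw [h1, h2, one_mul]

lemma mulOp_cancel {g h : Circle → ℂ} (hg : MemLp g ∞ arc) (hh : MemLp h ∞ arc)
    (H : ∀ᵐ t ∂arc, g t * h t = 1) (f : Lp ℂ p arc) : mulOp p g (mulOp p h f) = f := by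
  rw [mulOp_mulOp hg hh, mulOp_eq_self H]

lemma pair_mulOp {g : Circle → ℂ} (hg : MemLp g ∞ arc) (f : Lp ℂ p arc) (k : Lp ℂ q arc) :
    pair (mulOp p g f) k = pair f (mulOp q (fun t => conj (g t)) k) := by
  refine integral_congr_ae ?_
  filter_upwards [coeFn_mulOp hg f, coeFn_mulOp (memLp_top_conj hg) k] with t h1 h2
  rw [h1, h2, map_mul, Complex.conj_conj]
  ring

lemma fcoef_mulOp_zpow (m : ℤ) (f : Lp ℂ p arc) (n : ℤ) :
    fcoef (mulOp p (fun t => (t : ℂ) ^ m) f) n = fcoef f (n - m) := by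
  refine integral_congr_ae ?_
  filter_upwards [coeFn_mulOp (memLp_top_zpow m) f] with t h1
  rw [h1, mul_right_comm, mul_comm, ← zpow_add₀ (Circle.coe_ne_zero t)]
  congr 2
  ring

end Multiplication

/-! ### The weighted shift -/

section Shift

variable (β : ℂ) [hβ : Fact (1 < ‖β‖)]

/-- The weight `t⁻¹ α₋(t)` of the shift `J_α`. -/
def weight (t : Circle) : ℂ := (t : ℂ)⁻¹ * alphaMinus β t

lemma weight_eq (t : Circle) : weight β t = lam β / (conj β * (t : ℂ) - 1) := by
  have := Circle.coe_ne_zero t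
  have := denom_ne_zero β t
  rw [weight, alphaMinus]
  field_simp

lemma continuous_weight : Continuous (weight β) := by
  have : weight β = fun t : Circle => lam β / (conj β * (t : ℂ) - 1) := funext (weight_eq β)
  rw [this]
  exact Continuous.div (by fun_prop) (by fun_prop) (denom_ne_zero β)

lemma continuous_alpha : Continuous (alpha β) := (alpha_lipschitz β).continuous

lemma lam_mul_lam : lam β * lam β = 1 - β * conj β := by
  have h := hβ.out
  have h1 : (0 : ℝ) ≤ ‖β‖ ^ 2 - 1 := by nlinarith
  have h2 : ((Real.sqrt (‖β‖ ^ 2 - 1) : ℝ) : ℂ) * (Real.sqrt (‖β‖ ^ 2 - 1) : ℝ) =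
      β * conj β - 1 := by
    rw [← Complex.ofReal_mul, Real.mul_self_sqrt h1, Complex.mul_conj, Complex.normSq_eq_norm_sq]
    push_cast
    rfl
  rw [lam]
  linear_combination (Real.sqrt (‖β‖ ^ 2 - 1) : ℂ) * (Real.sqrt (‖β‖ ^ 2 - 1) : ℂ) *
    Complex.I_mul_I - h2

lemma conj_lam : conj (lam β) = -lam β := by
  simp [lam]

/-- This is `J_α² = I`; the constant `λ` is normalised by `λ² = 1 - |β|²` for this purpose. -/
lemma weight_mul_weight (t : Circle) : weight β (alpha β t) * weight β t = 1 := by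
  have h1 := denom_ne_zero β t
  have h2 := denom_ne_zero β (alpha β t)
  have h3 := lam_mul_lam β
  have h4 : (conj β * (alpha β t : ℂ) - 1) * (conj β * (t : ℂ) - 1) = 1 - β * conj β := by
    rw [coe_alpha]
    field_simp
    ring
  rw [weight_eq, weight_eq, div_mul_div_comm, h4, h3, div_self]
  rw [← h4]
  exact mul_ne_zero h2 h1

lemma sub_ne_zero_of_norm_le {z : ℂ} (hz : ‖z‖ ≤ 1) : z - β ≠ 0 := fun h => by
  have h1 := hβ.out
  rw [sub_eq_zero.1 h] at hz
  linarith

/-- As `|β| > 1`, the pole lies outside the closed disc, and the factor `t` makes the value at the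
origin vanish. -/
lemma integral_eq_zero_of_eq_div {f : Circle → ℂ} (g : ℂ → ℂ) (hg : Differentiable ℂ g) (k : ℕ)
    (h : ∀ t : Circle, f t = (t : ℂ) * g t / ((t : ℂ) - β) ^ k) : ∫ t, f t ∂arc = 0 := by
  have h1 : DiffContOnCl ℂ (fun z => z * g z / (z - β) ^ k) (Metric.ball 0 1) := by
    refine DifferentiableOn.diffContOnCl fun z hz => ?_
    rw [closure_ball _ one_ne_zero, mem_closedBall_zero_iff] at hz
    exact (DifferentiableAt.div (𝕜 := ℂ) (c := fun z => z * g z) (d := fun z => (z - β) ^ k)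
      (by fun_prop) (by fun_prop)
      (pow_ne_zero _ (sub_ne_zero_of_norm_le β hz))).differentiableWithinAt
  have h2 := integral_arc_of_diffContOnCl h1
  rw [zero_mul, zero_div] at h2
  rw [← h2]
  exact integral_congr_ae (Filter.Eventually.of_forall h)

lemma conj_weight (t : Circle) : conj (weight β t) = lam β * t / ((t : ℂ) - β) := by
  have h1 := sub_ne_zero_of_norm_le β (Circle.norm_coe t).le
  have h2 := Circle.coe_ne_zero t
  rw [weight_eq, map_div₀, conj_lam, map_sub, map_mul, Complex.conj_conj, conj_coe, map_one]
  have h3 : β * (t : ℂ)⁻¹ - 1 = -((t : ℂ) - β) / t := by field_simp; ring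
  rw [h3]
  field_simp

lemma alpha_inv (t : Circle) : (alpha β t : ℂ)⁻¹ = (conj β * t - 1) / ((t : ℂ) - β) := by
  rw [coe_alpha, inv_div]

/-- This is `P J_α P = 0` on monomials. The pole of the integrand lies inside the disc; conjugation
on the circle reflects it to `β`. -/
lemma integral_weight_mul_zpow_nonneg {n m : ℤ} (hn : 0 ≤ n) (hm : 0 ≤ m) :
    ∫ t : Circle, weight β t * (alpha β t : ℂ) ^ n * (t : ℂ) ^ (-m) ∂arc = 0 := by
  obtain ⟨n, rfl⟩ := Int.eq_ofNat_of_zero_le hn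
  obtain ⟨m, rfl⟩ := Int.eq_ofNat_of_zero_le hm
  rw [← map_eq_zero (starRingEnd ℂ), ← integral_conj_arc]
  refine integral_eq_zero_of_eq_div β (fun z => lam β * (conj β * z - 1) ^ n * z ^ m)
    (by fun_prop) (n + 1) fun t => ?_
  have h1 := sub_ne_zero_of_norm_le β (Circle.norm_coe t).le
  rw [map_mul, map_mul, conj_weight, conj_zpow, conj_zpow, neg_neg, zpow_natCast, zpow_neg,
    zpow_natCast, ← inv_pow, alpha_inv, div_pow]
  field_simp
  ring

/-- This is `Q J_α Q = 0` on monomials. Negative powers of `α` cancel the pole of the weight, so no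
conjugation is needed. -/
lemma integral_weight_mul_zpow_neg {n m : ℤ} (hn : n < 0) (hm : m < 0) :
    ∫ t : Circle, weight β t * (alpha β t : ℂ) ^ n * (t : ℂ) ^ (-m) ∂arc = 0 := by
  obtain ⟨n, rfl⟩ : ∃ k : ℕ, n = -((k + 1 : ℕ) : ℤ) := ⟨(-n - 1).toNat, by omega⟩
  obtain ⟨m, rfl⟩ : ∃ k : ℕ, m = -((k + 1 : ℕ) : ℤ) := ⟨(-m - 1).toNat, by omega⟩
  refine integral_eq_zero_of_eq_div β (fun z => lam β * (conj β * z - 1) ^ n * z ^ m)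
    (by fun_prop) (n + 1) fun t => ?_
  have h1 := sub_ne_zero_of_norm_le β (Circle.norm_coe t).le
  have h2 := denom_ne_zero β t
  rw [weight_eq, neg_neg, zpow_natCast, zpow_neg, zpow_natCast, ← inv_pow, alpha_inv, div_pow]
  field_simp
  ring

/-- The change of variables `s = α(t)` for trigonometric monomials. -/
lemma integral_alpha_zpow (n : ℤ) :
    ∫ t : Circle, (alpha β t : ℂ) ^ n * (weight β t * conj (weight β t)) ∂arc =
      ∫ t : Circle, (t : ℂ) ^ n ∂arc := by
  have key : ∀ k : ℕ, ∫ t : Circle, (alpha β t : ℂ) ^ (-((k + 1 : ℕ) : ℤ)) *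
      (weight β t * conj (weight β t)) ∂arc = 0 := fun k => by
    refine integral_eq_zero_of_eq_div β (fun z => lam β * lam β * (conj β * z - 1) ^ k)
      (by fun_prop) (k + 2) fun t => ?_
    have h1 := sub_ne_zero_of_norm_le β (Circle.norm_coe t).le
    have h2 := denom_ne_zero β t
    rw [conj_weight, weight_eq, zpow_neg, zpow_natCast, ← inv_pow, alpha_inv, div_pow]
    field_simp
    ring
  have keyc : ∀ (n : ℤ) (t : Circle), conj ((alpha β t : ℂ) ^ n *
      (weight β t * conj (weight β t))) =
      (alpha β t : ℂ) ^ (-n) * (weight β t * conj (weight β t)) := fun n t => by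
    rw [map_mul, map_mul, Complex.conj_conj, conj_zpow, mul_comm (conj (weight β t))]
  rw [integral_zpow]
  rcases lt_trichotomy n 0 with hn | rfl | hn
  · obtain ⟨k, rfl⟩ : ∃ k : ℕ, n = -((k + 1 : ℕ) : ℤ) := ⟨(-n - 1).toNat, by omega⟩
    rw [key, if_neg hn.ne]
  · have h0 : β ≠ 0 := fun h => by
      have := hβ.out
      rw [h, norm_zero] at this
      linarith
    -- `|weight|²` is a Poisson kernel: the conjugate of a holomorphic function vanishing at `0`,
    -- plus a holomorphic function with value `1` at `0`.
    have e : ∀ t : Circle, (alpha β t : ℂ) ^ (0 : ℤ) * (weight β t * conj (weight β t)) =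
        conj ((t : ℂ) * (-1) / ((t : ℂ) - β) ^ 1) + -β / ((t : ℂ) - β) := fun t => by
      have h1 := sub_ne_zero_of_norm_le β (Circle.norm_coe t).le
      have h2 := denom_ne_zero β t
      have h3 := Circle.coe_ne_zero t
      have h4 : conj ((t : ℂ) * (-1) / ((t : ℂ) - β) ^ 1) = 1 / (conj β * t - 1) := by
        rw [pow_one, map_div₀, map_mul, map_sub, conj_coe, map_neg, map_one]
        have h5 : (t : ℂ)⁻¹ - conj β = -(conj β * t - 1) / t := by field_simp; ring
        rw [h5]
        field_simp
      rw [h4, conj_weight, weight_eq, zpow_zero, one_mul]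
      field_simp
      linear_combination (t : ℂ) * lam_mul_lam β
    have c1 : Continuous fun t : Circle => (t : ℂ) * (-1) / ((t : ℂ) - β) ^ 1 :=
      Continuous.div (by fun_prop) (by fun_prop) fun t =>
        pow_ne_zero _ (sub_ne_zero_of_norm_le β (Circle.norm_coe t).le)
    have c2 : Continuous fun t : Circle => -β / ((t : ℂ) - β) :=
      Continuous.div (by fun_prop) (by fun_prop) fun t =>
        sub_ne_zero_of_norm_le β (Circle.norm_coe t).le
    have c1' : Continuous fun t : Circle => conj ((t : ℂ) * (-1) / ((t : ℂ) - β) ^ 1) :=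
      Complex.continuous_conj.comp c1
    refine (integral_congr_ae (Filter.Eventually.of_forall e)).trans ?_
    refine (integral_add (integrable_arc_of_continuous c1')
      (integrable_arc_of_continuous c2)).trans ?_
    rw [integral_conj_arc,
      integral_eq_zero_of_eq_div β (fun _ => -1) (by fun_prop) 1 (fun t => rfl), map_zero, zero_add]
    have h1 : DiffContOnCl ℂ (fun z => -β / (z - β)) (Metric.ball 0 1) := by
      refine DifferentiableOn.diffContOnCl fun z hz => ?_
      rw [closure_ball _ one_ne_zero, mem_closedBall_zero_iff] at hz
      exact (DifferentiableAt.div (𝕜 := ℂ) (c := fun _ => -β) (d := fun z => z - β)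
        (by fun_prop) (by fun_prop) (sub_ne_zero_of_norm_le β hz)).differentiableWithinAt
    rw [integral_arc_of_diffContOnCl h1]
    simp [h0]
  · obtain ⟨k, rfl⟩ : ∃ k : ℕ, n = ((k + 1 : ℕ) : ℤ) := ⟨(n - 1).toNat, by omega⟩
    rw [if_neg hn.ne', ← map_eq_zero (starRingEnd ℂ), ← integral_conj_arc]
    simp only [keyc]
    exact key k

end Shift

/-! ### The shift on `L^p`: involution, self-adjointness, and interchange of `H^p` with `ker P`. -/

section ShiftOperator

variable {p q : ℝ≥0∞} [hp1 : Fact (1 ≤ p)] [hq1 : Fact (1 ≤ q)] [hpq : p.HolderConjugate q]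
  (β : ℂ) [hβ : Fact (1 < ‖β‖)]

/-- The change of variables `s = α(t)` for continuous functions. -/
lemma integral_comp_alpha (F : C(Circle, ℂ)) :
    ∫ t, F (alpha β t) * (weight β t * conj (weight β t)) ∂arc = ∫ t, F t ∂arc := by
  let W : C(Circle, ℂ) := ⟨fun t => weight β t * conj (weight β t),
    (continuous_weight β).mul (Complex.continuous_conj.comp (continuous_weight β))⟩
  let A : C(Circle, Circle) := ⟨alpha β, continuous_alpha β⟩
  have hint : ∀ G : C(Circle, ℂ), Integrable G arc := fun G =>
    integrable_arc_of_continuous G.continuous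
  have h1 : ∀ G : C(Circle, ℂ), ‖∫ t, G t ∂arc‖ ≤ 1 * ‖G‖ := fun G => by
    have := norm_integral_le_of_norm_le_const (μ := arc)
      (Filter.Eventually.of_forall G.norm_coe_le_norm)
    simpa [mul_comm] using this
  let L : C(Circle, ℂ) →L[ℂ] ℂ := LinearMap.mkContinuous
    { toFun := fun G => ∫ t, G t ∂arc
      map_add' := fun G H => integral_add (hint G) (hint H)
      map_smul' := fun c G => integral_const_mul c _ } 1 h1
  have hL : ∀ G, L G = ∫ t, G t ∂arc := fun G => rfl
  have hc : Continuous fun G : C(Circle, ℂ) => L (G.comp A * W) :=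
    L.continuous.comp ((ContinuousMap.continuous_precomp A).mul continuous_const)
  have key : (fun G : C(Circle, ℂ) => L (G.comp A * W)) = fun G => L G := by
    refine denseRange_trig.equalizer hc L.continuous ?_
    ext a
    simp only [Function.comp]
    induction a using Finsupp.induction_linear with
    | zero => simp [map_zero]
    | add a b ha hb =>
      have : (trig a + trig b).comp A * W = (trig a).comp A * W + (trig b).comp A * W := by
        ext t; simp [add_mul]
      rw [map_add, map_add, ← ha, ← hb, this, map_add]
    | single n c =>
      rw [trig_single, map_smul, hL (zpowC n)]
      have : (c • zpowC n).comp A * W = c • ((zpowC n).comp A * W) := by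
        ext t; simp
      rw [this, map_smul]
      congr 1
      exact integral_alpha_zpow β n
  exact congrFun key F

lemma coeFn_compAlpha (f : Lp ℂ p arc) : compAlpha β p f =ᵐ[arc] fun t => f (alpha β t) :=
  (memLp_comp_alpha β (Lp.memLp f)).coeFn_toLp

lemma coeFn_shiftOp (f : Lp ℂ p arc) :
    shiftOp p β f =ᵐ[arc] fun t => weight β t * f (alpha β t) := by
  have h := coeFn_mulOp (memLp_top_of_continuous (continuous_weight β)) (compAlpha β p f)
  filter_upwards [h, coeFn_compAlpha β f] with t h1 h2
  rw [← h2, ← h1]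
  rfl

lemma ae_comp_alpha {P : Circle → Prop} (h : ∀ᵐ t ∂arc, P t) : ∀ᵐ t ∂arc, P (alpha β t) :=
  (quasiMeasurePreserving_alpha β).ae h

lemma shiftOp_shiftOp (f : Lp ℂ p arc) : shiftOp p β (shiftOp p β f) = f := by
  refine Lp.ext ?_
  filter_upwards [coeFn_shiftOp β (shiftOp p β f), ae_comp_alpha β (coeFn_shiftOp β f)]
    with t h1 h2
  rw [h1, h2, alpha_alpha, ← mul_assoc, mul_comm (weight β t), weight_mul_weight, one_mul]

lemma memLp_top_comp_alpha {g : Circle → ℂ} (hg : MemLp g ∞ arc) :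
    MemLp (fun t => g (alpha β t)) ∞ arc := memLp_comp_alpha β hg

lemma shiftOp_mulOp {g : Circle → ℂ} (hg : MemLp g ∞ arc) (f : Lp ℂ p arc) :
    shiftOp p β (mulOp p g f) = mulOp p (fun t => g (alpha β t)) (shiftOp p β f) := by
  refine Lp.ext ?_
  filter_upwards [coeFn_shiftOp β (mulOp p g f), ae_comp_alpha β (coeFn_mulOp hg f),
    coeFn_shiftOp β f, coeFn_mulOp (memLp_top_comp_alpha β hg) (shiftOp p β f)] with t h1 h2 h3 h4
  rw [h1, h2, h4, h3]
  ring

lemma coeFn_shiftOp_mono (n : ℤ) :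
    shiftOp p β (mono p n) =ᵐ[arc] fun t => weight β t * (alpha β t : ℂ) ^ n := by
  filter_upwards [coeFn_shiftOp β (mono p n), ae_comp_alpha β (coeFn_mono p n)] with t h1 h2
  rw [h1, h2]

lemma fcoef_shiftOp_mono (n m : ℤ) : fcoef (shiftOp p β (mono p n)) m =
    ∫ t : Circle, weight β t * (alpha β t : ℂ) ^ n * (t : ℂ) ^ (-m) ∂arc := by
  refine integral_congr_ae ?_
  filter_upwards [coeFn_shiftOp_mono (p := p) β n] with t h1
  rw [h1]

/-- The shift `J_α` is its own adjoint. -/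
lemma pair_shiftOp [hfin : Fact (p < ∞)] [hqfin : Fact (q < ∞)] (f : Lp ℂ p arc)
    (g : Lp ℂ q arc) : pair (shiftOp p β f) g = pair f (shiftOp q β g) := by
  refine pair_eq_of_mono hfin.out.ne hqfin.out.ne (fun m n => ?_) f g
  let F : C(Circle, ℂ) := ⟨fun t => (t : ℂ) ^ m * conj (weight β t * (alpha β t : ℂ) ^ n),
    (zpowC m).continuous.mul (Complex.continuous_conj.comp
      ((continuous_weight β).mul ((zpowC n).continuous.comp (continuous_alpha β))))⟩
  have h1 : pair (mono p m) (shiftOp q β (mono q n)) = ∫ t, F t ∂arc := by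
    refine integral_congr_ae ?_
    filter_upwards [coeFn_mono p m, coeFn_shiftOp_mono (p := q) β n] with t h1 h2
    rw [h1, h2]
    rfl
  -- After the substitution the Jacobian `|weight|²` meets the conjugate of `weight ∘ α`, and only
  -- one factor `weight` survives.
  rw [h1, ← integral_comp_alpha β F, pair_mono, fcoef_shiftOp_mono]
  refine integral_congr_ae (Filter.Eventually.of_forall fun t => ?_)
  change _ = (alpha β t : ℂ) ^ m * conj (weight β (alpha β t) * (alpha β (alpha β t) : ℂ) ^ n) *
    (weight β t * conj (weight β t))
  rw [alpha_alpha, map_mul, conj_zpow]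
  have := congrArg conj (weight_mul_weight β t)
  rw [map_mul, map_one] at this
  dsimp only
  linear_combination (-(weight β t * (alpha β t : ℂ) ^ m * (t : ℂ) ^ (-n))) * this

variable [hlt : Fact (1 < p)] [hfin : Fact (p < ∞)]

/-- `P J_α P = 0`. -/
lemma projP_shiftOp {f : Lp ℂ p arc} (hf : f ∈ Hardy p) : projP p (shiftOp p β f) = 0 := by
  have : projP p ∘L shiftOp p β ∘L (Hardy p).subtypeL ∘L projP p = 0 := by
    refine clm_ext_mono hfin.out.ne fun n => ?_
    change projP p (shiftOp p β (projP p (mono p n))) = 0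
    rcases lt_or_ge n 0 with hn | hn
    · rw [projP_mono_of_neg hn]
      simp
    · rw [projP_of_mem (mono_mem_Hardy hn), projP_eq_zero_iff]
      intro m hm
      rw [fcoef_shiftOp_mono, integral_weight_mul_zpow_nonneg β hn hm]
  have h := DFunLike.congr_fun this f
  change projP p (shiftOp p β (projP p f)) = 0 at h
  rwa [projP_of_mem hf] at h

/-- `Q J_α Q = 0`. -/
lemma shiftOp_mem_Hardy {f : Lp ℂ p arc} (hf : projP p f = 0) : shiftOp p β f ∈ Hardy p := by
  have : projQ p ∘L shiftOp p β ∘L projQ p = 0 := by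
    refine clm_ext_mono hfin.out.ne fun n => ?_
    change projQ p (shiftOp p β (projQ p (mono p n))) = 0
    rcases lt_or_ge n 0 with hn | hn
    · rw [projQ_eq_self (projP_mono_of_neg hn)]
      refine ext_fcoef fun m => ?_
      have h0 : fcoef (0 : Lp ℂ p arc) m = 0 := by rw [← fcoefL_apply]; exact map_zero _
      rw [fcoef_projQ, h0]
      split_ifs with hm
      · rfl
      · rw [fcoef_shiftOp_mono, integral_weight_mul_zpow_neg β hn (not_le.1 hm)]
    · have h0 : projQ p (mono p n) = 0 := by
        rw [projQ_apply, projP_of_mem (mono_mem_Hardy hn), sub_self]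
      rw [h0]
      simp
  have h := DFunLike.congr_fun this f
  change projQ p (shiftOp p β (projQ p f)) = 0 at h
  rw [projQ_eq_self hf, projQ_apply, sub_eq_zero] at h
  rw [h]
  exact Subtype.coe_prop _

end ShiftOperator

/-! ### Linear algebra of a shift of multiplicity one -/

section LinearAlgebra

variable {E : Type*} [AddCommGroup E] [Module ℂ E] {V L A : E →ₗ[ℂ] E} {φ : E →ₗ[ℂ] ℂ} {e : E}

/-- Composing with a shift `V` removes one dimension from the kernel. -/
lemma nonempty_ker_equiv (hLV : ∀ x, L (V x) = x) (hVL : ∀ x, V (L x) = x - φ x • e)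
    (hφV : ∀ x, φ (V x) = 0) {k : E} (hk : A k = 0) (hφk : φ k = 1) :
    Nonempty (LinearMap.ker A ≃ₗ[ℂ] LinearMap.ker (A ∘ₗ V) × ℂ) := by
  refine ⟨LinearEquiv.ofLinearMap
    (((L ∘ₗ (LinearMap.id - φ.smulRight k)).restrict
      (p := LinearMap.ker A) (q := LinearMap.ker (A ∘ₗ V)) fun x hx => ?_).prod
        (φ ∘ₗ (LinearMap.ker A).subtype))
    (((V ∘ₗ (LinearMap.ker (A ∘ₗ V)).subtype).coprod (LinearMap.id.smulRight k)).codRestrict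
      (LinearMap.ker A) fun x => ?_) ?_ ?_⟩
  · rw [LinearMap.mem_ker] at hx ⊢
    simp [hVL, hφk, hx, hk]
  · have h1 : A (V x.1) = 0 := x.1.2
    rw [LinearMap.mem_ker]
    simp [hk, h1]
  · refine LinearMap.ext fun x => Prod.ext (Subtype.ext ?_) ?_
    · simp [hφk, hLV, hφV]
    · simp [hφk, hφV]
  · refine LinearMap.ext fun x => Subtype.ext ?_
    simp [hVL, hφk]
    module

lemma finite_ker_comp (hLV : ∀ x, L (V x) = x) (hVL : ∀ x, V (L x) = x - φ x • e)
    (hφV : ∀ x, φ (V x) = 0) {k : E} (hk : A k = 0) (hφk : φ k = 1)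
    [FiniteDimensional ℂ (LinearMap.ker A)] :
    FiniteDimensional ℂ (LinearMap.ker (A ∘ₗ V)) ∧
      Module.finrank ℂ (LinearMap.ker A) = Module.finrank ℂ (LinearMap.ker (A ∘ₗ V)) + 1 := by
  obtain ⟨Φ⟩ := nonempty_ker_equiv hLV hVL hφV hk hφk
  have : FiniteDimensional ℂ (LinearMap.ker (A ∘ₗ V) × ℂ) := Φ.finiteDimensional
  have h : FiniteDimensional ℂ (LinearMap.ker (A ∘ₗ V)) :=
    Module.Finite.of_surjective (LinearMap.fst ℂ _ ℂ) LinearMap.fst_surjective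
  refine ⟨h, ?_⟩
  rw [Φ.finrank_eq, Module.finrank_prod, Module.finrank_self]

/-- A preimage can be corrected by a multiple of `k` so that `φ` vanishes on it; it then lies in the
range of `V`. -/
lemma surjective_comp (hVL : ∀ x, V (L x) = x - φ x • e) {k : E} (hk : A k = 0) (hφk : φ k = 1)
    (hA : Function.Surjective A) : Function.Surjective (A ∘ₗ V) := fun y => by
  obtain ⟨x, rfl⟩ := hA y
  refine ⟨L (x - φ x • k), ?_⟩
  simp [hVL, hφk, hk]

/-- The same dimension count as `finite_ker_comp`, with finiteness passed in the other direction. -/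
lemma finite_ker_of_comp (hLV : ∀ x, L (V x) = x) (hVL : ∀ x, V (L x) = x - φ x • e)
    (hφV : ∀ x, φ (V x) = 0) {k : E} (hk : A k = 0) (hφk : φ k = 1)
    [FiniteDimensional ℂ (LinearMap.ker (A ∘ₗ V))] :
    FiniteDimensional ℂ (LinearMap.ker A) ∧
      Module.finrank ℂ (LinearMap.ker A) = Module.finrank ℂ (LinearMap.ker (A ∘ₗ V)) + 1 := by
  obtain ⟨Φ⟩ := nonempty_ker_equiv hLV hVL hφV hk hφk
  refine ⟨Φ.symm.finiteDimensional, ?_⟩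
  rw [Φ.finrank_eq, Module.finrank_prod, Module.finrank_self]

/-- Composing with the backward shift `L` removes one dimension from the cokernel. -/
lemma finrank_coker_comp (hLV : ∀ x, L (V x) = x) (hVL : ∀ x, V (L x) = x - φ x • e)
    (hLe : L e = 0) (he : e ∉ LinearMap.range A) [FiniteDimensional ℂ (E ⧸ LinearMap.range A)] :
    FiniteDimensional ℂ (E ⧸ LinearMap.range (L ∘ₗ A)) ∧
      Module.finrank ℂ (E ⧸ LinearMap.range A) =
        Module.finrank ℂ (E ⧸ LinearMap.range (L ∘ₗ A)) + 1 := by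
  have hle : LinearMap.range A ≤ (LinearMap.range (L ∘ₗ A)).comap L := by
    rintro _ ⟨x, rfl⟩
    exact ⟨x, rfl⟩
  let ψ := (LinearMap.range A).mapQ (LinearMap.range (L ∘ₗ A)) L hle
  have hψ : Function.Surjective ψ := fun y => by
    obtain ⟨y, rfl⟩ := Submodule.Quotient.mk_surjective _ y
    exact ⟨Submodule.Quotient.mk (V y), by simp [ψ, hLV]⟩
  -- If `L x = L (A z)`, then `x - A z` is killed by `L`, so it is a multiple of `e`.
  have hker : LinearMap.ker ψ = Submodule.span ℂ {(Submodule.Quotient.mk e : E ⧸ LinearMap.range A)} := by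
    ext x
    obtain ⟨x, rfl⟩ := Submodule.Quotient.mk_surjective _ x
    rw [LinearMap.mem_ker, Submodule.mem_span_singleton]
    constructor
    · intro h
      simp only [ψ, Submodule.mapQ_apply, Submodule.Quotient.mk_eq_zero] at h
      obtain ⟨z, hz⟩ := h
      refine ⟨φ (x - A z), ?_⟩
      rw [← Submodule.Quotient.mk_smul, Submodule.Quotient.eq]
      have h1 : L (x - A z) = 0 := by rw [map_sub, ← hz]; simp
      have h2 := hVL (x - A z)
      rw [h1, map_zero, eq_comm, sub_eq_zero] at h2
      rw [← h2]
      exact ⟨-z, by simp⟩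
    · rintro ⟨c, hc⟩
      rw [← hc, map_smul]
      simp [ψ, hLe]
  have hfin : FiniteDimensional ℂ (E ⧸ LinearMap.range (L ∘ₗ A)) := Module.Finite.of_surjective ψ hψ
  refine ⟨hfin, ?_⟩
  have h1 := LinearMap.finrank_range_add_finrank_ker ψ
  rw [LinearMap.range_eq_top.2 hψ, finrank_top, hker, finrank_span_singleton] at h1
  · exact h1.symm
  · rwa [Ne, Submodule.Quotient.mk_eq_zero]

end LinearAlgebra

/-! ### Toeplitz operators -/

section Toeplitz

variable {p q : ℝ≥0∞} [hp1 : Fact (1 ≤ p)] [hq1 : Fact (1 ≤ q)] [hpq : p.HolderConjugate q]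

lemma toeplitz_apply (g : Circle → ℂ) (f : Hardy p) :
    toeplitz p g f = projP p (mulOp p g (f : Lp ℂ p arc)) := rfl

lemma toeplitz_congr {g h : Circle → ℂ} (H : g =ᵐ[arc] h) : toeplitz p g = toeplitz p h := by
  rw [toeplitz, toeplitz, mulOp_congr H]

instance instCompleteSpaceHardy : CompleteSpace (Hardy p) := by
  have : IsClosed (Hardy p : Set (Lp ℂ p arc)) := by
    have h : (Hardy p : Set (Lp ℂ p arc)) = ⋂ n : ℤ, ⋂ _ : n < 0, {f | fcoefL n f = 0} := by
      ext f
      simp [mem_Hardy, fcoefL_apply]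
    rw [h]
    exact isClosed_iInter fun n => isClosed_iInter fun _ =>
      isClosed_eq (fcoefL n).continuous continuous_const
  exact this.completeSpace_coe

variable [hlt : Fact (1 < p)] [hfin : Fact (p < ∞)]

lemma mulOp_zpow_mem {n : ℤ} (hn : 0 ≤ n) {f : Lp ℂ p arc} (hf : f ∈ Hardy p) :
    mulOp p (fun t => (t : ℂ) ^ n) f ∈ Hardy p := fun m hm => by
  rw [fcoef_mulOp_zpow]
  exact hf _ (by omega)

lemma projP_mulOp_zpow_neg {n : ℤ} (hn : 0 ≤ n) {f : Lp ℂ p arc} (hf : projP p f = 0) :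
    projP p (mulOp p (fun t => (t : ℂ) ^ (-n)) f) = 0 := by
  rw [projP_eq_zero_iff] at hf ⊢
  intro m hm
  rw [fcoef_mulOp_zpow]
  exact hf _ (by omega)

lemma fcoef_toeplitz_zpow (m : ℤ) (f : Hardy p) (n : ℤ) :
    fcoef (toeplitz p (fun t => (t : ℂ) ^ m) f : Lp ℂ p arc) n =
      if 0 ≤ n then fcoef (f : Lp ℂ p arc) (n - m) else 0 := by
  rw [toeplitz_apply, fcoef_projP, fcoef_mulOp_zpow]

lemma projP_mulOp_projP_zpow {n : ℤ} (hn : 0 ≤ n) (x : Lp ℂ p arc) :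
    projP p (mulOp p (fun t => (t : ℂ) ^ (-n)) (projP p x)) =
      projP p (mulOp p (fun t => (t : ℂ) ^ (-n)) x) := by
  have h := projP_mulOp_zpow_neg hn (projP_projQ x)
  rw [projQ_apply, map_sub, map_sub, sub_eq_zero] at h
  exact h.symm

variable {g : Circle → ℂ} (hg : MemLp g ∞ arc)
include hg

/-- Toeplitz operators multiply when the right factor has an analytic symbol, since `t ^ n`
preserves `H^p`; dually, `t ^ (-n)` may be split off on the left since it preserves `ker P`. -/
lemma toeplitz_mul_zpow {n : ℤ} (hn : 0 ≤ n) (f : Hardy p) :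
    toeplitz p (fun t => g t * (t : ℂ) ^ n) f =
      toeplitz p g (toeplitz p (fun t => (t : ℂ) ^ n) f) := by
  rw [toeplitz_apply, toeplitz_apply, toeplitz_apply, projP_of_mem (mulOp_zpow_mem hn f.2),
    mulOp_mulOp hg (memLp_top_zpow n)]

lemma toeplitz_mul_zpow_neg {n : ℤ} (hn : 0 ≤ n) (f : Hardy p) :
    toeplitz p (fun t => g t * (t : ℂ) ^ (-n)) f =
      toeplitz p (fun t => (t : ℂ) ^ (-n)) (toeplitz p g f) := by
  rw [toeplitz_apply, toeplitz_apply, toeplitz_apply, projP_mulOp_projP_zpow hn,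
    mulOp_mulOp (memLp_top_zpow (-n)) hg]
  simp only [mul_comm]

omit hg in
lemma ext_Hardy {f f' : Hardy p}
    (h : ∀ n : ℤ, 0 ≤ n → fcoef (f : Lp ℂ p arc) n = fcoef (f' : Lp ℂ p arc) n) : f = f' :=
  Subtype.ext (ext_fcoef fun n => by
    rcases lt_or_ge n 0 with hn | hn
    · rw [f.2 n hn, f'.2 n hn]
    · exact h n hn)

omit hg in
lemma toeplitz_zpow_neg_zpow {n : ℤ} (hn : 0 ≤ n) (f : Hardy p) :
    toeplitz p (fun t => (t : ℂ) ^ (-n)) (toeplitz p (fun t => (t : ℂ) ^ n) f) = f :=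
  ext_Hardy fun m hm => by
    rw [fcoef_toeplitz_zpow, fcoef_toeplitz_zpow, if_pos hm, if_pos (by omega)]
    congr 1
    ring

/-- The monomial `t ^ n`, `n ≥ 0`, as an element of `H^p`. -/
def monoH (p : ℝ≥0∞) [Fact (1 ≤ p)] [Fact (1 < p)] [Fact (p < ∞)] (n : ℕ) : Hardy p :=
  ⟨mono p n, mono_mem_Hardy (Int.natCast_nonneg n)⟩

/-- Evaluation of functions in `H^p` at the origin. -/
def evalZero (p : ℝ≥0∞) [Fact (1 ≤ p)] : Hardy p →ₗ[ℂ] ℂ :=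
  (fcoefL 0 : Lp ℂ p arc →L[ℂ] ℂ).toLinearMap ∘ₗ (Hardy p).subtype

omit hg hlt hfin in
lemma evalZero_apply (f : Hardy p) : evalZero p f = fcoef (f : Lp ℂ p arc) 0 := fcoefL_apply 0 _

omit hg in
lemma fcoef_monoH (n : ℕ) (m : ℤ) :
    fcoef (monoH p n : Lp ℂ p arc) m = if (n : ℤ) = m then 1 else 0 := fcoef_mono _ _

omit hg in
lemma toeplitz_zpow_one_zpow_neg (f : Hardy p) :
    toeplitz p (fun t => (t : ℂ) ^ (1 : ℤ)) (toeplitz p (fun t => (t : ℂ) ^ (-1 : ℤ)) f) =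
      f - evalZero p f • monoH p 0 :=
  ext_Hardy fun m hm => by
    rw [fcoef_toeplitz_zpow, fcoef_toeplitz_zpow, if_pos hm, AddSubgroupClass.coe_sub,
      Submodule.coe_smul, fcoef_sub, fcoef_smul, fcoef_monoH, evalZero_apply]
    rcases hm.eq_or_lt with rfl | hm'
    · simp
    · rw [if_pos (by omega), if_neg (by simpa using hm'.ne)]
      simp

omit hg in
lemma evalZero_toeplitz_zpow_one (f : Hardy p) :
    evalZero p (toeplitz p (fun t => (t : ℂ) ^ (1 : ℤ)) f) = 0 := by
  rw [evalZero_apply, fcoef_toeplitz_zpow, if_pos le_rfl]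
  exact f.2 _ (by omega)

omit hg in
lemma toeplitz_zpow_neg_one_monoH : toeplitz p (fun t => (t : ℂ) ^ (-1 : ℤ)) (monoH p 0) = 0 :=
  ext_Hardy fun m hm => by
    rw [fcoef_toeplitz_zpow, if_pos hm, fcoef_monoH, if_neg (by push_cast; omega)]
    exact (by rw [← fcoefL_apply]; exact (map_zero _).symm)

/-- A nontrivial kernel of a Toeplitz operator contains a function with value `1` at `0`. -/
lemma exists_ker_evalZero {f : Hardy p} (hf : toeplitz p g f = 0) (hf0 : f ≠ 0) :
    ∃ k, toeplitz p g k = 0 ∧ evalZero p k = 1 := by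
  have hex : ∃ n : ℕ, fcoef (f : Lp ℂ p arc) n ≠ 0 := by
    by_contra! h
    refine hf0 (ext_Hardy fun n hn => ?_)
    obtain ⟨n, rfl⟩ := Int.eq_ofNat_of_zero_le hn
    rw [h n, ← fcoefL_apply]
    exact (map_zero _).symm
  classical
  -- `m` is the order of the zero of `f` at the origin. Dividing by `t ^ m` stays in the kernel
  -- because `T(g) k = T(t^{-m}) T(g) T(t^m) k`.
  set m := Nat.find hex with hm
  set k := toeplitz p (fun t => (t : ℂ) ^ (-(m : ℤ))) f with hk
  have hm0 : (0 : ℤ) ≤ m := Int.natCast_nonneg m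
  have hfk : toeplitz p (fun t => (t : ℂ) ^ (m : ℤ)) k = f := ext_Hardy fun n hn => by
    rw [fcoef_toeplitz_zpow, if_pos hn, hk, fcoef_toeplitz_zpow]
    split_ifs with h
    · congr 1; ring
    · obtain ⟨n, rfl⟩ := Int.eq_ofNat_of_zero_le hn
      have := Nat.find_min hex (m := n) (by omega)
      rw [not_not] at this
      exact this.symm
  have hk0 : toeplitz p g k = 0 := by
    have h1 := toeplitz_mul_zpow_neg (p := p) (memLp_top_mul hg (memLp_top_zpow m)) hm0 k
    rw [toeplitz_mul_zpow hg hm0, hfk, hf, map_zero] at h1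
    rw [← h1]
    refine DFunLike.congr_fun (toeplitz_congr (Filter.Eventually.of_forall fun t => ?_)) k
    rw [mul_assoc, ← zpow_add₀ (Circle.coe_ne_zero t), add_neg_cancel, zpow_zero, mul_one]
  have hev : evalZero p k = fcoef (f : Lp ℂ p arc) m := by
    rw [evalZero_apply, hk, fcoef_toeplitz_zpow, if_pos le_rfl]
    congr 1; ring
  have hne : evalZero p k ≠ 0 := by rw [hev]; exact Nat.find_spec hex
  exact ⟨(evalZero p k)⁻¹ • k, by rw [map_smul, hk0, smul_zero],
    by rw [map_smul, smul_eq_mul, inv_mul_cancel₀ hne]⟩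

/-- The heart of Coburn's alternative. As `g` vanishes almost nowhere, `g f` is nonzero and has only
negative frequencies. Multiplying by `t ^ m` moves its highest frequency `-m` to `0`, so `T(g) (t^m
f)` is a nonzero constant. -/
lemma monoH_zero_mem_range (hg0 : ∀ᵐ t ∂arc, g t ≠ 0) {f : Hardy p} (hf : toeplitz p g f = 0)
    (hf0 : f ≠ 0) : ∃ k, toeplitz p g k = monoH p 0 := by
  set h := mulOp p g (f : Lp ℂ p arc) with hh
  have hP : projP p h = 0 := hf
  rw [projP_eq_zero_iff] at hP
  have hex : ∃ n : ℕ, fcoef h (-(n : ℤ)) ≠ 0 := by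
    by_contra! H
    apply hf0
    have h0 : h = 0 := ext_fcoef fun n => by
      have : fcoef (0 : Lp ℂ p arc) n = 0 := by rw [← fcoefL_apply]; exact map_zero _
      rw [this]
      rcases le_or_gt 0 n with hn | hn
      · exact hP n hn
      · have := H (-n).toNat
        rwa [Int.toNat_of_nonneg (by omega), neg_neg] at this
    refine Subtype.ext (Lp.ext ?_)
    filter_upwards [coeFn_mulOp hg (f : Lp ℂ p arc), hg0, Lp.coeFn_zero ℂ p arc] with t h1 h2 h3
    rw [← hh, h0, h3] at h1
    have h4 : (f : Lp ℂ p arc) t = 0 := (mul_eq_zero.1 h1.symm).resolve_left h2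
    rw [h4]
    exact h3.symm
  classical
  set m := Nat.find hex with hm
  have hm0 : (0 : ℤ) ≤ m := Int.natCast_nonneg m
  have hne : fcoef h (-(m : ℤ)) ≠ 0 := Nat.find_spec hex
  have key : toeplitz p g (toeplitz p (fun t => (t : ℂ) ^ (m : ℤ)) f) =
      fcoef h (-(m : ℤ)) • monoH p 0 := ext_Hardy fun n hn => by
    rw [← toeplitz_mul_zpow hg hm0, toeplitz_apply]
    have e : mulOp p (fun t => g t * (t : ℂ) ^ (m : ℤ)) (f : Lp ℂ p arc) =
        mulOp p (fun t => (t : ℂ) ^ (m : ℤ)) h := by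
      rw [hh, mulOp_mulOp (memLp_top_zpow _) hg]
      simp only [mul_comm]
    rw [e, fcoef_projP, if_pos hn, fcoef_mulOp_zpow, Submodule.coe_smul, fcoef_smul, fcoef_monoH]
    rcases hn.eq_or_lt with rfl | hn'
    · simp
    · rw [if_neg (by simpa using hn'.ne), mul_zero]
      rcases lt_or_ge n m with h1 | h1
      · have := Nat.find_min hex (m := ((m : ℤ) - n).toNat) (by omega)
        rw [not_not, Int.toNat_of_nonneg (by omega)] at this
        rwa [neg_sub] at this
      · exact hP _ (by omega)
  refine ⟨(fcoef h (-(m : ℤ)))⁻¹ • toeplitz p (fun t => (t : ℂ) ^ (m : ℤ)) f, ?_⟩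
  rw [map_smul, key, smul_smul, inv_mul_cancel₀ hne, one_smul]

omit hg in
lemma dense_of_monoH_mem {S : Submodule ℂ (Hardy p)} (h : ∀ n, monoH p n ∈ S) :
    Dense (S : Set (Hardy p)) := by
  have hsurj : Function.Surjective (projP p) := fun f => ⟨f, projP_coe f⟩
  have h1 : DenseRange (projP p ∘ trigLp p) :=
    hsurj.denseRange.comp (denseRange_trigLp hfin.out.ne) (projP p).continuous
  refine h1.mono ?_
  rintro _ ⟨a, rfl⟩
  simp only [Function.comp, trigLp_eq_sum, Finsupp.sum, map_sum, map_smul]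
  refine Submodule.sum_mem _ fun n _ => Submodule.smul_mem _ _ ?_
  rcases lt_or_ge n 0 with hn | hn
  · rw [projP_mono_of_neg hn]
    exact S.zero_mem
  · obtain ⟨n, rfl⟩ := Int.eq_ofNat_of_zero_le hn
    have : projP p (mono p (n : ℤ)) = monoH p n := projP_coe (monoH p n)
    rw [this]
    exact h n

/-- If the constants lie in the range of a Toeplitz operator, then so do all polynomials. -/
lemma monoH_mem_range {k : Hardy p} (hk : toeplitz p g k = monoH p 0) (n : ℕ) :
    monoH p n ∈ LinearMap.range (toeplitz p g : Hardy p →ₗ[ℂ] Hardy p) := by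
  induction n using Nat.strong_induction_on with
  | _ n ih =>
    set h := mulOp p g (k : Lp ℂ p arc) with hh
    have hP : ∀ j : ℤ, 0 ≤ j → fcoef h j = if (0 : ℤ) = j then 1 else 0 := fun j hj => by
      have h1 := fcoef_projP h j
      rw [if_pos hj] at h1
      rw [← h1]
      have h2 : projP p h = monoH p 0 := hk
      rw [h2, fcoef_monoH]
      simp
    -- The part of `g k` with nonnegative indices is `1`, so `P (t^n g k)` is `t^n` plus a
    -- polynomial of lower degree, and strong induction applies.
    have key : toeplitz p g (toeplitz p (fun t => (t : ℂ) ^ (n : ℤ)) k) =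
        monoH p n + ∑ j ∈ Finset.range n, fcoef h ((j : ℤ) - n) • monoH p j :=
      ext_Hardy fun m hm => by
        rw [← toeplitz_mul_zpow hg (Int.natCast_nonneg n), toeplitz_apply]
        have e : mulOp p (fun t => g t * (t : ℂ) ^ (n : ℤ)) (k : Lp ℂ p arc) =
            mulOp p (fun t => (t : ℂ) ^ (n : ℤ)) h := by
          rw [hh, mulOp_mulOp (memLp_top_zpow _) hg]
          simp only [mul_comm]
        rw [e, fcoef_projP, if_pos hm, fcoef_mulOp_zpow]
        obtain ⟨m, rfl⟩ := Int.eq_ofNat_of_zero_le hm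
        rw [Submodule.coe_add, fcoef_add, fcoef_monoH, ← fcoefL_apply m, Submodule.coe_sum, map_sum]
        simp only [Submodule.coe_smul, map_smul, fcoefL_apply, fcoef_monoH, smul_eq_mul, mul_ite,
          mul_one, mul_zero, Nat.cast_inj]
        rw [Finset.sum_ite_eq' (Finset.range n) m (fun j => fcoef h ((j : ℤ) - n))]
        rcases lt_or_ge m n with h1 | h1
        · rw [if_neg h1.ne', if_pos (Finset.mem_range.2 h1), zero_add]
        · rw [hP _ (by omega), if_neg (show m ∉ Finset.range n by simpa using h1),
            add_zero]
          congr 1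
          rw [eq_iff_iff]
          omega
    have h3 : monoH p n = toeplitz p g (toeplitz p (fun t => (t : ℂ) ^ (n : ℤ)) k) -
        ∑ j ∈ Finset.range n, fcoef h ((j : ℤ) - n) • monoH p j := by
      rw [key]; abel
    rw [h3]
    exact Submodule.sub_mem _ ⟨_, rfl⟩ (Submodule.sum_mem _ fun j hj =>
      Submodule.smul_mem _ _ (ih j (Finset.mem_range.1 hj)))

lemma surjective_of_monoH_mem {k : Hardy p} (hk : toeplitz p g k = monoH p 0)
    (hcl : IsClosed (LinearMap.range (toeplitz p g : Hardy p →ₗ[ℂ] Hardy p) : Set (Hardy p))) :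
    Function.Surjective (toeplitz p g) := by
  have h := (dense_of_monoH_mem (monoH_mem_range hg hk)).closure_eq
  rw [hcl.closure_eq] at h
  intro y
  have : y ∈ (LinearMap.range (toeplitz p g : Hardy p →ₗ[ℂ] Hardy p) : Set (Hardy p)) := by
    rw [h]; trivial
  exact this

omit hg in
lemma toeplitz_zpow_comp_congr {n m k : ℤ} (h : n + m = k) :
    toeplitz p (fun t => g t * (t : ℂ) ^ n * (t : ℂ) ^ m) =
      toeplitz p (fun t => g t * (t : ℂ) ^ k) :=
  toeplitz_congr (Filter.Eventually.of_forall fun t => by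
    dsimp only
    rw [mul_assoc, ← zpow_add₀ (Circle.coe_ne_zero t), h])

omit hg in
lemma toeplitz_zpow_zero : toeplitz p (fun t => g t * (t : ℂ) ^ (0 : ℤ)) = toeplitz p g :=
  toeplitz_congr (Filter.Eventually.of_forall fun t => by simp)

lemma toeplitz_comp_V : (toeplitz p (fun t => g t * (t : ℂ) ^ (1 : ℤ)) : Hardy p →ₗ[ℂ] Hardy p) =
    (toeplitz p g : Hardy p →ₗ[ℂ] Hardy p) ∘ₗ
      (toeplitz p (fun t => (t : ℂ) ^ (1 : ℤ)) : Hardy p →ₗ[ℂ] Hardy p) :=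
  LinearMap.ext fun f => toeplitz_mul_zpow hg zero_le_one f

lemma toeplitz_comp_L : (toeplitz p (fun t => g t * (t : ℂ) ^ (-1 : ℤ)) : Hardy p →ₗ[ℂ] Hardy p) =
    (toeplitz p (fun t => (t : ℂ) ^ (-1 : ℤ)) : Hardy p →ₗ[ℂ] Hardy p) ∘ₗ
      (toeplitz p g : Hardy p →ₗ[ℂ] Hardy p) :=
  LinearMap.ext fun f => toeplitz_mul_zpow_neg hg zero_le_one f

/-- Each factor `t` in the symbol preserves surjectivity and lowers the kernel dimension by one, as
long as the kernel is nonzero. -/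
lemma bijective_of_surjective (n : ℕ) (hs : Function.Surjective (toeplitz p g))
    (hf : FiniteDimensional ℂ (LinearMap.ker (toeplitz p g : Hardy p →ₗ[ℂ] Hardy p)))
    (hn : Module.finrank ℂ (LinearMap.ker (toeplitz p g : Hardy p →ₗ[ℂ] Hardy p)) = n) :
    Function.Bijective (toeplitz p (fun t => g t * (t : ℂ) ^ (n : ℤ))) := by
  induction n generalizing g with
  | zero =>
    rw [Nat.cast_zero, toeplitz_zpow_zero]
    refine ⟨?_, hs⟩
    have := Submodule.finrank_eq_zero.1 hn
    exact LinearMap.ker_eq_bot.1 this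
  | succ n ih =>
    obtain ⟨f, hf0⟩ : ∃ f : LinearMap.ker (toeplitz p g : Hardy p →ₗ[ℂ] Hardy p), f ≠ 0 := by
      have : Nontrivial (LinearMap.ker (toeplitz p g : Hardy p →ₗ[ℂ] Hardy p)) :=
        Module.nontrivial_of_finrank_pos (R := ℂ) (by omega)
      exact exists_ne 0
    obtain ⟨k, hk, hk1⟩ := exists_ker_evalZero hg (f := f.1) f.2 fun h => hf0 (Subtype.ext h)
    have h1 := finite_ker_comp (A := (toeplitz p g : Hardy p →ₗ[ℂ] Hardy p))
      (toeplitz_zpow_neg_zpow zero_le_one) toeplitz_zpow_one_zpow_neg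
      evalZero_toeplitz_zpow_one hk hk1
    have h2 := surjective_comp (A := (toeplitz p g : Hardy p →ₗ[ℂ] Hardy p))
      (V := (toeplitz p (fun t => (t : ℂ) ^ (1 : ℤ)) : Hardy p →ₗ[ℂ] Hardy p))
      toeplitz_zpow_one_zpow_neg hk hk1 hs
    rw [← toeplitz_comp_V hg] at h1 h2
    have := ih (memLp_top_mul hg (memLp_top_zpow 1)) h2 h1.1 (by omega)
    rwa [toeplitz_zpow_comp_congr (k := ((n + 1 : ℕ) : ℤ)) (by push_cast; ring)] at this

/-- Each factor `t⁻¹` preserves injectivity and lowers the codimension of the range by one. While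
the range is proper it omits the constants, since otherwise closedness would force surjectivity. -/
lemma bijective_of_injective (n : ℕ) (hi : Function.Injective (toeplitz p g))
    (hcl : IsClosed (LinearMap.range (toeplitz p g : Hardy p →ₗ[ℂ] Hardy p) : Set (Hardy p)))
    (hf : FiniteDimensional ℂ
      (Hardy p ⧸ LinearMap.range (toeplitz p g : Hardy p →ₗ[ℂ] Hardy p)))
    (hn : Module.finrank ℂ
      (Hardy p ⧸ LinearMap.range (toeplitz p g : Hardy p →ₗ[ℂ] Hardy p)) = n) :
    Function.Bijective (toeplitz p (fun t => g t * (t : ℂ) ^ (-(n : ℤ)))) := by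
  have hrange : Function.Surjective (toeplitz p g) → Module.finrank ℂ
      (Hardy p ⧸ LinearMap.range (toeplitz p g : Hardy p →ₗ[ℂ] Hardy p)) = 0 := fun h => by
    rw [LinearMap.range_eq_top.2 h]
    exact Module.finrank_zero_of_subsingleton
  induction n generalizing g with
  | zero =>
    rw [Nat.cast_zero, neg_zero, toeplitz_zpow_zero]
    refine ⟨hi, ?_⟩
    have := Module.finrank_zero_iff.1 hn
    exact LinearMap.range_eq_top.1 (Submodule.Quotient.subsingleton_iff.1 this)
  | succ n ih =>
    have he : monoH p 0 ∉ LinearMap.range (toeplitz p g : Hardy p →ₗ[ℂ] Hardy p) := by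
      rintro ⟨k, hk⟩
      have := hrange (surjective_of_monoH_mem hg hk hcl)
      omega
    have h1 := finrank_coker_comp (A := (toeplitz p g : Hardy p →ₗ[ℂ] Hardy p))
      (toeplitz_zpow_neg_zpow zero_le_one) toeplitz_zpow_one_zpow_neg
      toeplitz_zpow_neg_one_monoH he
    have h3 : Function.Injective (toeplitz p (fun t => g t * (t : ℂ) ^ (-1 : ℤ))) := by
      refine (injective_iff_map_eq_zero _).2 fun x hx => ?_
      rw [toeplitz_mul_zpow_neg hg zero_le_one] at hx
      have h4 := toeplitz_zpow_one_zpow_neg (toeplitz p g x)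
      rw [hx, map_zero, eq_comm, sub_eq_zero] at h4
      by_cases h5 : evalZero p (toeplitz p g x) = 0
      · rw [h5, zero_smul] at h4
        exact hi (h4.trans (map_zero _).symm)
      · obtain ⟨c, hc⟩ : ∃ c, c = evalZero p (toeplitz p g x) := ⟨_, rfl⟩
        rw [← hc] at h4 h5
        refine absurd ⟨c⁻¹ • x, ?_⟩ he
        rw [map_smul]
        change c⁻¹ • toeplitz p g x = _
        rw [h4, smul_smul, inv_mul_cancel₀ h5, one_smul]
    -- The range of `T(t⁻¹) T(g)` is the preimage under `T(t)` of `range T(g) + ℂ·1`, which is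
    -- closed because `range T(g)` is closed and of finite codimension.
    have h4 : IsClosed (LinearMap.range
        (toeplitz p (fun t => g t * (t : ℂ) ^ (-1 : ℤ)) : Hardy p →ₗ[ℂ] Hardy p) :
          Set (Hardy p)) := by
      have h5 : (LinearMap.range
          (toeplitz p (fun t => g t * (t : ℂ) ^ (-1 : ℤ)) : Hardy p →ₗ[ℂ] Hardy p) :
            Set (Hardy p)) = toeplitz p (fun t => (t : ℂ) ^ (1 : ℤ)) ⁻¹'
          ((LinearMap.range (toeplitz p g : Hardy p →ₗ[ℂ] Hardy p) ⊔
            Submodule.span ℂ {monoH p 0} : Submodule ℂ (Hardy p)) : Set (Hardy p)) := by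
        ext y
        constructor
        · rintro ⟨x, rfl⟩
          rw [Set.mem_preimage, SetLike.mem_coe]
          change toeplitz p _ (toeplitz p _ x) ∈ _
          rw [toeplitz_mul_zpow_neg hg zero_le_one, toeplitz_zpow_one_zpow_neg]
          exact Submodule.sub_mem _ (Submodule.mem_sup_left ⟨x, rfl⟩) (Submodule.mem_sup_right
            (Submodule.smul_mem _ _ (Submodule.mem_span_singleton_self _)))
        · intro hy
          obtain ⟨_, ⟨x, rfl⟩, z, hz, hxz⟩ := Submodule.mem_sup.1 hy
          obtain ⟨c, rfl⟩ := Submodule.mem_span_singleton.1 hz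
          refine ⟨x, ?_⟩
          change toeplitz p _ x = y
          rw [toeplitz_mul_zpow_neg hg zero_le_one, ← toeplitz_zpow_neg_zpow zero_le_one y, ← hxz,
            map_add, map_smul, toeplitz_zpow_neg_one_monoH, smul_zero, add_zero]
          rfl
      rw [h5]
      exact (Submodule.isClosed_mono_of_finiteDimensional_quotient hcl le_sup_left).preimage
        (toeplitz p _).continuous
    rw [← toeplitz_comp_L hg] at h1
    have := ih (memLp_top_mul hg (memLp_top_zpow (-1))) h3 h4 h1.1 (by omega) (fun h => by
      rw [LinearMap.range_eq_top.2 h]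
      exact Module.finrank_zero_of_subsingleton)
    rwa [toeplitz_zpow_comp_congr (k := -((n + 1 : ℕ) : ℤ)) (by push_cast; ring)] at this

/-- A Fredholm Toeplitz operator `T(g)` of index `κ` is surjective or injective according to the
sign of `κ`, and `T(g t^κ)` is bijective. -/
lemma toeplitz_of_isFredholm (hg0 : ∀ᵐ t ∂arc, g t ≠ 0) (hF : (toeplitz p g).IsFredholm) :
    Function.Bijective (toeplitz p (fun t => g t * (t : ℂ) ^ index (toeplitz p g))) ∧
      (0 ≤ index (toeplitz p g) → Function.Surjective (toeplitz p g)) ∧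
      (index (toeplitz p g) ≤ 0 → Function.Injective (toeplitz p g)) := by
  have hker : FiniteDimensional ℂ (LinearMap.ker (toeplitz p g : Hardy p →ₗ[ℂ] Hardy p)) :=
    hF.finite_ker
  have hcok : FiniteDimensional ℂ
    (Hardy p ⧸ LinearMap.range (toeplitz p g : Hardy p →ₗ[ℂ] Hardy p)) := hF.finite_coker
  by_cases hi : Function.Injective (toeplitz p g)
  · have h0 : Module.finrank ℂ (LinearMap.ker (toeplitz p g : Hardy p →ₗ[ℂ] Hardy p)) = 0 :=
      Submodule.finrank_eq_zero.2 (LinearMap.ker_eq_bot.2 hi)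
    have hind : index (toeplitz p g) = -(Module.finrank ℂ
        (Hardy p ⧸ LinearMap.range (toeplitz p g : Hardy p →ₗ[ℂ] Hardy p)) : ℤ) := by
      rw [index, h0]; simp
    refine ⟨?_, fun h => ?_, fun _ => hi⟩
    · rw [hind]
      exact bijective_of_injective hg _ hi hF.isClosed_range hcok rfl
    · have h1 : Module.finrank ℂ
        (Hardy p ⧸ LinearMap.range (toeplitz p g : Hardy p →ₗ[ℂ] Hardy p)) = 0 := by omega
      have := bijective_of_injective hg 0 hi hF.isClosed_range hcok h1
      rw [Nat.cast_zero, neg_zero, toeplitz_zpow_zero] at this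
      exact this.2
  -- A nontrivial kernel forces surjectivity, so the index equals the kernel dimension.
  · obtain ⟨f, hf, hf0⟩ : ∃ f, toeplitz p g f = 0 ∧ f ≠ 0 := by
      by_contra! h
      exact hi ((injective_iff_map_eq_zero _).2 h)
    obtain ⟨k, hk⟩ := monoH_zero_mem_range hg hg0 hf hf0
    have hs := surjective_of_monoH_mem hg hk hF.isClosed_range
    have h0 : Module.finrank ℂ
        (Hardy p ⧸ LinearMap.range (toeplitz p g : Hardy p →ₗ[ℂ] Hardy p)) = 0 := by
      rw [LinearMap.range_eq_top.2 hs]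
      exact Module.finrank_zero_of_subsingleton
    have hind : index (toeplitz p g) = (Module.finrank ℂ
        (LinearMap.ker (toeplitz p g : Hardy p →ₗ[ℂ] Hardy p)) : ℤ) := by
      rw [index, h0]; simp
    refine ⟨?_, fun _ => hs, fun h => ?_⟩
    · rw [hind]
      exact bijective_of_surjective hg _ hs hker rfl
    · have h1 : Module.finrank ℂ (LinearMap.ker (toeplitz p g : Hardy p →ₗ[ℂ] Hardy p)) = 0 := by
        omega
      exact LinearMap.ker_eq_bot.1 (Submodule.finrank_eq_zero.1 h1)

/-- Each factor `t⁻¹` adds one kernel dimension: a preimage of the constant `1` is annihilated by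
`T(t⁻¹)`. This computes the index on `H^q`, where Fredholmness is not assumed. -/
lemma finrank_ker_of_bijective (hb : Function.Bijective (toeplitz p g)) (n : ℕ) :
    Function.Surjective (toeplitz p (fun t => g t * (t : ℂ) ^ (-(n : ℤ)))) ∧
    FiniteDimensional ℂ (LinearMap.ker
      (toeplitz p (fun t => g t * (t : ℂ) ^ (-(n : ℤ))) : Hardy p →ₗ[ℂ] Hardy p)) ∧
    Module.finrank ℂ (LinearMap.ker
      (toeplitz p (fun t => g t * (t : ℂ) ^ (-(n : ℤ))) : Hardy p →ₗ[ℂ] Hardy p)) = n := by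
  induction n with
  | zero =>
    rw [Nat.cast_zero, neg_zero, toeplitz_zpow_zero]
    have : LinearMap.ker (toeplitz p g : Hardy p →ₗ[ℂ] Hardy p) = ⊥ :=
      LinearMap.ker_eq_bot.2 hb.1
    rw [this]
    exact ⟨hb.2, inferInstance, finrank_bot ℂ _⟩
  | succ n ih =>
    obtain ⟨hs, hf, hn⟩ := ih
    set h : Circle → ℂ := fun t => g t * (t : ℂ) ^ (-(n : ℤ)) with hh
    have hhm : MemLp h ∞ arc := memLp_top_mul hg (memLp_top_zpow _)
    have hhm' : MemLp (fun t => h t * (t : ℂ) ^ (-1 : ℤ)) ∞ arc :=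
      memLp_top_mul hhm (memLp_top_zpow _)
    have e : toeplitz p (fun t => g t * (t : ℂ) ^ (-((n + 1 : ℕ) : ℤ))) =
        toeplitz p (fun t => h t * (t : ℂ) ^ (-1 : ℤ)) :=
      (toeplitz_zpow_comp_congr (by push_cast; ring)).symm
    rw [e]
    have e2 : (toeplitz p h : Hardy p →ₗ[ℂ] Hardy p) =
        (toeplitz p (fun t => h t * (t : ℂ) ^ (-1 : ℤ)) : Hardy p →ₗ[ℂ] Hardy p) ∘ₗ
          (toeplitz p (fun t => (t : ℂ) ^ (1 : ℤ)) : Hardy p →ₗ[ℂ] Hardy p) := by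
      rw [← toeplitz_comp_V hhm', toeplitz_zpow_comp_congr (k := 0) (by norm_num),
        toeplitz_zpow_zero]
    obtain ⟨x, hx⟩ := hs (monoH p 0)
    have hx0 : toeplitz p (fun t => h t * (t : ℂ) ^ (-1 : ℤ)) x = 0 := by
      rw [toeplitz_mul_zpow_neg hhm zero_le_one, hx, toeplitz_zpow_neg_one_monoH]
    have hxne : x ≠ 0 := fun h0 => by
      rw [h0, map_zero] at hx
      have h1 := fcoef_monoH (p := p) 0 0
      rw [← hx, ← fcoefL_apply] at h1
      simp at h1
    obtain ⟨k, hk, hk1⟩ := exists_ker_evalZero hhm' hx0 hxne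
    have hsurj : Function.Surjective (toeplitz p (fun t => h t * (t : ℂ) ^ (-1 : ℤ))) := fun y => by
      obtain ⟨z, hz⟩ := hs (toeplitz p (fun t => (t : ℂ) ^ (1 : ℤ)) y)
      refine ⟨z, ?_⟩
      rw [toeplitz_mul_zpow_neg hhm zero_le_one, hz, toeplitz_zpow_neg_zpow zero_le_one]
    rw [e2] at hf
    have h1 := finite_ker_of_comp
      (A := (toeplitz p (fun t => h t * (t : ℂ) ^ (-1 : ℤ)) : Hardy p →ₗ[ℂ] Hardy p))
      (toeplitz_zpow_neg_zpow zero_le_one) toeplitz_zpow_one_zpow_neg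
      evalZero_toeplitz_zpow_one hk hk1
    refine ⟨hsurj, h1.1, ?_⟩
    rw [h1.2, ← e2, hn]

lemma index_of_bijective (hb : Function.Bijective (toeplitz p g)) (n : ℕ) :
    index (toeplitz p (fun t => g t * (t : ℂ) ^ (-(n : ℤ)))) = n := by
  obtain ⟨h1, -, h2⟩ := finrank_ker_of_bijective hg hb n
  rw [index, h2, LinearMap.range_eq_top.2 h1, Module.finrank_zero_of_subsingleton]
  simp

omit hg in
lemma isInvertible_of_bijective {A : Hardy p →L[ℂ] Hardy p} (h : Function.Bijective A) :
    A.IsInvertible :=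
  ⟨ContinuousLinearEquiv.ofBijective A (LinearMap.ker_eq_bot.2 h.1) (LinearMap.range_eq_top.2 h.2),
    ContinuousLinearEquiv.coe_ofBijective _ _ _⟩

/-- For `κ ≥ 0` one has `T(g) = T(t^{-κ}) T(g t^κ)`, and `T(t^{-κ})` is a left inverse of `T(t^κ)`.
-/
lemma toeplitz_rightInv (hk : 0 ≤ index (toeplitz p g))
    (hb : Function.Bijective (toeplitz p (fun t => g t * (t : ℂ) ^ index (toeplitz p g)))) :
    toeplitz p g ∘L rightInv p g = ContinuousLinearMap.id ℂ _ := by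
  ext1 y
  rw [ContinuousLinearMap.comp_apply, rightInv, ContinuousLinearMap.comp_apply]
  set κ := index (toeplitz p g) with hκ
  set f := (toeplitz p (fun t => g t * (t : ℂ) ^ κ)).inverse
    (toeplitz p (fun t => (t : ℂ) ^ κ) y) with hf
  have h1 : toeplitz p (fun t => g t * (t : ℂ) ^ κ) f = toeplitz p (fun t => (t : ℂ) ^ κ) y :=
    (isInvertible_of_bijective hb).self_apply_inverse _
  have h2 := toeplitz_mul_zpow_neg (p := p) (memLp_top_mul hg (memLp_top_zpow κ)) hk f
  rw [h1, toeplitz_zpow_neg_zpow hk, toeplitz_zpow_comp_congr (k := 0) (by ring),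
    toeplitz_zpow_zero] at h2
  exact h2

/-- For `κ = ind T(g) ≤ 0`, a left inverse of `T(g)`. -/
lemma exists_leftInv (hk : index (toeplitz p g) ≤ 0)
    (hb : Function.Bijective (toeplitz p (fun t => g t * (t : ℂ) ^ index (toeplitz p g)))) :
    ∃ B : Hardy p →L[ℂ] Hardy p, ∀ f, B (toeplitz p g f) = f := by
  set κ := index (toeplitz p g) with hκ
  -- The same formula as for `rightInv`; for `κ ≤ 0` the factorisation is `T(g t^κ) = T(t^κ) T(g)`,
  -- so it inverts from the left.
  refine ⟨(toeplitz p (fun t => g t * (t : ℂ) ^ κ)).inverse ∘L toeplitz p (fun t => (t : ℂ) ^ κ),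
    fun f => ?_⟩
  have h := toeplitz_mul_zpow_neg (p := p) hg (n := -κ) (by omega) f
  rw [neg_neg] at h
  rw [ContinuousLinearMap.comp_apply, ← h]
  exact (isInvertible_of_bijective hb).inverse_apply_self f

end Toeplitz

/-! ### Duality -/

section Duality

variable {p q : ℝ≥0∞} [hp1 : Fact (1 ≤ p)] [hq1 : Fact (1 ≤ q)] [hpq : p.HolderConjugate q]

/-- The inclusion of `L²` into `L^p` for `p ≤ 2`. -/
def inclL2 (hp2 : p ≤ 2) : Lp ℂ 2 arc →L[ℂ] Lp ℂ p arc :=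
  LinearMap.mkContinuous
    { toFun := fun f => ((Lp.memLp f).mono_exponent hp2).toLp f
      map_add' := fun f g => by
        rw [← MemLp.toLp_add]
        exact MemLp.toLp_congr _ _ (Lp.coeFn_add f g)
      map_smul' := fun c f => by
        rw [RingHom.id_apply, ← MemLp.toLp_const_smul]
        exact MemLp.toLp_congr _ _ (Lp.coeFn_smul c f) } 1 fun f => by
    change ‖((Lp.memLp f).mono_exponent hp2).toLp f‖ ≤ _
    rw [one_mul, Lp.norm_toLp, Lp.norm_def]
    exact ENNReal.toReal_mono (Lp.eLpNorm_ne_top f)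
      (eLpNorm_le_eLpNorm_of_exponent_le hp2 (Lp.aestronglyMeasurable f))

lemma coeFn_inclL2 (hp2 : p ≤ 2) (f : Lp ℂ 2 arc) : inclL2 hp2 f =ᵐ[arc] f :=
  ((Lp.memLp f).mono_exponent hp2).coeFn_toLp

/-- Functionals on `L^p`, `1 < p ≤ 2`, are represented by functions in `L^q`. -/
lemma exists_representation (hp : 1 < p) (hp2 : p ≤ 2) (ℓ : Lp ℂ p arc →L[ℂ] ℂ) :
    ∃ k : Lp ℂ q arc, ∀ f, ℓ f = pair f k := by
  have hqp := hpq.symm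
  have hp' : p < ∞ := hp2.trans_lt (by simp)
  have hq : 1 < q := one_lt_conj hp'
  have hq' : q < ∞ := conj_lt_top (p := p) hp
  have hq2 : 2 ≤ q.toReal := by
    have := ENNReal.toReal_mono hq'.ne (two_le_conj (q := q) hp2)
    simpa using this
  -- The functional restricted to `L²` is represented by some `g ∈ L²`. What remains is `g ∈ L^q`,
  -- shown by bounding the truncations `u N` uniformly and applying Fatou's lemma.
  set g : Lp ℂ 2 arc := (InnerProductSpace.toDual ℂ (Lp ℂ 2 arc)).symm (ℓ ∘L inclL2 hp2) with hgdef
  have hg : ∀ f : Lp ℂ 2 arc, ℓ (inclL2 hp2 f) = ∫ t, f t * conj (g t) ∂arc := fun f => by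
    have h1 : inner ℂ g f = ℓ (inclL2 hp2 f) := by
      rw [hgdef, InnerProductSpace.toDual_symm_apply]
      rfl
    rw [← h1, L2.inner_def]
    simp only [RCLike.inner_apply]
  have hgm : StronglyMeasurable (g : Circle → ℂ) := Lp.stronglyMeasurable g
  let S : ℕ → Set Circle := fun N => {t | ‖g t‖ ≤ N}
  have hS : ∀ N, MeasurableSet (S N) := fun N =>
    measurableSet_le hgm.norm.measurable measurable_const
  let u : ℕ → Circle → ℂ := fun N => (S N).indicator g
  have hum : ∀ N, AEStronglyMeasurable (u N) arc := fun N =>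
    (hgm.indicator (hS N)).aestronglyMeasurable
  have hub : ∀ N t, ‖u N t‖ ≤ N := fun N t => by
    by_cases h : t ∈ S N
    · rw [show u N t = g t from Set.indicator_of_mem h _]
      exact h
    · simp [u, h]
  have huL : ∀ N, MemLp (u N) q arc := fun N =>
    (memLp_top_of_bound (hum N) N (Filter.Eventually.of_forall (hub N))).mono_exponent le_top
  have hbound : ∀ N, ‖(huL N).toLp (u N)‖ ≤ ‖ℓ‖ := fun N => by
    obtain ⟨k, hk1, hk2, c, hk3⟩ := exists_extremal (q := p) hq hq' ((huL N).toLp (u N))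
    have hk4 : ∀ᵐ t ∂arc, k t = c * (u N t * ((‖u N t‖ ^ (q.toReal - 2) : ℝ) : ℂ)) := by
      filter_upwards [hk3, (huL N).coeFn_toLp] with t h1 h2
      rw [h1, h2]
    have hkb : ∀ᵐ t ∂arc, ‖k t‖ ≤ |c| * (N * (N : ℝ) ^ (q.toReal - 2)) := by
      filter_upwards [hk4] with t h1
      rw [h1, norm_mul, norm_mul, Complex.norm_real, Complex.norm_real, Real.norm_eq_abs,
        Real.norm_eq_abs, abs_of_nonneg (by positivity : 0 ≤ ‖u N t‖ ^ (q.toReal - 2))]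
      have := hub N t
      -- Here `q ≥ 2` matters: the extremal function of the bounded `u N` is then bounded, hence in
      -- `L²`, and can be tested against `g`.
      have h0 : 0 ≤ q.toReal - 2 := by linarith
      gcongr
    have hk2L : MemLp k 2 arc :=
      (memLp_top_of_bound (Lp.aestronglyMeasurable k) _ hkb).mono_exponent le_top
    have h1 : inclL2 hp2 (hk2L.toLp k) = k := by
      refine Lp.ext ?_
      filter_upwards [coeFn_inclL2 hp2 (hk2L.toLp k), hk2L.coeFn_toLp] with t h1 h2
      rw [h1, h2]
    have h2 : ℓ k = pair k ((huL N).toLp (u N)) := by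
      rw [← h1, hg, h1]
      refine integral_congr_ae ?_
      filter_upwards [hk2L.coeFn_toLp, (huL N).coeFn_toLp, hk4] with t h1 h2 h3
      rw [h1, h2]
      by_cases h : t ∈ S N
      · simp [u, h]
      · have : u N t = 0 := by simp [u, h]
        rw [h3, this]
        simp
    have h3 : ‖ℓ k‖ = ‖(huL N).toLp (u N)‖ := by
      rw [h2, ← pair_symm, hk2]
      simp
    rw [← h3]
    simpa using ℓ.le_opNorm_of_le hk1
  have hgL : MemLp g q arc := by
    refine ⟨hgm.aestronglyMeasurable, ?_⟩
    have h1 : eLpNorm g q arc ≤ Filter.liminf (fun N => eLpNorm (u N) q arc) Filter.atTop := by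
      refine Lp.eLpNorm_lim_le_liminf_eLpNorm hum g (Filter.Eventually.of_forall fun t => ?_)
      obtain ⟨M, hM⟩ := exists_nat_ge ‖g t‖
      refine tendsto_const_nhds.congr' ?_
      filter_upwards [Filter.eventually_ge_atTop M] with N hN
      have : t ∈ S N := hM.trans (by exact_mod_cast hN)
      simp [u, this]
    refine (h1.trans (Filter.liminf_le_of_frequently_le' (x := ENNReal.ofReal ‖ℓ‖)
      (Filter.Frequently.of_forall fun N => ?_))).trans_lt ENNReal.ofReal_lt_top
    have := hbound N
    rw [Lp.norm_toLp] at this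
    exact (ENNReal.le_ofReal_iff_toReal_le (huL N).2.ne (norm_nonneg _)).2 this
  refine ⟨hgL.toLp g, fun f => ?_⟩
  have : ℓ = pairL (hgL.toLp g) := by
    refine clm_ext_mono hp'.ne fun n => ?_
    have h1 : inclL2 hp2 (mono 2 n) = mono p n := by
      refine Lp.ext ?_
      filter_upwards [coeFn_inclL2 hp2 (mono 2 n), coeFn_mono 2 n, coeFn_mono p n] with t h1 h2 h3
      rw [h1, h2, h3]
    rw [← h1, hg, pairL_apply]
    refine integral_congr_ae ?_
    filter_upwards [coeFn_inclL2 hp2 (mono 2 n), hgL.coeFn_toLp] with t h1 h2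
    rw [h1, h2]
  rw [this, pairL_apply]

variable [hlt : Fact (1 < p)] [hfin : Fact (p < ∞)] [hqlt : Fact (1 < q)] [hqfin : Fact (q < ∞)]

lemma pair_projP_right (y : Hardy p) (k : Lp ℂ q arc) :
    pair (y : Lp ℂ p arc) (projP q k : Lp ℂ q arc) = pair (y : Lp ℂ p arc) k := by
  rw [← pair_projP, projP_coe]

lemma pair_projP_left (y : Lp ℂ p arc) (k : Hardy q) :
    pair (projP p y : Lp ℂ p arc) (k : Lp ℂ q arc) = pair y (k : Lp ℂ q arc) := by
  rw [pair_projP, projP_coe]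

lemma Hardy_eq_zero_of_pair {y : Hardy p}
    (h : ∀ k : Hardy q, pair (y : Lp ℂ p arc) (k : Lp ℂ q arc) = 0) : y = 0 :=
  Subtype.ext (eq_zero_of_pair (q := q) hlt.out hfin.out fun k => by
    rw [← pair_projP_right]; exact h _)

lemma Hardy_eq_of_pair {y z : Hardy p}
    (h : ∀ k : Hardy q, pair (y : Lp ℂ p arc) (k : Lp ℂ q arc) =
      pair (z : Lp ℂ p arc) (k : Lp ℂ q arc)) : y = z :=
  sub_eq_zero.1 (Hardy_eq_zero_of_pair (q := q) fun k => by
    rw [AddSubgroupClass.coe_sub, pair_sub_left, h, sub_self])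

variable {g : Circle → ℂ} (hg : MemLp g ∞ arc)
include hg

lemma pair_toeplitz (f : Hardy p) (k : Hardy q) :
    pair (toeplitz p g f : Lp ℂ p arc) (k : Lp ℂ q arc) =
      pair (f : Lp ℂ p arc) (toeplitz q (fun t => conj (g t)) k : Lp ℂ q arc) := by
  rw [toeplitz_apply, toeplitz_apply, pair_projP_left, pair_mulOp hg, pair_projP_right]

lemma injective_toeplitz_conj (hs : Function.Surjective (toeplitz p g)) :
    Function.Injective (toeplitz q (fun t => conj (g t))) := by
  have hqp := hpq.symm
  refine (injective_iff_map_eq_zero _).2 fun k hk => ?_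
  refine Hardy_eq_zero_of_pair (q := p) fun y => ?_
  obtain ⟨f, rfl⟩ := hs y
  rw [← pair_symm, pair_toeplitz hg, hk]
  have := pair_zero_right (q := q) (f : Lp ℂ p arc)
  simpa using this

/-- Functionals are represented only for exponents at most `2`, hence two cases. For `p ≤ 2`, a
preimage of `y` represents `f ↦ ⟨T(g)⁻¹ P f, y⟩`. For `p ≥ 2`, the inverse of `T(g)` bounds `T(conj
g)` from below, so its range is closed. A functional on `H^q` vanishing on that range is given by
some `k ∈ L^p` with `T(g) P k = 0`, so it is zero. -/
lemma bijective_toeplitz_conj (hb : Function.Bijective (toeplitz p g)) :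
    Function.Bijective (toeplitz q (fun t => conj (g t))) := by
  have hqp := hpq.symm
  refine ⟨injective_toeplitz_conj hg hb.2, ?_⟩
  set T := toeplitz p g with hT
  set T' := toeplitz q (fun t => conj (g t)) with hT'
  have hinv := isInvertible_of_bijective hb
  set B := T.inverse with hB
  rcases le_total p 2 with hp2 | hp2
  · intro y
    obtain ⟨k, hk⟩ := exists_representation (q := q) hlt.out hp2
      (pairL (y : Lp ℂ q arc) ∘L (Hardy p).subtypeL ∘L B ∘L projP p)
    refine ⟨projP q k, Hardy_eq_of_pair (q := p) fun f => ?_⟩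
    rw [← pair_symm, ← pair_symm (f : Lp ℂ p arc)]
    congr 1
    rw [hT', ← pair_toeplitz hg, pair_projP_right, ← hk]
    change pairL (y : Lp ℂ q arc) (B (projP p (T f)) : Lp ℂ p arc) = _
    rw [pairL_apply, projP_coe, hinv.inverse_apply_self]
  · have hq2 : q ≤ 2 := conj_le_two hp2
    have hbound : ∀ z : Hardy q, ‖z‖ ≤ (‖(Hardy p).subtypeL ∘L B ∘L projP p‖) * ‖T' z‖ := fun z => by
      refine norm_le_of_pair (q := p) hqlt.out hqfin.out (z : Lp ℂ q arc) fun k hk => ?_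
      have h1 : pair (z : Lp ℂ q arc) k =
          conj (pair (B (projP p k) : Lp ℂ p arc) (T' z : Lp ℂ q arc)) := by
        rw [hT', ← pair_toeplitz hg, ← hT, hinv.self_apply_inverse, pair_symm, pair_projP_right]
      rw [h1, RCLike.norm_conj]
      refine (norm_pair_le _ _).trans ?_
      gcongr
      · have := (((Hardy p).subtypeL ∘L B ∘L projP p).le_opNorm_of_le hk)
        rw [mul_one] at this
        exact this
      · exact le_rfl
    have hanti : AntilipschitzWith (Real.toNNReal ‖(Hardy p).subtypeL ∘L B ∘L projP p‖) T' :=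
      AddMonoidHomClass.antilipschitz_of_bound T' fun z => by
        rw [Real.coe_toNNReal _ (norm_nonneg _)]
        exact hbound z
    have hcl : IsClosed (LinearMap.range (T' : Hardy q →ₗ[ℂ] Hardy q) : Set (Hardy q)) :=
      hanti.isClosed_range T'.uniformContinuous
    by_contra hns
    have hne : LinearMap.range (T' : Hardy q →ₗ[ℂ] Hardy q) ≠ ⊤ := fun h =>
      hns (LinearMap.range_eq_top.1 h)
    obtain ⟨y, -, hy⟩ := SetLike.exists_of_lt (lt_top_iff_ne_top.2 hne)
    set R := LinearMap.range (T' : Hardy q →ₗ[ℂ] Hardy q) with hR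
    have : IsClosed (R : Set (Hardy q)) := hcl
    have hy0 : (Submodule.Quotient.mk y : Hardy q ⧸ R) ≠ 0 := fun h =>
      hy ((Submodule.Quotient.mk_eq_zero _).1 h)
    obtain ⟨ℓ, hℓ⟩ := SeparatingDual.exists_ne_zero (R := ℂ) hy0
    obtain ⟨k, hk⟩ := exists_representation (p := q) (q := p) hqlt.out hq2
      (ℓ ∘L R.mkQL ∘L projP q)
    have hk' : ∀ z : Hardy q, ℓ (Submodule.Quotient.mk z) = pair (z : Lp ℂ q arc) k := fun z => by
      rw [← hk]
      change _ = ℓ (Submodule.Quotient.mk (projP q (z : Lp ℂ q arc)))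
      rw [projP_coe]
    refine hℓ ?_
    have hTk : T (projP p k) = 0 := Hardy_eq_zero_of_pair (q := q) fun z => by
      rw [hT, pair_toeplitz hg, ← pair_symm, pair_projP_right, ← hT', ← hk',
        (Submodule.Quotient.mk_eq_zero R (x := T' z)).2 ⟨z, rfl⟩, map_zero, map_zero]
    have hk0 : projP p k = 0 := hb.1 (by rw [hTk, map_zero])
    rw [hk', ← pair_projP_right, hk0]
    exact pair_zero_right _

end Duality

/-! ### Toeplitz plus Hankel operators -/

section Subspaces

variable {p : ℝ≥0∞} [hp1 : Fact (1 ≤ p)] [hlt : Fact (1 < p)] [hfin : Fact (p < ∞)]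
  (β : ℂ) [hβ : Fact (1 < ‖β‖)]

lemma hankel_apply (b : Circle → ℂ) (f : Hardy p) :
    hankel p β b f = projP p (mulOp p b (shiftOp p β (f : Lp ℂ p arc))) := by
  change projP p (mulOp p b (projQ p (shiftOp p β (f : Lp ℂ p arc)))) = _
  rw [projQ_eq_self (projP_shiftOp β f.2)]

lemma coe_shiftQ (g : Circle → ℂ) (f : Hardy p) :
    (shiftQ p β g f : Lp ℂ p arc) = shiftOp p β (projQ p (mulOp p g (f : Lp ℂ p arc))) :=
  projP_of_mem (shiftOp_mem_Hardy β (projP_projQ _))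

lemma rightInv_congr {g h : Circle → ℂ} (H : g =ᵐ[arc] h) : rightInv p g = rightInv p h := by
  have e : ∀ n : ℤ, toeplitz p (fun t => g t * (t : ℂ) ^ n) =
      toeplitz p (fun t => h t * (t : ℂ) ^ n) := fun n => by
    refine toeplitz_congr ?_
    filter_upwards [H] with t ht
    rw [ht]
  rw [rightInv, rightInv, toeplitz_congr H, e]

lemma imP_congr (ε : ℂ) {g h : Circle → ℂ} (H : g =ᵐ[arc] h) : imP p β ε g = imP p β ε h := by
  rw [imP, imP, toeplitz_congr H, shiftQ, shiftQ, mulOp_congr H]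

variable {g : Circle → ℂ}

lemma mulOp_shiftOp_mulOp (hg : MemLp g ∞ arc) (hgg : ∀ᵐ t ∂arc, g t * g (alpha β t) = 1)
    (f : Lp ℂ p arc) : mulOp p g (shiftOp p β (mulOp p g f)) = shiftOp p β f := by
  rw [shiftOp_mulOp β hg, mulOp_cancel hg (memLp_top_comp_alpha β hg) hgg]

variable {ε : ℂ} (hε : ε * ε = 1)
include hε

/-- Since `g g_α = 1`, the map `s ↦ J g s` is an involution of `ker T(g)`, and `P_α^ε(g)` projects
onto its `ε`-eigenspace. The eigenvalue equation `J g s = ε s` is `g s = ε J s`, which by itself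
implies `T(g) s = 0`. -/
lemma mem_imP (hg : MemLp g ∞ arc) (hgg : ∀ᵐ t ∂arc, g t * g (alpha β t) = 1) {s : Hardy p} :
    s ∈ imP p β ε g ↔ mulOp p g (s : Lp ℂ p arc) = ε • shiftOp p β (s : Lp ℂ p arc) := by
  constructor
  · rintro ⟨x, hx, rfl⟩
    have hx' : projP p (mulOp p g (x : Lp ℂ p arc)) = 0 := hx
    have e : ((((1 / 2 : ℂ) • (ContinuousLinearMap.id ℂ (Hardy p) + ε • shiftQ p β g) :
        Hardy p →L[ℂ] Hardy p) x : Hardy p) : Lp ℂ p arc) =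
        (1 / 2 : ℂ) • ((x : Lp ℂ p arc) + ε • shiftOp p β (mulOp p g (x : Lp ℂ p arc))) := by
      have := coe_shiftQ β g x
      rw [projQ_eq_self hx'] at this
      rw [← this]
      rfl
    rw [ContinuousLinearMap.coe_coe, e]
    simp only [map_smul, map_add]
    rw [mulOp_shiftOp_mulOp β hg hgg, shiftOp_shiftOp]
    rw [smul_comm ε (1 / 2 : ℂ), smul_add, smul_add, smul_smul ε ε, hε, one_smul, smul_add,
      add_comm]
  · intro h
    have hs : toeplitz p g s = 0 := by
      rw [toeplitz_apply, h, map_smul, projP_shiftOp β s.2, smul_zero]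
    refine ⟨s, hs, Subtype.ext ?_⟩
    have e := coe_shiftQ β g s
    rw [projQ_eq_self (f := mulOp p g (s : Lp ℂ p arc)) hs, h, map_smul, shiftOp_shiftOp] at e
    change (1 / 2 : ℂ) • ((s : Lp ℂ p arc) + ε • (shiftQ p β g s : Lp ℂ p arc)) = s
    rw [e, smul_smul, hε, one_smul, ← two_smul ℂ, smul_smul]
    norm_num

lemma imP_eq_bot (hg : MemLp g ∞ arc) (hgg : ∀ᵐ t ∂arc, g t * g (alpha β t) = 1)
    (hi : Function.Injective (toeplitz p g)) : imP p β ε g = ⊥ := by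
  refine (Submodule.eq_bot_iff _).2 fun s hs => ?_
  rw [mem_imP β hε hg hgg] at hs
  refine hi ?_
  rw [toeplitz_apply, hs, map_smul, projP_shiftOp β s.2, smul_zero, map_zero]

omit hε in
/-- For a right inverse `R` of `T(g)`, a solution `f ∈ H^p` of `g f + ε J f = w`. -/
def solveOp (ε : ℂ) (g : Circle → ℂ) (R : Hardy p →L[ℂ] Hardy p) : Lp ℂ p arc →L[ℂ] Hardy p :=
  (1 / 2 : ℂ) • (R ∘L projP p + ε • (projP p ∘L shiftOp p β ∘L projQ p ∘L
    (ContinuousLinearMap.id ℂ _ - mulOp p g ∘L (Hardy p).subtypeL ∘L R ∘L projP p)))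

/-- Let `f₀ = R P w` and `f₁ = ε J (w - g f₀)`; the latter is in `H^p` because `w - g f₀ ∈ ker P`.
Using `g J w = ε w` and `g J g = J`, the operator `g + ε J` sends `f₁` to `2 w - (g f₀ + ε J f₀)`,
so the average of `f₀` and `f₁` is a solution. -/
lemma solveOp_spec (hg : MemLp g ∞ arc) (hgg : ∀ᵐ t ∂arc, g t * g (alpha β t) = 1)
    {R : Hardy p →L[ℂ] Hardy p} (hR : toeplitz p g ∘L R = ContinuousLinearMap.id ℂ _)
    {w : Lp ℂ p arc} (hw : mulOp p g (shiftOp p β w) = ε • w) :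
    mulOp p g (solveOp β ε g R w : Lp ℂ p arc) +
      ε • shiftOp p β (solveOp β ε g R w : Lp ℂ p arc) = w := by
  set f₀ : Hardy p := R (projP p w) with hf₀
  have h0 : projP p (w - mulOp p g (f₀ : Lp ℂ p arc)) = 0 := by
    rw [map_sub, sub_eq_zero]
    exact (DFunLike.congr_fun hR (projP p w)).symm
  have e : (solveOp β ε g R w : Lp ℂ p arc) =
      (1 / 2 : ℂ) • ((f₀ : Lp ℂ p arc) + ε • shiftOp p β (w - mulOp p g (f₀ : Lp ℂ p arc))) := by
    rw [← projP_of_mem (shiftOp_mem_Hardy β h0)]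
    conv_rhs => rw [← projQ_eq_self h0]
    rfl
  rw [e]
  simp only [map_smul, map_add, map_sub]
  rw [mulOp_shiftOp_mulOp β hg hgg, shiftOp_shiftOp, shiftOp_shiftOp, hw]
  have h1 : ε • ε • w = w := by rw [smul_smul, hε, one_smul]
  have h2 : ∀ x : Lp ℂ p arc, ε • ε • x = x := fun x => by rw [smul_smul, hε, one_smul]
  simp only [smul_add, smul_sub, smul_comm ε (1 / 2 : ℂ), h2]
  have h3 : w = (1 / 2 : ℂ) • w + (1 / 2 : ℂ) • w := by
    rw [← add_smul]; norm_num
  conv_rhs => rw [h3]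
  abel

end Subspaces

/-! ### Kernel and one-sided inverses for a matching pair. -/

section MatchingPair

variable {p : ℝ≥0∞} [hp1 : Fact (1 ≤ p)] [hlt : Fact (1 < p)] [hfin : Fact (p < ∞)]
  {β : ℂ} [hβ : Fact (1 < ‖β‖)] {a b : Circle → ℂ} (hab : IsMatchingPair β a b)

namespace IsMatchingPair

include hab

lemma ne_zero_right : ∀ᵐ t ∂arc, b t ≠ 0 ∧ b (alpha β t) ≠ 0 := by
  filter_upwards [hab.ne_zero, ae_comp_alpha β hab.ne_zero, hab.matching] with t h1 h2 h3
  have := mul_ne_zero h1 h2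
  rw [h3] at this
  exact mul_ne_zero_iff.1 this

lemma memLp_inv_comp : MemLp (fun t => (a (alpha β t))⁻¹) ∞ arc :=
  memLp_top_comp_alpha β hab.memLp_inv

lemma memLp_inv_right : MemLp (fun t => (b t)⁻¹) ∞ arc := by
  refine (memLp_congr_ae ?_).1 (memLp_top_mul (memLp_top_comp_alpha β hab.memLp_right)
    (memLp_top_mul hab.memLp_inv hab.memLp_inv_comp))
  filter_upwards [hab.ne_zero, ae_comp_alpha β hab.ne_zero, hab.matching, hab.ne_zero_right]
    with t h1 h2 h3 h4
  have := h4.1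
  field_simp
  rw [h3]
  ring

lemma memLp_subC : MemLp (subC a b) ∞ arc := memLp_top_mul hab.memLp_left hab.memLp_inv_right

lemma memLp_subD : MemLp (subD β a b) ∞ arc := memLp_top_mul hab.memLp_right hab.memLp_inv_comp

lemma subC_ne_zero : ∀ᵐ t ∂arc, subC a b t ≠ 0 := by
  filter_upwards [hab.ne_zero, hab.ne_zero_right] with t h1 h2
  exact mul_ne_zero h1 (inv_ne_zero h2.1)

lemma subD_ne_zero : ∀ᵐ t ∂arc, subD β a b t ≠ 0 := by
  filter_upwards [ae_comp_alpha β hab.ne_zero, hab.ne_zero_right] with t h1 h2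
  exact mul_ne_zero h2.1 (inv_ne_zero h1)

lemma subC_mul_subC : ∀ᵐ t ∂arc, subC a b t * subC a b (alpha β t) = 1 := by
  filter_upwards [hab.matching, hab.ne_zero_right] with t h1 ⟨h2, h3⟩
  rw [subC, subC]
  field_simp
  exact h1

lemma subD_mul_subD : ∀ᵐ t ∂arc, subD β a b t * subD β a b (alpha β t) = 1 := by
  filter_upwards [hab.matching, hab.ne_zero, ae_comp_alpha β hab.ne_zero] with t h1 h2 h3
  rw [subD, subD, alpha_alpha]
  field_simp
  rw [← h1, mul_comm]

lemma mulOp_left (f : Lp ℂ p arc) : mulOp p b (mulOp p (subC a b) f) = mulOp p a f := by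
  rw [mulOp_mulOp hab.memLp_right hab.memLp_subC]
  refine DFunLike.congr_fun (mulOp_congr ?_) f
  filter_upwards [hab.ne_zero_right] with t h1
  have := h1.1
  rw [subC]
  field_simp

lemma mulOp_right_inv (f : Lp ℂ p arc) : mulOp p b (mulOp p (fun t => (b t)⁻¹) f) = f := by
  refine mulOp_cancel hab.memLp_right hab.memLp_inv_right ?_ f
  filter_upwards [hab.ne_zero_right] with t h1
  exact mul_inv_cancel₀ h1.1

lemma mulOp_inv_right (f : Lp ℂ p arc) : mulOp p (fun t => (b t)⁻¹) (mulOp p b f) = f := by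
  refine mulOp_cancel hab.memLp_inv_right hab.memLp_right ?_ f
  filter_upwards [hab.ne_zero_right] with t h1
  exact inv_mul_cancel₀ h1.1

lemma subD_shiftOp_left (f : Lp ℂ p arc) :
    mulOp p (subD β a b) (shiftOp p β (mulOp p a f)) = mulOp p b (shiftOp p β f) := by
  rw [shiftOp_mulOp β hab.memLp_left, mulOp_mulOp hab.memLp_subD
    (memLp_top_comp_alpha β hab.memLp_left)]
  refine DFunLike.congr_fun (mulOp_congr ?_) _
  filter_upwards [ae_comp_alpha β hab.ne_zero] with t h1
  rw [subD]
  field_simp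

lemma subD_shiftOp_right (f : Lp ℂ p arc) :
    mulOp p (subD β a b) (shiftOp p β (mulOp p b f)) = mulOp p a (shiftOp p β f) := by
  rw [shiftOp_mulOp β hab.memLp_right, mulOp_mulOp hab.memLp_subD
    (memLp_top_comp_alpha β hab.memLp_right)]
  refine DFunLike.congr_fun (mulOp_congr ?_) _
  filter_upwards [ae_comp_alpha β hab.ne_zero, hab.matching] with t h1 h2
  rw [subD]
  field_simp
  rw [← h2, mul_comm]

lemma mulOp_right_inv_comp (f : Lp ℂ p arc) :
    mulOp p b (mulOp p (fun t => (a (alpha β t))⁻¹) f) = mulOp p (subD β a b) f := by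
  rw [mulOp_mulOp hab.memLp_right hab.memLp_inv_comp]
  rfl

lemma subC_shiftOp_inv_right (f : Lp ℂ p arc) :
    mulOp p (subC a b) (shiftOp p β (mulOp p (fun t => (b t)⁻¹) f)) =
      mulOp p (fun t => (b t)⁻¹) (mulOp p (subD β a b) (shiftOp p β f)) := by
  rw [shiftOp_mulOp β hab.memLp_inv_right, mulOp_mulOp hab.memLp_subC
    (memLp_top_comp_alpha β hab.memLp_inv_right), mulOp_mulOp hab.memLp_inv_right hab.memLp_subD]
  refine DFunLike.congr_fun (mulOp_congr ?_) _
  filter_upwards [ae_comp_alpha β hab.ne_zero, hab.ne_zero_right, hab.matching] with t h1 ⟨h2, h3⟩ h4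
  rw [subD, subC]
  field_simp
  exact h4

lemma subC_shiftOp_inv_comp (f : Lp ℂ p arc) :
    mulOp p (subC a b) (shiftOp p β (mulOp p (fun t => (a (alpha β t))⁻¹) f)) =
      mulOp p (fun t => (b t)⁻¹) (shiftOp p β f) := by
  rw [shiftOp_mulOp β hab.memLp_inv_comp, mulOp_mulOp hab.memLp_subC
    (memLp_top_comp_alpha β hab.memLp_inv_comp)]
  refine DFunLike.congr_fun (mulOp_congr ?_) _
  filter_upwards [hab.ne_zero, hab.ne_zero_right] with t h1 h2
  have := h2.1
  rw [subC, alpha_alpha]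
  field_simp

lemma inv_right_subD (f : Lp ℂ p arc) :
    mulOp p (fun t => (b t)⁻¹) (mulOp p (subD β a b) f) =
      mulOp p (fun t => (a (alpha β t))⁻¹) f := by
  rw [← hab.mulOp_right_inv_comp, hab.mulOp_inv_right]

omit hab in
/-- The operator `T(a) + ε H_α(b)` as the compression of `f ↦ a f + ε b J_α f`. -/
lemma toeplitz_add_hankel_apply (ε : ℂ) (f : Hardy p) :
    (toeplitz p a + ε • hankel p β b) f = projP p (mulOp p a (f : Lp ℂ p arc) +
      ε • mulOp p b (shiftOp p β (f : Lp ℂ p arc))) := by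
  rw [map_add, map_smul, ← hankel_apply, ← toeplitz_apply]
  rfl

variable {ε : ℂ} (hε : ε * ε = 1)
include hε

/-- The involution `d J` exchanges the two terms: `d J (a f) = b J f` and `d J (b J f) = a f`. -/
lemma subD_shiftOp_symbol (f : Lp ℂ p arc) :
    mulOp p (subD β a b) (shiftOp p β (mulOp p a f + ε • mulOp p b (shiftOp p β f))) =
      ε • (mulOp p a f + ε • mulOp p b (shiftOp p β f)) := by
  simp only [map_add, map_smul]
  rw [hab.subD_shiftOp_left, hab.subD_shiftOp_right, shiftOp_shiftOp, smul_add, smul_smul, hε,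
    one_smul, add_comm]

omit hε in
lemma symbol_eq (f : Lp ℂ p arc) :
    mulOp p a f + ε • mulOp p b (shiftOp p β f) =
      mulOp p b (mulOp p (subC a b) f + ε • shiftOp p β f) := by
  rw [map_add, map_smul, hab.mulOp_left]

omit hε in
lemma mulOp_subC_eq_iff (f : Lp ℂ p arc) :
    mulOp p (subC a b) f = -ε • shiftOp p β f ↔
      mulOp p a f + ε • mulOp p b (shiftOp p β f) = 0 := by
  rw [hab.symbol_eq, neg_smul, eq_neg_iff_add_eq_zero]
  refine ⟨fun h => by rw [h, map_zero], fun h => ?_⟩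
  rw [← hab.mulOp_inv_right (mulOp p (subC a b) f + _), h, map_zero]

omit hab hε in
lemma phi_eq_solveOp (s : Hardy p) :
    phi β p ε a b s = solveOp β ε (subC a b) (rightInv p (subC a b))
      (mulOp p (fun t => (a (alpha β t))⁻¹) (s : Lp ℂ p arc)) := by
  simp only [phi, solveOp, shiftQ, toeplitz, _root_.smul_apply,
    _root_.add_apply, _root_.sub_apply, ContinuousLinearMap.comp_apply,
    ContinuousLinearMap.id_apply, map_sub, smul_sub, Submodule.subtypeL_apply]
  congr 1
  abel

/-- `φ` solves `c f + ε J f = w` for `w = a_α⁻¹ s`. The relation `d s = ε J s` gives both the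
compatibility `c J w = b⁻¹ J s = ε w` and `b w = d s = ε J s`. -/
lemma symbol_phi (hR : toeplitz p (subC a b) ∘L rightInv p (subC a b) = ContinuousLinearMap.id ℂ _)
    {s : Hardy p} (hs : s ∈ imP p β ε (subD β a b)) :
    mulOp p a (phi β p ε a b s : Lp ℂ p arc) +
      ε • mulOp p b (shiftOp p β (phi β p ε a b s : Lp ℂ p arc)) =
        ε • shiftOp p β (s : Lp ℂ p arc) := by
  rw [mem_imP β hε hab.memLp_subD hab.subD_mul_subD] at hs
  rw [hab.symbol_eq, phi_eq_solveOp, solveOp_spec β hε hab.memLp_subC hab.subC_mul_subC hR,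
    hab.mulOp_right_inv_comp, hs]
  rw [hab.subC_shiftOp_inv_comp, ← hab.inv_right_subD, hs, map_smul, smul_smul, hε, one_smul]

/-- The kernel of `T(a) + ε H_α(b)` if `T(c)` is right invertible. -/
theorem isDirectSum_ker
    (hR : toeplitz p (subC a b) ∘L rightInv p (subC a b) = ContinuousLinearMap.id ℂ _) :
    IsDirectSum (LinearMap.ker ((toeplitz p a + ε • hankel p β b : Hardy p →L[ℂ] Hardy p) :
        Hardy p →ₗ[ℂ] Hardy p))
      (imP p β (-ε) (subC a b))
      ((imP p β ε (subD β a b)).map (phi β p ε a b : Hardy p →ₗ[ℂ] Hardy p)) := by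
  have hε' : -ε * -ε = 1 := by rw [neg_mul_neg, hε]
  have hc := fun f : Hardy p => (mem_imP (s := f) β hε' hab.memLp_subC hab.subC_mul_subC).trans
    (hab.mulOp_subC_eq_iff (f : Lp ℂ p arc))
  have hsq : ∀ x : Lp ℂ p arc, ε • ε • x = x := fun x => by rw [smul_smul, hε, one_smul]
  refine ⟨le_antisymm (fun f hf => ?_) (sup_le (fun f hf => ?_) ?_), ?_⟩
  · have hf' : projP p (mulOp p a (f : Lp ℂ p arc) +
        ε • mulOp p b (shiftOp p β (f : Lp ℂ p arc))) = 0 := by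
      rw [← toeplitz_add_hankel_apply]
      exact hf
    set h := mulOp p a (f : Lp ℂ p arc) + ε • mulOp p b (shiftOp p β (f : Lp ℂ p arc)) with hh
    let s : Hardy p := ⟨shiftOp p β h, shiftOp_mem_Hardy β hf'⟩
    have hs : s ∈ imP p β ε (subD β a b) := by
      rw [mem_imP β hε hab.memLp_subD hab.subD_mul_subD]
      change mulOp p _ (shiftOp p β h) = ε • shiftOp p β (shiftOp p β h)
      rw [shiftOp_shiftOp, hh, hab.subD_shiftOp_symbol hε]
    have hφ := hab.symbol_phi hε hR hs
    have hJ : shiftOp p β (s : Lp ℂ p arc) = h := shiftOp_shiftOp β h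
    -- The symbol of `φ(s)` is `ε J s = ε h`, so `ε φ(s)` has the same symbol `h` as `f`.
    refine Submodule.mem_sup.2 ⟨f - ε • phi β p ε a b s, ?_, ε • phi β p ε a b s,
      Submodule.smul_mem _ _ ⟨s, hs, rfl⟩, sub_add_cancel _ _⟩
    rw [hc, AddSubgroupClass.coe_sub, Submodule.coe_smul]
    simp only [map_sub, map_smul]
    have : ε • (mulOp p a (phi β p ε a b s : Lp ℂ p arc) +
        ε • mulOp p b (shiftOp p β (phi β p ε a b s : Lp ℂ p arc))) = h := by
      rw [hφ, hJ, hsq]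
    have e : h - ε • (mulOp p a (phi β p ε a b s : Lp ℂ p arc) +
        ε • mulOp p b (shiftOp p β (phi β p ε a b s : Lp ℂ p arc))) = 0 := by
      rw [this, sub_self]
    rw [← e, hh, smul_add, smul_sub]
    abel
  · rw [hc] at hf
    change (toeplitz p a + ε • hankel p β b) f = 0
    rw [toeplitz_add_hankel_apply, hf, map_zero]
  · rintro _ ⟨s, hs, rfl⟩
    change (toeplitz p a + ε • hankel p β b) (phi β p ε a b s) = 0
    rw [toeplitz_add_hankel_apply, hab.symbol_phi hε hR hs, map_smul, projP_shiftOp β s.2,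
      smul_zero]
  · rw [Submodule.disjoint_def]
    rintro _ h1 ⟨s, hs, rfl⟩
    have h2 := (hc _).1 h1
    change mulOp p a (phi β p ε a b s : Lp ℂ p arc) +
      ε • mulOp p b (shiftOp p β (phi β p ε a b s : Lp ℂ p arc)) = 0 at h2
    rw [hab.symbol_phi hε hR hs] at h2
    -- An element of both summands has symbol `0` and also `ε J s`; thus `s = 0`.
    have h3 : (s : Lp ℂ p arc) = 0 := by
      rw [← shiftOp_shiftOp β (s : Lp ℂ p arc), ← hsq (shiftOp p β (s : Lp ℂ p arc)), h2,
        smul_zero, map_zero]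
    have h4 : s = 0 := Subtype.ext h3
    rw [h4, map_zero]

theorem rightInvertible {Rc Rd : Hardy p →L[ℂ] Hardy p}
    (hRc : toeplitz p (subC a b) ∘L Rc = ContinuousLinearMap.id ℂ _)
    (hRd : toeplitz p (subD β a b) ∘L Rd = ContinuousLinearMap.id ℂ _) :
    RightInvertible (toeplitz p a + ε • hankel p β b) := by
  have hε' : -ε * -ε = 1 := by rw [neg_mul_neg, hε]
  -- Read from the inside: `s` solves `d s - ε J s = ε y - d J y`, then `h = y + J s` satisfies `d J
  -- h = ε h`, and `f` solves `c f + ε J f = b⁻¹ h`.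
  refine ⟨solveOp β ε (subC a b) Rc ∘L mulOp p (fun t => (b t)⁻¹) ∘L ((Hardy p).subtypeL +
    shiftOp p β ∘L (Hardy p).subtypeL ∘L solveOp β (-ε) (subD β a b) Rd ∘L
      (ε • (Hardy p).subtypeL - mulOp p (subD β a b) ∘L shiftOp p β ∘L (Hardy p).subtypeL)), ?_⟩
  ext1 y
  set w : Lp ℂ p arc := ε • (y : Lp ℂ p arc) -
    mulOp p (subD β a b) (shiftOp p β (y : Lp ℂ p arc)) with hw
  have h1 : mulOp p (subD β a b) (shiftOp p β w) = -ε • w := by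
    rw [hw, map_sub, map_smul, map_sub, map_smul,
      mulOp_shiftOp_mulOp β hab.memLp_subD hab.subD_mul_subD, shiftOp_shiftOp, smul_sub, smul_smul,
      neg_mul, hε, neg_smul, neg_smul, one_smul]
    abel
  set s := solveOp β (-ε) (subD β a b) Rd w with hs
  have h2 := solveOp_spec β hε' hab.memLp_subD hab.subD_mul_subD hRd h1
  rw [← hs] at h2
  set h : Lp ℂ p arc := (y : Lp ℂ p arc) + shiftOp p β (s : Lp ℂ p arc) with hh
  have h3 : mulOp p (subD β a b) (shiftOp p β h) = ε • h := by
    have : mulOp p (subD β a b) (s : Lp ℂ p arc) = w + ε • shiftOp p β (s : Lp ℂ p arc) := by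
      rw [← h2, neg_smul, neg_add_cancel_right]
    rw [hh, map_add, shiftOp_shiftOp, map_add, this, hw, smul_add]
    abel
  have h4 := solveOp_spec β hε hab.memLp_subC hab.subC_mul_subC hRc
    (w := mulOp p (fun t => (b t)⁻¹) h) (by rw [hab.subC_shiftOp_inv_right, h3, map_smul])
  change (toeplitz p a + ε • hankel p β b)
    (solveOp β ε (subC a b) Rc (mulOp p (fun t => (b t)⁻¹) h)) = y
  rw [toeplitz_add_hankel_apply, hab.symbol_eq, h4, hab.mulOp_right_inv, hh, map_add,
    projP_shiftOp β s.2, add_zero, projP_coe]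

/-- From `y = P h` the symbol `h` is recovered as `y + J s`, where `s = J Q h` is determined by
`T(d) s = P (ε y - d J y)`. Then `P (b⁻¹ h) = T(c) f`, as `P J f = 0`. -/
theorem leftInvertible {Lc Ld : Hardy p →L[ℂ] Hardy p}
    (hLc : ∀ f, Lc (toeplitz p (subC a b) f) = f)
    (hLd : ∀ f, Ld (toeplitz p (subD β a b) f) = f) :
    LeftInvertible (toeplitz p a + ε • hankel p β b) := by
  refine ⟨Lc ∘L projP p ∘L mulOp p (fun t => (b t)⁻¹) ∘L ((Hardy p).subtypeL +
    shiftOp p β ∘L (Hardy p).subtypeL ∘L Ld ∘L projP p ∘L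
      (ε • (Hardy p).subtypeL - mulOp p (subD β a b) ∘L shiftOp p β ∘L (Hardy p).subtypeL)), ?_⟩
  ext1 f
  rw [ContinuousLinearMap.comp_apply, toeplitz_add_hankel_apply]
  have h1 := hab.subD_shiftOp_symbol hε (f : Lp ℂ p arc)
  have h2 := hab.symbol_eq (ε := ε) (f : Lp ℂ p arc)
  set h := mulOp p a (f : Lp ℂ p arc) + ε • mulOp p b (shiftOp p β (f : Lp ℂ p arc)) with hh
  set y := projP p h with hy
  let s : Hardy p := ⟨shiftOp p β (projQ p h), shiftOp_mem_Hardy β (projP_projQ h)⟩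
  have hJs : shiftOp p β (s : Lp ℂ p arc) = h - y := shiftOp_shiftOp β _
  have hs : (s : Lp ℂ p arc) = shiftOp p β h - shiftOp p β (y : Lp ℂ p arc) := by
    rw [← map_sub]
    rfl
  have h3 : toeplitz p (subD β a b) s = projP p (ε • (y : Lp ℂ p arc) -
      mulOp p (subD β a b) (shiftOp p β (y : Lp ℂ p arc))) := by
    have h0 : projP p h = projP p (y : Lp ℂ p arc) := by rw [projP_coe]
    rw [toeplitz_apply, hs, map_sub, h1, map_sub, map_sub, map_smul, map_smul, h0]
  have h4 : (y : Lp ℂ p arc) + shiftOp p β (s : Lp ℂ p arc) = h := by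
    rw [hJs, add_sub_cancel]
  change Lc (projP p (mulOp p (fun t => (b t)⁻¹) ((y : Lp ℂ p arc) + shiftOp p β
    (Ld (projP p (ε • (y : Lp ℂ p arc) -
      mulOp p (subD β a b) (shiftOp p β (y : Lp ℂ p arc)))) : Lp ℂ p arc)))) = f
  rw [← h3, hLd, h4, h2, hab.mulOp_inv_right, map_add, map_smul, projP_shiftOp β f.2, smul_zero,
    add_zero, ← toeplitz_apply, hLc]

end IsMatchingPair

end MatchingPair

/-! ### The adjoint operator and its matching pair. -/

section Adjoint

variable {p q : ℝ≥0∞} [hp1 : Fact (1 ≤ p)] [hq1 : Fact (1 ≤ q)] [hpq : p.HolderConjugate q]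
  [hlt : Fact (1 < p)] [hfin : Fact (p < ∞)] [hqlt : Fact (1 < q)] [hqfin : Fact (q < ∞)]
  {β : ℂ} [hβ : Fact (1 < ‖β‖)] {a b : Circle → ℂ}

/-- As `J` is self-adjoint, the adjoint of `b J` is `J conj(b) = conj(b_α) J`. -/
lemma coker_toeplitz_add_hankel (ha : MemLp a ∞ arc) (hb : MemLp b ∞ arc) {ε : ℂ}
    (hε : conj ε = ε) :
    coker q (toeplitz p a + ε • hankel p β b) =
      LinearMap.ker ((toeplitz q (fun t => conj (a t)) +
        ε • hankel q β (fun t => conj (b (alpha β t))) : Hardy q →L[ℂ] Hardy q) :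
          Hardy q →ₗ[ℂ] Hardy q) := by
  have hqp := hpq.symm
  have key : ∀ (f : Hardy p) (g : Hardy q),
      pair ((toeplitz p a + ε • hankel p β b) f : Lp ℂ p arc) (g : Lp ℂ q arc) =
      pair (f : Lp ℂ p arc) ((toeplitz q (fun t => conj (a t)) +
        ε • hankel q β (fun t => conj (b (alpha β t)))) g : Lp ℂ q arc) := fun f g => by
    rw [IsMatchingPair.toeplitz_add_hankel_apply, IsMatchingPair.toeplitz_add_hankel_apply,
      pair_projP_left, pair_projP_right, pair_add_left, pair_add_right, pair_smul_left,
      pair_smul_right, hε, pair_mulOp ha, pair_mulOp hb, pair_shiftOp,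
      shiftOp_mulOp β (memLp_top_conj hb)]
  ext g
  constructor
  · intro h
    refine Hardy_eq_zero_of_pair (q := p) fun f => ?_
    rw [← pair_symm]
    have : pair ((toeplitz p a + ε • hankel p β b) f : Lp ℂ p arc) (g : Lp ℂ q arc) = 0 := h f
    rw [key] at this
    exact (map_eq_zero _).2 this
  · intro h f
    have h0 : (toeplitz q (fun t => conj (a t)) +
        ε • hankel q β (fun t => conj (b (alpha β t)))) g = 0 := h
    refine (key f g).trans ?_
    rw [h0]
    exact pair_zero_right _

omit hp1 hq1 hpq hlt hfin hqlt hqfin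

lemma IsMatchingPair.adjoint (hab : IsMatchingPair β a b) :
    IsMatchingPair β (fun t => conj (a t)) (fun t => conj (b (alpha β t))) where
  memLp_left := memLp_top_conj hab.memLp_left
  memLp_right := memLp_top_conj (memLp_top_comp_alpha β hab.memLp_right)
  ne_zero := by
    filter_upwards [hab.ne_zero] with t h
    exact (map_ne_zero _).2 h
  memLp_inv := by
    simp only [← map_inv₀]
    exact memLp_top_conj hab.memLp_inv
  matching := by
    filter_upwards [hab.matching] with t h
    rw [alpha_alpha, ← map_mul, h, map_mul, mul_comm]

lemma IsMatchingPair.subC_adjoint (hab : IsMatchingPair β a b) :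
    subC (fun t => conj (a t)) (fun t => conj (b (alpha β t))) =ᵐ[arc]
      fun t => conj (subD β a b t) := by
  filter_upwards [hab.matching, hab.ne_zero_right, ae_comp_alpha β hab.ne_zero] with t h1 ⟨h2, h3⟩ h4
  rw [subC, subD, ← map_inv₀, ← map_mul]
  congr 1
  field_simp
  rw [h1, mul_comm]

lemma IsMatchingPair.subD_adjoint (hab : IsMatchingPair β a b) :
    subD β (fun t => conj (a t)) (fun t => conj (b (alpha β t))) =ᵐ[arc]
      fun t => conj (subC a b t) := by
  filter_upwards [hab.matching, hab.ne_zero_right, ae_comp_alpha β hab.ne_zero] with t h1 ⟨h2, h3⟩ h4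
  rw [subC, subD, ← map_inv₀, ← map_mul]
  congr 1
  field_simp
  rw [mul_comm, ← h1, mul_comm]

end Adjoint

/-! ### Right inverses of Toeplitz operators on the dual Hardy space. -/

section AdjointIndex

variable {p q : ℝ≥0∞} [hp1 : Fact (1 ≤ p)] [hq1 : Fact (1 ≤ q)] [hpq : p.HolderConjugate q]
  [hlt : Fact (1 < p)] [hfin : Fact (p < ∞)] [hqlt : Fact (1 < q)] [hqfin : Fact (q < ∞)]
  {g : Circle → ℂ}

/-- If `T(g)` is Fredholm of nonpositive index on `H^p`, then `T(conj g)` is right invertible on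
`H^q`. -/
lemma toeplitz_conj_rightInv (hg : MemLp g ∞ arc) (hg0 : ∀ᵐ t ∂arc, g t ≠ 0)
    (hF : (toeplitz p g).IsFredholm) (hk : index (toeplitz p g) ≤ 0) :
    toeplitz q (fun t => conj (g t)) ∘L rightInv q (fun t => conj (g t)) =
      ContinuousLinearMap.id ℂ _ := by
  obtain ⟨n, hn⟩ : ∃ n : ℕ, index (toeplitz p g) = -(n : ℤ) :=
    ⟨(-index (toeplitz p g)).toNat, by omega⟩
  -- Bijectivity of `T(g t^{-n})` passes to `T(conj(g) t^n)` on `H^q`; dividing its symbol by `t^n`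
  -- shows that `T(conj g)` has index `n`, the exponent built into `rightInv`.
  have hb := bijective_toeplitz_conj (q := q) (memLp_top_mul hg (memLp_top_zpow _))
    (toeplitz_of_isFredholm hg hg0 hF).1
  have e : (fun t : Circle => conj (g t * (t : ℂ) ^ index (toeplitz p g))) =
      fun t : Circle => conj (g t) * (t : ℂ) ^ (n : ℤ) := by
    funext t
    rw [hn, map_mul, conj_zpow, neg_neg]
  rw [e] at hb
  have hi := index_of_bijective (memLp_top_mul (memLp_top_conj hg) (memLp_top_zpow _)) hb n
  rw [toeplitz_zpow_comp_congr (k := 0) (by ring), toeplitz_zpow_zero] at hi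
  exact toeplitz_rightInv (memLp_top_conj hg) (by omega) (by rwa [hi])

end AdjointIndex

end AlphaTH

end

/-! ### The three cases of the theorem. -/

theorem theorem5p1 (β : ℂ) [Fact (1 < ‖β‖)] (p q : ℝ≥0∞) [Fact (1 ≤ p)] [Fact (1 ≤ q)]
    [p.HolderConjugate q] (hp : 1 < p) (hp' : p < ∞) (a b : Circle → ℂ)
    (hab : AlphaTH.IsFredholmPair β p a b) :
    let c : Circle → ℂ := AlphaTH.subC a b
    let d : Circle → ℂ := AlphaTH.subD β a b
    let κ₁ : ℤ := AlphaTH.index (AlphaTH.toeplitz p c)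
    let κ₂ : ℤ := AlphaTH.index (AlphaTH.toeplitz p d)
    let cbar : Circle → ℂ := fun t => conj (c t)
    let dbar : Circle → ℂ := fun t => conj (d t)
    let abar : Circle → ℂ := fun t => conj (a t)
    let bbar : Circle → ℂ := fun t => conj (b (AlphaTH.alpha β t))
    -- the operators `T(a) + H_α(b)` (for `ε = 1`) and `T(a) - H_α(b)` (for `ε = -1`)
    let A : ℂ → (AlphaTH.Hardy p →L[ℂ] AlphaTH.Hardy p) :=
      fun ε => AlphaTH.toeplitz p a + ε • AlphaTH.hankel p β b
    (0 ≤ κ₁ → 0 < κ₂ →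
      AlphaTH.toeplitz p c ∘L AlphaTH.rightInv p c = ContinuousLinearMap.id ℂ _ ∧
      ∀ ε : ℂ, ε = 1 ∨ ε = -1 →
        AlphaTH.RightInvertible (A ε) ∧
        AlphaTH.IsDirectSum (LinearMap.ker (A ε : AlphaTH.Hardy p →ₗ[ℂ] AlphaTH.Hardy p))
          (AlphaTH.imP p β (-ε) c)
          ((AlphaTH.imP p β ε d).map
            (AlphaTH.phi β p ε a b : AlphaTH.Hardy p →ₗ[ℂ] AlphaTH.Hardy p))) ∧
    (κ₁ < 0 → κ₂ ≤ 0 →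
      AlphaTH.toeplitz q dbar ∘L AlphaTH.rightInv q dbar = ContinuousLinearMap.id ℂ _ ∧
      ∀ ε : ℂ, ε = 1 ∨ ε = -1 →
        AlphaTH.LeftInvertible (A ε) ∧
        AlphaTH.IsDirectSum (AlphaTH.coker q (A ε))
          (AlphaTH.imP q β (-ε) dbar)
          ((AlphaTH.imP q β ε cbar).map
            (AlphaTH.phi β q ε abar bbar : AlphaTH.Hardy q →ₗ[ℂ] AlphaTH.Hardy q)) ∧
        (κ₂ = 0 → AlphaTH.imP q β ε dbar = ⊥)) ∧
    (0 ≤ κ₁ → κ₂ ≤ 0 →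
      ∀ ε : ℂ, ε = 1 ∨ ε = -1 →
        LinearMap.ker (A ε : AlphaTH.Hardy p →ₗ[ℂ] AlphaTH.Hardy p) =
          AlphaTH.imP p β (-ε) c ∧
        AlphaTH.coker q (A ε) = AlphaTH.imP q β (-ε) dbar) := by
 
  intro c d κ₁ κ₂ cbar dbar abar bbar A
  have hpf : Fact (1 < p) := ⟨hp⟩
  have hpf' : Fact (p < ∞) := ⟨hp'⟩
  have hqf : Fact (1 < q) := ⟨AlphaTH.one_lt_conj hp'⟩
  have hqf' : Fact (q < ∞) := ⟨AlphaTH.conj_lt_top (p := p) hp⟩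
  obtain ⟨hm, hFc, hFd⟩ := hab
  have hsq : ∀ ε : ℂ, ε = 1 ∨ ε = -1 → ε * ε = 1 := by
    rintro ε (rfl | rfl) <;> norm_num
  have hconj : ∀ ε : ℂ, ε = 1 ∨ ε = -1 → conj ε = ε := by
    rintro ε (rfl | rfl) <;> simp
  obtain ⟨hcb, hcs, hci⟩ := AlphaTH.toeplitz_of_isFredholm hm.memLp_subC hm.subC_ne_zero hFc
  obtain ⟨hdb, hds, hdi⟩ := AlphaTH.toeplitz_of_isFredholm hm.memLp_subD hm.subD_ne_zero hFd
  have hCbar := hm.subD_adjoint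
  have hDbar := hm.subC_adjoint
  -- The kernel theorem for the adjoint pair needs only `κ₂ ≤ 0`, since its first subordinated
  -- function is `conj d`; it serves both (ii) and (iii).
  have hker : ∀ ε : ℂ, ε = 1 ∨ ε = -1 → κ₂ ≤ 0 →
      AlphaTH.IsDirectSum (AlphaTH.coker q (A ε)) (AlphaTH.imP q β (-ε) dbar)
        ((AlphaTH.imP q β ε cbar).map
          (AlphaTH.phi β q ε abar bbar : AlphaTH.Hardy q →ₗ[ℂ] AlphaTH.Hardy q)) := by
    intro ε hε hk
    have hR := AlphaTH.toeplitz_conj_rightInv (q := q) hm.memLp_subD hm.subD_ne_zero hFd hk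
    rw [← AlphaTH.toeplitz_congr hDbar, ← AlphaTH.rightInv_congr hDbar] at hR
    have := hm.adjoint.isDirectSum_ker (hsq ε hε) hR
    rw [AlphaTH.imP_congr (p := q) β _ hDbar, AlphaTH.imP_congr (p := q) β _ hCbar,
      ← AlphaTH.coker_toeplitz_add_hankel (p := p) hm.memLp_left hm.memLp_right (hconj ε hε)] at this
    exact this
  refine ⟨fun h1 h2 => ⟨AlphaTH.toeplitz_rightInv hm.memLp_subC h1 hcb, fun ε hε => ⟨?_, ?_⟩⟩,
    fun h1 h2 => ⟨AlphaTH.toeplitz_conj_rightInv hm.memLp_subD hm.subD_ne_zero hFd h2,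
      fun ε hε => ⟨?_, hker ε hε h2, fun h3 => ?_⟩⟩, fun h1 h2 ε hε => ⟨?_, ?_⟩⟩
  · exact hm.rightInvertible (hsq ε hε) (AlphaTH.toeplitz_rightInv hm.memLp_subC h1 hcb)
      (AlphaTH.toeplitz_rightInv hm.memLp_subD h2.le hdb)
  · exact hm.isDirectSum_ker (hsq ε hε) (AlphaTH.toeplitz_rightInv hm.memLp_subC h1 hcb)
  · obtain ⟨Lc, hLc⟩ := AlphaTH.exists_leftInv hm.memLp_subC h1.le hcb
    obtain ⟨Ld, hLd⟩ := AlphaTH.exists_leftInv hm.memLp_subD h2 hdb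
    exact hm.leftInvertible (hsq ε hε) hLc hLd
  · have hi := AlphaTH.injective_toeplitz_conj (q := q) hm.memLp_subD (hds h3.ge)
    rw [← AlphaTH.toeplitz_congr hDbar] at hi
    rw [← AlphaTH.imP_congr (p := q) β ε hDbar]
    exact AlphaTH.imP_eq_bot β (hsq ε hε) hm.adjoint.memLp_subC hm.adjoint.subC_mul_subC hi
  -- For `κ₂ ≤ 0` the operator `T(d)` is injective, so the second summand vanishes.
  · have h := (hm.isDirectSum_ker (hsq ε hε) (AlphaTH.toeplitz_rightInv hm.memLp_subC h1 hcb)).1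
    rwa [AlphaTH.imP_eq_bot β (hsq ε hε) hm.memLp_subD hm.subD_mul_subD (hdi h2),
      Submodule.map_bot, sup_bot_eq] at h
  · have h := (hker ε hε h2).1
    -- Likewise `κ₁ ≥ 0` makes `T(c)` surjective, hence `T(conj c)` injective on `H^q`.
    have hi := AlphaTH.injective_toeplitz_conj (q := q) hm.memLp_subC (hcs h1)
    rw [← AlphaTH.toeplitz_congr hCbar] at hi
    rwa [← AlphaTH.imP_congr (p := q) β ε hCbar, AlphaTH.imP_eq_bot β (hsq ε hε) hm.adjoint.memLp_subD
      hm.adjoint.subD_mul_subD hi, Submodule.map_bot, sup_bot_eq] at h
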